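/- **Lemma (Wavelet System Complexity).** *Networks.* For $r\in\mathbb N$ let $\rho_r(t)=\max\{0,t\}^r$. A network $\Phi$ with $d$ inputs and one output is given by affine maps $T_l:x\mapsto A_lx+b_l$, $1\le l\le D$ ($D\ge 1$), between spaces $\mathbb R^{N_{l-1}}\to\mathbb R^{N_l}$ with $N_0=d$, $N_D=1$, $N_l\ge 1$, and, for $1\le l\le D-1$, componentwise activations $\boldsymbol\sigma_l$, each component being either the identity or $\rho_r$. Its realization is $\mathcal R(\Phi)=T_D\circ\boldsymbol\sigma_{D-1}\circ\cdots\circ\boldsymbol\sigma_1\circ T_1$, its depth is $D$, and $W(\Phi)$ is the total number of nonzero entries of the matrices $A_l$. For fixed $0<p\le\infty$, $\mathsf{RePU}^{r,d,1}_w$ is the set of such $\Phi$ with $\mathcal R(\Phi)\in L^p(\mathbb R^d)$ and $W(\Phi)\le w$; $\mathsf{ReLU}^{d,1}_w=\mathsf{RePU}^{1,d,1}_w$. *Wavelets.* Let $\varphi:\mathbb R\to\mathbb R$ be compactly supported and piecewise polynomial of order $L$ with at most $N_\varphi$ breakpoints, i.e. there is a set of at most $N_\varphi$ points such that on every interval avoiding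 them $\varphi$ is a polynomial of degree at most $L-1$ (the values at the breakpoints are arbitrary). Let $\psi=\sum_{k\in\mathbb Z}g_k\,\varphi(2\,\cdot-k)$ with at most $N_\psi$ nonzero coefficients $g_k\in\mathbb R$. Put $\psi^1=\psi$, $\psi^0=\varphi$, $\psi^e(x)=\psi^{e_1}(x_1)\cdots\psi^{e_d}(x_d)$ for $e\in\{0,1\}^d\setminus\{0\}$, and, for $\lambda=(e,j,k)\in\nabla=(\{0,1\}^d\setminus\{0\})\times\mathbb Z\times\mathbb Z^d$ and $0<p\le\infty$, $$\psi_{\lambda,p}(x)=2^{dj/p}\,\psi^e(2^jx-k),\qquad 2^{dj/\infty}:=1 .$$ If $p=\infty$, assume in addition that $\varphi$ is continuous. The support of $\psi_{\lambda,p}$ is its support as an element of $L^p$ (the set of points each of whose neighbourhoods meets $\{\psi_{\lambda,p}\ne0\}$ in positive Lebesgue measure); for continuous functions, such as $\mathcal R(\Phi)$, this is the closure of the set where the function is nonzero. $\|\cdot\|_{L^\infty}$ is the essential supremum and $|\cdot|$ is Lebesgue measure. (i) For every $r\ge2$ there is a constant $c>0$ depending only on $r$, and for all $d,L,N_\varphi,N_\psi$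 there is a constant $C>0$ depending only on $r,d,L,N_\varphi,N_\psi$, such that for all $\varphi,\psi$ as above, all $0<p\le\infty$, all $\lambda\in\nabla$ and all $\varepsilon>0$ there is a network $\Phi\in\mathsf{RePU}^{r,d,1}_{C}$ with $$\operatorname{supp}\mathcal R(\Phi)=\operatorname{supp}\psi_{\lambda,p},\qquad \|\psi_{\lambda,p}-\mathcal R(\Phi)\|_{L^p(\mathbb R^d)}\le\varepsilon,$$ and depth at most $c\,(1+\log L+\log d)$. (ii) For all $p_0,S,M$ with $0<p_0<\infty$ and $S,M\geq 0$ there is a constant $c>0$ depending only on $p_0,S,M$, and for all $d,L,N_\varphi,N_\psi$ there is a constant $C>0$ depending only on $p_0,S,M,d,L,N_\varphi,N_\psi$, such that for all $\varphi,\psi$ as above with $|\operatorname{supp}\varphi|,|\operatorname{supp}\psi|\le S$ and $\|\varphi\|_{L^\infty},\|\psi\|_{L^\infty}\le M$, all $p_0\le p\le\infty$, all $\lambda\in\nabla$ and all $0<\varepsilon<1$ there is a network $\Phi\in\mathsf{ReLU}^{d,1}_{C(1+\log\varepsilon^{-1})}$ with $$\operatorname{supp}\mathcal R(\Phi)=\operatorname{supp}\psi_{\lambda,p},\qquad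 \|\psi_{\lambda,p}-\mathcal R(\Phi)\|_{L^p(\mathbb R^d)}\le\varepsilon,$$ and depth at most $c\,(1+L\log L)(1+d\log d)(1+\log\varepsilon^{-1})$. (Convention: $0\log 0=0$, and $\log 0$ is read as $0$ in the depth bounds.) -/

import Mathlib

open MeasureTheory
open scoped ENNReal NNReal Topology

noncomputable section

/-! ### Rectifier networks -/

/-- The rectified power unit `ρ_r(t) = max{0, t} ^ r`. -/
def repu (r : ℕ) (t : ℝ) : ℝ := max 0 t ^ r

/-- The two activation functions a neuron may carry: the identity or `ρ_r`. -/
inductive Activation where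
  | ident : Activation
  | rect : Activation

/-- The function `ℝ → ℝ` denoted by an activation, for networks of degree `r`. -/
def Activation.toFun (r : ℕ) : Activation → ℝ → ℝ
  | .ident, t => t
  | .rect, t => repu r t

/-- Feed-forward networks with `n` inputs and `m` outputs: a list of affine maps
`x ↦ A x + b`, alternating with layers of componentwise activations, which starts and ends
with an affine map.  Every hidden layer has at least one neuron. -/
inductive RectNet : ℕ → ℕ → Type where
  | output {n m : ℕ} (A : Matrix (Fin m) (Fin n) ℝ) (b : Fin m → ℝ) : RectNet n m
  | hidden {n k m : ℕ} (hk : 0 < k) (A : Matrix (Fin k) (Fin n) ℝ) (b : Fin k → ℝ)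
      (σ : Fin k → Activation) (rest : RectNet k m) : RectNet n m

/-- The realization `T_L ∘ σ_{L-1} ∘ ⋯ ∘ σ_1 ∘ T_1`, with activations of degree `r`. -/
def RectNet.realize (r : ℕ) : {n m : ℕ} → RectNet n m → (Fin n → ℝ) → (Fin m → ℝ)
  | _, _, .output A b, x => A.mulVec x + b
  | _, _, .hidden _ A b σ rest, x =>
      rest.realize r (fun i => (σ i).toFun r ((A.mulVec x + b) i))

/-- The number of nonzero entries of a matrix. -/
def matrixNNZ {m n : ℕ} (A : Matrix (Fin m) (Fin n) ℝ) : ℕ :=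
  {q : Fin m × Fin n | A q.1 q.2 ≠ 0}.ncard

/-- The number of nonzero weights `W(Φ) = ∑_l ‖A_l‖_{ℓ⁰}`. -/
def RectNet.weights : {n m : ℕ} → RectNet n m → ℕ
  | _, _, .output A _ => matrixNNZ A
  | _, _, .hidden _ A _ _ rest => matrixNNZ A + rest.weights

/-- The depth: the number `L` of layers, i.e. of affine maps. -/
def RectNet.depth : {n m : ℕ} → RectNet n m → ℕ
  | _, _, .output _ _ => 1
  | _, _, .hidden _ _ _ _ rest => rest.depth + 1

/-- The realization of a network with one output, as a real-valued function. -/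
def RectNet.realizeScalar (r : ℕ) {d : ℕ} (Φ : RectNet d 1) (x : Fin d → ℝ) : ℝ :=
  Φ.realize r x 0

/-- `RePU^{r,d,1}_w`, with ambient space `X = L^p(ℝ^d)`: networks with realization in `L^p`
and at most `w` nonzero weights. -/
def RePUClass (r d : ℕ) (p : ℝ≥0∞) (w : ℝ) : Set (RectNet d 1) :=
  {Φ | MemLp (Φ.realizeScalar r) p volume ∧ (Φ.weights : ℝ) ≤ w}

/-- `ReLU^{d,1}_w = RePU^{1,d,1}_w`. -/
abbrev ReLUClass (d : ℕ) (p : ℝ≥0∞) (w : ℝ) : Set (RectNet d 1) := RePUClass 1 d p w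

/-! ### Piecewise polynomials and tensor product wavelets -/

/-- `f` is piecewise polynomial of order `L` (degree at most `L - 1`) with at most `N`
breakpoints: on every interval, bounded or not, that contains no breakpoint, `f` agrees with
one polynomial of degree less than `L`.  The values at the breakpoints are arbitrary. -/
def IsPiecewisePolynomial (L N : ℕ) (f : ℝ → ℝ) : Prop :=
  ∃ T : Finset ℝ, T.card ≤ N ∧
    ∀ I : Set ℝ, I.OrdConnected → Disjoint I (T : Set ℝ) →
      ∃ P : Polynomial ℝ, P.degree < (L : WithBot ℕ) ∧ ∀ x ∈ I, f x = P.eval x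

/-- The wavelet `ψ = ∑_k g_k φ(2 · - k)` with finitely many nonzero coefficients. -/
def motherWavelet (φ : ℝ → ℝ) (g : ℤ →₀ ℝ) (x : ℝ) : ℝ :=
  g.sum fun k c => c * φ (2 * x - k)

/-- The index set `∇` of triples `(e, j, k)` with `e ∈ {0,1}^d \ {0}`, `j ∈ ℤ`, `k ∈ ℤ^d`. -/
structure WaveletIndex (d : ℕ) where
  e : Fin d → Bool
  e_ne_zero : ∃ i, e i = true
  j : ℤ
  k : Fin d → ℤ

/-- `ψ^e(x) = ψ^{e_1}(x_1) ⋯ ψ^{e_d}(x_d)`, with `ψ^1 = ψ` and `ψ^0 = φ`. -/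
def tensorWavelet (φ ψ : ℝ → ℝ) {d : ℕ} (e : Fin d → Bool) (x : Fin d → ℝ) : ℝ :=
  ∏ i, if e i then ψ (x i) else φ (x i)

/-- `ψ_{λ,p}(x) = 2^{d j / p} ψ^e(2^j x - k)` for `λ = (e, j, k)`.  For `p = ∞` one has
`p.toReal = 0`, so that the exponent, hence the normalization `2^{d j / ∞} = 1`, is right. -/
def wavelet (φ ψ : ℝ → ℝ) {d : ℕ} (lam : WaveletIndex d) (p : ℝ≥0∞) (x : Fin d → ℝ) : ℝ :=
  (2 : ℝ) ^ ((d : ℝ) * (lam.j : ℝ) / p.toReal) *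
    tensorWavelet φ ψ lam.e (fun i => (2 : ℝ) ^ lam.j * x i - (lam.k i : ℝ))

/-! ### Supports -/

/-- The (essential) support of `f` as an element of `L^p(ℝ^d)`: the points all of whose
neighbourhoods meet `{f ≠ 0}` in positive Lebesgue measure. -/
def essSupport {d : ℕ} (f : (Fin d → ℝ) → ℝ) : Set (Fin d → ℝ) :=
  {x | ∀ U ∈ 𝓝 x, 0 < volume (U ∩ {y | f y ≠ 0})}

/-- The essential support is the closure of `{f ≠ 0}` if `f` is continuous, or continuous from
the right in the coordinatewise order (as the tensor wavelets of a right-continuous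
`φ` are). -/
theorem essSupport_eq_tsupport {d : ℕ} (f : (Fin d → ℝ) → ℝ)
    (hf : ∀ x, ContinuousWithinAt f (Set.Ici x) x) : essSupport f = tsupport f := by
  ext x
  constructor
  · intro hx
    refine mem_closure_iff_nhds.2 fun U hU => ?_
    exact nonempty_of_measure_ne_zero (hx U hU).ne'
  · intro hx U hU
    obtain ⟨V, hVU, hV, hxV⟩ := mem_nhds_iff.1 hU
    obtain ⟨y, hyV, hy⟩ := mem_closure_iff.1 hx V hV hxV
    have h1 : f ⁻¹' {0}ᶜ ∈ 𝓝[Set.Ici y] y :=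
      (hf y).preimage_mem_nhdsWithin (isOpen_compl_singleton.mem_nhds hy)
    obtain ⟨W, hW, hyW, hWs⟩ := mem_nhdsWithin.1 h1
    have hO : IsOpen (V ∩ W ∩ {z : Fin d → ℝ | ∀ i, y i < z i}) := by
      refine (hV.inter hW).inter ?_
      simp only [Set.ofPred_forall]
      exact isOpen_iInter_of_finite fun i => isOpen_lt continuous_const (continuous_apply i)
    have hne : (V ∩ W ∩ {z : Fin d → ℝ | ∀ i, y i < z i}).Nonempty := by
      have hc : Filter.Tendsto (fun t : ℝ => fun i => y i + t) (𝓝[>] 0) (𝓝 y) := by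
        have : Continuous (fun t : ℝ => fun i => y i + t) := by fun_prop
        have h := this.tendsto 0
        simp only [add_zero] at h
        exact h.mono_left nhdsWithin_le_nhds
      have h2 : ∀ᶠ t : ℝ in 𝓝[>] 0, (fun i => y i + t) ∈ V ∩ W :=
        hc.eventually ((hV.inter hW).mem_nhds ⟨hyV, hyW⟩)
      have h3 : ∀ᶠ t : ℝ in 𝓝[>] 0, 0 < t := self_mem_nhdsWithin
      obtain ⟨t, ht, ht0⟩ := (h2.and h3).exists
      exact ⟨_, ht, fun i => by simpa using ht0⟩
    refine (hO.measure_pos volume hne).trans_le (measure_mono ?_)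
    rintro z ⟨⟨hzV, hzW⟩, hz⟩
    exact ⟨hVU hzV, hWs ⟨hzW, fun i => (hz i).le⟩⟩

end

noncomputable section

/-! ### Functions computed by the layers of a network -/

/-! A wavelet is a constant times a product of `d` compactly supported piecewise polynomials of one
variable. This product has to be approximated by a network of controlled size whose support is
exactly right.

In one variable, each polynomial piece is multiplied by a cutoff with ramps of width `1 / K` that is
positive exactly on its interval. For a continuous function, bumps at the breakpoints complete the
cutoffs to a partition of unity on every interval (`one_sub_plateau_eq_sum`), and convergence as `K
→ ∞` is uniform. Without continuity the error of the cutoffs is bounded and lives on a set of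
measure tending to zero, which suffices for `p < ∞`. The bound on the number of weights does not
involve `K`, so `K` may be as large as desired.

Each piece is put in Lagrange form at equidistant nodes (`exists_lagrange`), with coefficients
controlled by `12 ^ L` times the sup bound. The cutoff fills the slot of the omitted node factor, so
the tensor product becomes a linear combination of products of `d * L` factors, each in `[-1, 1]`
where no cutoff vanishes. Polarization reduces such products to one power function
(`prod_eq_sum_powerset`). When the power is replaced by any other function, the alternating sum
still vanishes exactly as soon as one factor does (`sum_powerset_eq_zero`). Hence the network is
zero wherever a cutoff is, and inactive pieces cause no error. For `r ≥ 2` powers are exact at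
logarithmic depth; for `r = 1` they come from repeated approximate squaring, `m` layers per squaring
giving accuracy of order `4 ^ (-m)`.

The approximation `G` might vanish on an open part of the support. Adding `η * B`, with `B` positive
exactly on the open product set, cures this for all but countably many `η`
(`exists_interior_eq_empty`).

Finally, the factor `2 ^ (d j / p)` cancels the dilation of the supports (`normalized_volume_le`).
For ReLU networks all constants in the error are then absorbed in a power `Γ ^ (d L)`, so `m` of
order `d L (1 + log ε⁻¹)` is enough; about `log (d L)` squarings give the depth. -/

/-- The affine combinations of a set of functions. -/
def affSpan {X : Type*} (T : Set (X → ℝ)) : Submodule ℝ (X → ℝ) := Submodule.span ℝ (insert 1 T)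

theorem affSpan_mono {X : Type*} {T T' : Set (X → ℝ)} (h : T ⊆ T') : affSpan T ≤ affSpan T' :=
  Submodule.span_mono (Set.insert_subset_insert h)

theorem one_mem_affSpan {X : Type*} (T : Set (X → ℝ)) : (1 : X → ℝ) ∈ affSpan T :=
  Submodule.subset_span (Set.mem_insert _ _)

theorem const_mem_affSpan {X : Type*} (T : Set (X → ℝ)) (c : ℝ) : (fun _ => c) ∈ affSpan T := by
  convert (affSpan T).smul_mem c (one_mem_affSpan T) using 1
  ext x
  simp

theorem subset_affSpan {X : Type*} (T : Set (X → ℝ)) : T ⊆ affSpan T :=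
  fun _ hf => Submodule.subset_span (Set.mem_insert_of_mem _ hf)

theorem affSpan_le {X : Type*} {T T' : Set (X → ℝ)} (h : T ⊆ affSpan T') :
    affSpan T ≤ affSpan T' :=
  Submodule.span_le.2 (Set.insert_subset (one_mem_affSpan _) h)

/-- `IsLayer r d w D T`: the functions in `T` are those computed by the neurons of the `D`-th
layer of a network with `d` inputs, all of whose hidden layers have at most `w` neurons. -/
inductive IsLayer (r d w : ℕ) : ℕ → Set ((Fin d → ℝ) → ℝ) → Prop
  | zero : IsLayer r d w 0 (Set.range fun i x => x i)
  | succ {D : ℕ} {T T' : Set ((Fin d → ℝ) → ℝ)} (h : IsLayer r d w D T) (hfin : T'.Finite)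
      (hcard : T'.ncard ≤ w) (hT : ∀ g ∈ T', ∃ u ∈ affSpan T, g = u ∨ g = repu r ∘ u) :
      IsLayer r d w (D + 1) T'

theorem IsLayer.mono {r d w w' D : ℕ} {T : Set ((Fin d → ℝ) → ℝ)} (h : IsLayer r d w D T)
    (hw : w ≤ w') : IsLayer r d w' D T := by
  induction h with
  | zero => exact .zero
  | succ _ hf hc hT ih => exact .succ ih hf (hc.trans hw) hT

theorem IsLayer.union {r d w₁ w₂ D : ℕ} {T₁ T₂ : Set ((Fin d → ℝ) → ℝ)}
    (h₁ : IsLayer r d w₁ D T₁) (h₂ : IsLayer r d w₂ D T₂) :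
    IsLayer r d (w₁ + w₂) D (T₁ ∪ T₂) := by
  induction h₁ generalizing T₂ with
  | zero =>
    cases h₂
    rw [Set.union_self]
    exact .zero
  | @succ D S₁ T₁ _ hf₁ hc₁ hT₁ ih =>
    cases h₂ with
    | @succ _ S₂ _ h₂ hf₂ hc₂ hT₂ =>
      refine .succ (ih h₂) (hf₁.union hf₂)
        ((Set.ncard_union_le _ _).trans (add_le_add hc₁ hc₂)) ?_
      rintro g (hg | hg)
      · obtain ⟨u, hu, h⟩ := hT₁ g hg
        exact ⟨u, affSpan_mono Set.subset_union_left hu, h⟩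
      · obtain ⟨u, hu, h⟩ := hT₂ g hg
        exact ⟨u, affSpan_mono Set.subset_union_right hu, h⟩

theorem continuous_repu (r : ℕ) : Continuous (repu r) := by
  unfold repu
  fun_prop

theorem continuous_of_mem_affSpan {X : Type*} [TopologicalSpace X] {T : Set (X → ℝ)}
    (hT : ∀ g ∈ T, Continuous g) {u : X → ℝ} (hu : u ∈ affSpan T) : Continuous u := by
  refine Submodule.span_induction (p := fun u _ => Continuous u) ?_ ?_ ?_ ?_ hu
  · rintro f (rfl | hf)
    · exact continuous_const
    · exact hT f hf
  · exact continuous_const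
  · exact fun f g _ _ hf hg => hf.add hg
  · exact fun c f _ hf => hf.const_smul c

theorem IsLayer.continuous {r d w D : ℕ} {T : Set ((Fin d → ℝ) → ℝ)} (h : IsLayer r d w D T) :
    ∀ g ∈ T, Continuous g := by
  induction h with
  | zero =>
    rintro _ ⟨i, rfl⟩
    exact continuous_apply i
  | succ _ _ _ hT ih =>
    intro g hg
    obtain ⟨u, hu, rfl | rfl⟩ := hT g hg
    · exact continuous_of_mem_affSpan ih hu
    · exact (continuous_repu r).comp (continuous_of_mem_affSpan ih hu)

theorem mem_affSpan_range {X : Type*} {k : ℕ} {F : Fin k → X → ℝ} {u : X → ℝ}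
    (hu : u ∈ affSpan (Set.range F)) :
    ∃ (a : Fin k → ℝ) (b : ℝ), ∀ x, u x = a ⬝ᵥ (fun i => F i x) + b := by
  obtain ⟨b, v, hv, rfl⟩ := Submodule.mem_span_insert.1 hu
  obtain ⟨a, rfl⟩ := (Submodule.mem_span_range_iff_exists_fun ℝ).1 hv
  refine ⟨a, b, fun x => ?_⟩
  simp [dotProduct, add_comm]

theorem matrixNNZ_le {m n : ℕ} (A : Matrix (Fin m) (Fin n) ℝ) : matrixNNZ A ≤ m * n := by
  refine (Set.ncard_le_ncard (Set.subset_univ _)).trans ?_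
  simp [Set.ncard_univ, Nat.card_eq_fintype_card]

/-- The functions of a layer can be fed into any network. -/
theorem IsLayer.exists_feed {r d w D : ℕ} {T : Set ((Fin d → ℝ) → ℝ)} (h : IsLayer r d w D T) :
    ∃ k ≤ max d (w + 1), ∃ F : Fin k → (Fin d → ℝ) → ℝ, T ⊆ Set.range F ∧
      ∀ Ψ : RectNet k 1, ∃ Φ : RectNet d 1,
        (∀ x, Φ.realizeScalar r x = Ψ.realizeScalar r fun i => F i x) ∧
        Φ.depth = Ψ.depth + D ∧ Φ.weights ≤ Ψ.weights + D * max d (w + 1) ^ 2 := by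
  induction h with
  | zero =>
    exact ⟨d, le_max_left _ _, fun i x => x i, subset_rfl, fun Ψ =>
      ⟨Ψ, fun x => rfl, by simp, by simp⟩⟩
  | @succ D S T _ hf hc hT ih =>
    obtain ⟨k, hk, F, hF, hfeed⟩ := ih
    -- A hidden layer must have a neuron, but `T` may be empty. The adjoined constant function
    -- prevents this and explains the `w + 1` in the bounds.
    have hf' : (insert 1 T).Finite := hf.insert 1
    set k' := (insert 1 T).ncard with hk'
    have hk0 : 0 < k' := (Set.ncard_pos hf').2 (Set.insert_nonempty _ _)
    have hkw : k' ≤ max d (w + 1) :=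
      ((Set.ncard_insert_le _ _).trans (by omega)).trans (le_max_right _ _)
    have := hf'.fintype
    have e : Fin k' ≃ (insert 1 T : Set ((Fin d → ℝ) → ℝ)) :=
      (Fintype.equivFinOfCardEq (by rw [hk', Set.ncard_eq_toFinset_card', Set.toFinset_card])).symm
    have hT' : ∀ j : Fin k', ∃ (a : Fin k → ℝ) (b : ℝ) (σ : Activation),
        ∀ x, (e j : (Fin d → ℝ) → ℝ) x = σ.toFun r (a ⬝ᵥ (fun i => F i x) + b) := by
      intro j
      have key : ∃ u ∈ affSpan S, (e j : (Fin d → ℝ) → ℝ) = u ∨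
          (e j : (Fin d → ℝ) → ℝ) = repu r ∘ u := by
        rcases (e j).2 with h1 | h1
        · exact ⟨1, one_mem_affSpan _, Or.inl h1⟩
        · exact hT _ h1
      obtain ⟨u, hu, h⟩ := key
      obtain ⟨a, b, hab⟩ := mem_affSpan_range (affSpan_mono hF hu)
      rcases h with h | h
      · exact ⟨a, b, .ident, fun x => by rw [h, hab]; rfl⟩
      · exact ⟨a, b, .rect, fun x => by rw [h, Function.comp_apply, hab]; rfl⟩
    choose a b σ hab using hT'
    refine ⟨k', hkw, fun j => e j, fun g hg => ⟨e.symm ⟨g, Set.mem_insert_of_mem _ hg⟩, by simp⟩,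
      fun Ψ => ?_⟩
    -- Networks grow at the input end and layers at the output end. The new layer is therefore put
    -- in front of the continuation `Ψ`, and the result is fed by the preceding layers.
    obtain ⟨Φ, h1, h2, h3⟩ := hfeed (.hidden hk0 (Matrix.of a) b σ Ψ)
    refine ⟨Φ, fun x => ?_, ?_, ?_⟩
    · rw [h1]
      simp only [RectNet.realizeScalar, RectNet.realize]
      congr 1
      ext j
      rw [hab]
      rfl
    · rw [h2, RectNet.depth]; omega
    · rw [RectNet.weights] at h3
      have : matrixNNZ (Matrix.of a) ≤ max d (w + 1) ^ 2 := by
        rw [sq]; exact (matrixNNZ_le _).trans (Nat.mul_le_mul hkw hk)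
      calc Φ.weights ≤ _ := h3
        _ ≤ max d (w + 1) ^ 2 + Ψ.weights + D * max d (w + 1) ^ 2 := by gcongr
        _ = _ := by ring

/-! ### Closure properties of computable functions. -/

/-- All functions in `A` are affine combinations of the neurons of the `D`-th layer of one
network of width at most `w`. -/
def NetComputable (r d w D : ℕ) (A : Set ((Fin d → ℝ) → ℝ)) : Prop :=
  ∃ T, IsLayer r d w D T ∧ A ⊆ affSpan T

theorem NetComputable.exists_net {r d w D : ℕ} {f : (Fin d → ℝ) → ℝ} (h : NetComputable r d w D {f}) :
    ∃ Φ : RectNet d 1, Φ.realizeScalar r = f ∧ Φ.depth = D + 1 ∧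
      Φ.weights ≤ (D + 1) * max d (w + 1) ^ 2 := by
  obtain ⟨T, hT, hf⟩ := h
  obtain ⟨k, hk, F, hF, hfeed⟩ := hT.exists_feed
  obtain ⟨a, b, hab⟩ := mem_affSpan_range (affSpan_mono hF (hf rfl))
  obtain ⟨Φ, h1, h2, h3⟩ := hfeed (.output (Matrix.of fun _ => a) fun _ => b)
  refine ⟨Φ, ?_, ?_, ?_⟩
  · ext x
    rw [h1, hab]
    rfl
  · rw [h2, RectNet.depth]; omega
  · have h4 : matrixNNZ (Matrix.of fun _ : Fin 1 => a) ≤ max d (w + 1) ^ 2 := by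
      refine (matrixNNZ_le _).trans ?_
      rw [sq]
      exact Nat.mul_le_mul ((by omega : 1 ≤ w + 1).trans (le_max_right _ _)) hk
    rw [RectNet.weights] at h3
    calc Φ.weights ≤ _ := h3
      _ ≤ max d (w + 1) ^ 2 + D * max d (w + 1) ^ 2 := by gcongr
      _ = _ := by ring

namespace NetComputable

variable {r d w w₁ w₂ D : ℕ} {A B : Set ((Fin d → ℝ) → ℝ)} {f g : (Fin d → ℝ) → ℝ}

theorem mono (h : NetComputable r d w₁ D A) (hw : w₁ ≤ w₂) : NetComputable r d w₂ D A := by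
  obtain ⟨T, hT, hA⟩ := h
  exact ⟨T, hT.mono hw, hA⟩

/-- Affine combinations cost neither neurons nor layers, because the next affine map absorbs them.
-/
theorem affSpan (h : NetComputable r d w D A) (hB : B ⊆ affSpan A) : NetComputable r d w D B := by
  obtain ⟨T, hT, hA⟩ := h
  exact ⟨T, hT, hB.trans (affSpan_le hA)⟩

theorem union (hA : NetComputable r d w₁ D A) (hB : NetComputable r d w₂ D B) :
    NetComputable r d (w₁ + w₂) D (A ∪ B) := by
  obtain ⟨T, hT, hA⟩ := hA
  obtain ⟨S, hS, hB⟩ := hB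
  refine ⟨T ∪ S, hT.union hS, Set.union_subset ?_ ?_⟩
  · exact hA.trans (affSpan_mono Set.subset_union_left)
  · exact hB.trans (affSpan_mono Set.subset_union_right)

theorem step (h : NetComputable r d w D A) (hf : B.Finite) (hc : B.ncard ≤ w)
    (hB : ∀ g ∈ B, ∃ u ∈ _root_.affSpan A, g = u ∨ g = repu r ∘ u) :
    NetComputable r d w (D + 1) B := by
  obtain ⟨T, hT, hA⟩ := h
  refine ⟨B, hT.succ hf hc fun g hg => ?_, subset_affSpan _⟩
  obtain ⟨u, hu, h⟩ := hB g hg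
  exact ⟨u, affSpan_le hA hu, h⟩

theorem continuous (h : NetComputable r d w D {f}) : Continuous f := by
  obtain ⟨T, hT, hf⟩ := h
  exact continuous_of_mem_affSpan hT.continuous (hf rfl)

theorem empty (r d D : ℕ) : NetComputable r d 0 D ∅ := by
  induction D with
  | zero => exact ⟨_, .zero, Set.empty_subset _⟩
  | succ D ih => exact ih.step Set.finite_empty (by simp) (by simp)

theorem const (r d D : ℕ) (c : ℝ) : NetComputable r d 0 D {fun _ => c} :=
  (empty r d D).affSpan (by rintro _ rfl; exact const_mem_affSpan _ c)

theorem coord (r : ℕ) (i : Fin d) : NetComputable r d 0 0 {fun x => x i} :=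
  ⟨_, .zero, by rintro _ rfl; exact subset_affSpan _ ⟨i, rfl⟩⟩

theorem add (hf : NetComputable r d w₁ D {f}) (hg : NetComputable r d w₂ D {g}) :
    NetComputable r d (w₁ + w₂) D {fun x => f x + g x} := by
  refine (hf.union hg).affSpan ?_
  rintro _ rfl
  exact Submodule.add_mem _ (subset_affSpan _ (by simp)) (subset_affSpan _ (by simp))

theorem const_mul (hf : NetComputable r d w D {f}) (c : ℝ) :
    NetComputable r d w D {fun x => c * f x} := by
  refine hf.affSpan ?_
  rintro _ rfl
  exact Submodule.smul_mem _ c (subset_affSpan _ rfl)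

theorem add_const (hf : NetComputable r d w D {f}) (c : ℝ) :
    NetComputable r d w D {fun x => f x + c} := by
  simpa using hf.add (const r d D c)

theorem const_sub (hf : NetComputable r d w D {f}) (c : ℝ) :
    NetComputable r d w D {fun x => c - f x} := by
  convert (hf.const_mul (-1)).add_const c using 3
  ring

theorem sub (hf : NetComputable r d w₁ D {f}) (hg : NetComputable r d w₂ D {g}) :
    NetComputable r d (w₁ + w₂) D {fun x => f x - g x} := by
  convert hf.add (hg.const_mul (-1)) using 3
  ring

theorem sum {ι : Type*} (s : Finset ι) {F : ι → (Fin d → ℝ) → ℝ}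
    (h : ∀ i ∈ s, NetComputable r d w D {F i}) :
    NetComputable r d (s.card * w) D {fun x => ∑ i ∈ s, F i x} := by
  classical
  induction s using Finset.induction_on with
  | empty => simpa using const r d D 0
  | insert a s ha ih =>
    simp only [Finset.sum_insert ha, Finset.card_insert_of_notMem ha]
    rw [add_mul, one_mul, add_comm]
    exact (h a (by simp)).add (ih fun i hi => h i (by simp [hi]))

theorem repu (hf : NetComputable r d w D {f}) (hw : 1 ≤ w) :
    NetComputable r d w (D + 1) {fun x => repu r (f x)} := by
  refine hf.step (Set.finite_singleton _) (by simpa) ?_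
  rintro _ rfl
  exact ⟨f, subset_affSpan _ rfl, Or.inr rfl⟩

/-- A neuron with identity activation carries a value through a layer, so branches of different
depths can be synchronized. -/
theorem lift (hf : NetComputable r d w D {f}) (hw : 1 ≤ w) (n : ℕ) :
    NetComputable r d w (D + n) {f} := by
  induction n with
  | zero => exact hf
  | succ n ih =>
    refine ih.step (Set.finite_singleton _) (by simpa) ?_
    rintro _ rfl
    exact ⟨_, subset_affSpan _ rfl, Or.inl rfl⟩

end NetComputable

/-! ### Powers -/

theorem ncard_pair_le {α : Type*} (a b : α) : ({a, b} : Set α).ncard ≤ 2 := by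
  simpa using Set.ncard_insert_le a {b}

theorem ncard_triple_le {α : Type*} (a b c : α) : ({a, b, c} : Set α).ncard ≤ 3 :=
  (Set.ncard_insert_le a {b, c}).trans (Nat.succ_le_succ (ncard_pair_le b c))

/-- `Q` approximates `t ↦ t ^ N` on `[-1, 1]`, and is computed by networks of depth `D`. -/
structure IsPowerApprox (r N D : ℕ) (δ : ℝ) (Q : ℝ → ℝ) : Prop where
  abs_sub_le : ∀ t, |t| ≤ 1 → |Q t - t ^ N| ≤ δ
  computable : ∀ {d w D₀ : ℕ} {f : (Fin d → ℝ) → ℝ}, NetComputable r d w D₀ {f} →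
    NetComputable r d (max w 3) (D₀ + D) {fun x => Q (f x)}

theorem pow_eq_repu_add (r : ℕ) (hr : r ≠ 0) (t : ℝ) :
    t ^ r = repu r t + (-1) ^ r * repu r (-t) := by
  unfold repu
  rcases le_total 0 t with h | h
  · rw [max_eq_right h, max_eq_left (by linarith), zero_pow hr]; ring
  · rw [max_eq_left h, max_eq_right (by linarith), zero_pow hr, ← mul_pow]; ring

/-- One layer with the two neurons `ρ_r(u)` and `ρ_r(-u)` produces `u ^ r` exactly. The zero error
is what makes the size for `r ≥ 2` independent of `ε`. -/
theorem isPowerApprox_pow {r : ℕ} (hr : r ≠ 0) (k : ℕ) :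
    IsPowerApprox r (r ^ k) k 0 fun t => t ^ r ^ k := by
  refine ⟨fun t _ => by simp, fun {d w D₀ f} hf => ?_⟩
  induction k with
  | zero => simpa using hf.mono (le_max_left _ _)
  | succ k ih =>
    have h : NetComputable r d (max w 3) (D₀ + k + 1)
        {repu r ∘ (fun x => f x ^ r ^ k), repu r ∘ (fun x => -1 * f x ^ r ^ k)} := by
      refine ih.step (Set.toFinite _) ((ncard_pair_le _ _).trans (by omega)) ?_
      rintro g (rfl | rfl)
      · exact ⟨_, subset_affSpan _ rfl, Or.inr rfl⟩
      · exact ⟨_, Submodule.smul_mem _ (-1) (subset_affSpan _ rfl), Or.inr rfl⟩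
    refine h.affSpan ?_
    rintro _ rfl
    have h1 : repu r ∘ (fun x => f x ^ r ^ k) ∈ affSpan
        {repu r ∘ (fun x => f x ^ r ^ k), repu r ∘ (fun x => -1 * f x ^ r ^ k)} :=
      subset_affSpan _ (by simp)
    have h2 : repu r ∘ (fun x => -1 * f x ^ r ^ k) ∈ affSpan
        {repu r ∘ (fun x => f x ^ r ^ k), repu r ∘ (fun x => -1 * f x ^ r ^ k)} :=
      subset_affSpan _ (by simp)
    change _ ∈ affSpan _
    convert Submodule.add_mem _ h1 (Submodule.smul_mem _ ((-1) ^ r) h2) using 1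
    ext x
    simp only [Pi.add_apply, Pi.smul_apply, Function.comp_apply, smul_eq_mul, neg_one_mul]
    rw [← pow_eq_repu_add r hr, pow_succ, pow_mul]

theorem repu_one (t : ℝ) : repu 1 t = max 0 t := by simp [repu]

/-! ### Approximate squaring by rectifiers of degree one. -/

/-- The tent map on `[0, 1]`, in terms of rectifiers. -/
def tent (y : ℝ) : ℝ := 2 * repu 1 y - 4 * repu 1 (y - 1 / 2)

/-- The approximation `y - ∑_{s ≤ m} tent^s(y) / 4^s` of `y²`. -/
def sqApprox (m : ℕ) (y : ℝ) : ℝ := y - ∑ s ∈ Finset.range m, tent^[s + 1] y / 4 ^ (s + 1)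

/-- The last identity is the self-similarity of the parabola `y - y ^ 2` under the tent map;
iterating it produces the series for the square. -/
theorem tent_spec {y : ℝ} (h0 : 0 ≤ y) (h1 : y ≤ 1) :
    0 ≤ tent y ∧ tent y ≤ 1 ∧ y - y ^ 2 = (tent y + (tent y - tent y ^ 2)) / 4 := by
  unfold tent
  rw [repu_one, repu_one, max_eq_right h0]
  rcases le_total y (1 / 2) with h | h
  · rw [max_eq_left (by linarith)]
    refine ⟨by linarith, by linarith, by ring⟩
  · rw [max_eq_right (by linarith)]
    refine ⟨by linarith, by linarith, by ring⟩

theorem tent_iterate_mem {y : ℝ} (h0 : 0 ≤ y) (h1 : y ≤ 1) (m : ℕ) :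
    0 ≤ tent^[m] y ∧ tent^[m] y ≤ 1 := by
  induction m with
  | zero => exact ⟨h0, h1⟩
  | succ m ih =>
    rw [Function.iterate_succ_apply']
    exact ⟨(tent_spec ih.1 ih.2).1, (tent_spec ih.1 ih.2).2.1⟩

/-- The remainder after `m` steps is the same parabola at the iterated point, scaled by `4 ^ (-m)`.
It is thus nonnegative and exponentially small. -/
theorem sqApprox_sub_sq {y : ℝ} (h0 : 0 ≤ y) (h1 : y ≤ 1) (m : ℕ) :
    sqApprox m y - y ^ 2 = (tent^[m] y - (tent^[m] y) ^ 2) / 4 ^ m := by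
  induction m with
  | zero => simp [sqApprox]
  | succ m ih =>
    have hz := tent_iterate_mem h0 h1 m
    have h := (tent_spec hz.1 hz.2).2.2
    have : sqApprox (m + 1) y = sqApprox m y - tent^[m + 1] y / 4 ^ (m + 1) := by
      simp only [sqApprox, Finset.sum_range_succ]
      ring
    rw [this, sub_right_comm, ih, h, Function.iterate_succ_apply', pow_succ]
    field_simp
    ring

theorem sqApprox_mem {y : ℝ} (h0 : 0 ≤ y) (h1 : y ≤ 1) (m : ℕ) :
    0 ≤ sqApprox m y ∧ sqApprox m y ≤ 1 ∧ |sqApprox m y - y ^ 2| ≤ (4 ^ m)⁻¹ := by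
  have hz := tent_iterate_mem h0 h1 m
  have h := sqApprox_sub_sq h0 h1 m
  have h2 : 0 ≤ (tent^[m] y - (tent^[m] y) ^ 2) / 4 ^ m := by
    have : 0 ≤ tent^[m] y - (tent^[m] y) ^ 2 := by nlinarith
    positivity
  refine ⟨by nlinarith, ?_, ?_⟩
  · have : 0 ≤ ∑ s ∈ Finset.range m, tent^[s + 1] y / 4 ^ (s + 1) :=
      Finset.sum_nonneg fun s _ => div_nonneg (tent_iterate_mem h0 h1 _).1 (by positivity)
    unfold sqApprox
    linarith
  · rw [h, abs_of_nonneg h2, div_eq_mul_inv]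
    exact mul_le_of_le_one_left (by positivity) (by nlinarith)

theorem NetComputable.sqApprox {d w D₀ : ℕ} {f : (Fin d → ℝ) → ℝ}
    (hf : NetComputable 1 d w D₀ {f}) (hw : 3 ≤ w) (m : ℕ) :
    NetComputable 1 d w (D₀ + m) {fun x => sqApprox m (f x)} := by
  -- The induction must carry the tent iterate along with the partial sum. Each layer then needs
  -- three neurons: two for the next tent value and one that transports the sum.
  have key : NetComputable 1 d w (D₀ + m)
      {(fun x => tent^[m] (f x)), (fun x => _root_.sqApprox m (f x))} := by
    induction m with
    | zero => simpa [_root_.sqApprox] using hf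
    | succ m ih =>
      set A : Set ((Fin d → ℝ) → ℝ) :=
        {(fun x => tent^[m] (f x)), (fun x => _root_.sqApprox m (f x))} with hA
      set B : Set ((Fin d → ℝ) → ℝ) :=
        {_root_.repu 1 ∘ (fun x => tent^[m] (f x)),
          _root_.repu 1 ∘ ((fun x => tent^[m] (f x)) - fun _ => 1 / 2),
          (fun x => _root_.sqApprox m (f x))} with hB
      have h : NetComputable 1 d w (D₀ + m + 1) B := by
        refine ih.step (Set.toFinite _) ((ncard_triple_le _ _ _).trans hw) ?_
        rintro g (rfl | rfl | rfl)
        · exact ⟨_, subset_affSpan _ (by simp [hA]), Or.inr rfl⟩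
        · exact ⟨_, Submodule.sub_mem _ (subset_affSpan _ (by simp [hA]))
            (const_mem_affSpan _ _), Or.inr rfl⟩
        · exact ⟨_, subset_affSpan _ (by simp [hA]), Or.inl rfl⟩
      have h1 : (fun x => tent^[m + 1] (f x)) ∈ _root_.affSpan B := by
        have h1 : _root_.repu 1 ∘ (fun x => tent^[m] (f x)) ∈ _root_.affSpan B :=
          subset_affSpan _ (by simp [hB])
        have h2 : _root_.repu 1 ∘ ((fun x => tent^[m] (f x)) - fun _ => 1 / 2) ∈
            _root_.affSpan B := subset_affSpan _ (by simp [hB])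
        convert Submodule.sub_mem _ (Submodule.smul_mem _ 2 h1) (Submodule.smul_mem _ 4 h2) using 1
        ext x
        rw [Function.iterate_succ_apply']
        simp [tent]
      refine h.affSpan ?_
      rintro g (rfl | rfl)
      · exact h1
      · have h2 : (fun x => _root_.sqApprox m (f x)) ∈ _root_.affSpan B :=
          subset_affSpan _ (by simp [hB])
        change _ ∈ _root_.affSpan _
        convert Submodule.sub_mem _ h2 (Submodule.smul_mem _ ((4 ^ (m + 1))⁻¹ : ℝ) h1) using 1
        ext x
        simp [_root_.sqApprox, Finset.sum_range_succ, div_eq_inv_mul]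
        ring
  exact key.affSpan (by rintro _ rfl; exact subset_affSpan _ (by simp))

/-- Since `z ↦ z ^ 2` is 2-Lipschitz on `[0, 1]`, each squaring at most doubles the error and adds
`4 ^ (-m)`, so it stays below `(2 ^ k - 1) 4 ^ (-m)`. The first layer computes `|t|`; `k ≠ 0` makes
the exponent even, so the absolute value does no harm. -/
theorem isPowerApprox_sqApprox (m : ℕ) {k : ℕ} (hk : k ≠ 0) :
    IsPowerApprox 1 (2 ^ k) (1 + k * m) (2 ^ k * (4 ^ m)⁻¹) fun t => (sqApprox m)^[k] |t| := by
  constructor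
  · intro t ht
    have key : ∀ k : ℕ, 0 ≤ (sqApprox m)^[k] |t| ∧ (sqApprox m)^[k] |t| ≤ 1 ∧
        |(sqApprox m)^[k] |t| - |t| ^ 2 ^ k| ≤ (2 ^ k - 1) * (4 ^ m)⁻¹ := by
      intro k
      induction k with
      | zero => simpa using ht
      | succ k ih =>
        obtain ⟨h0, h1, h2⟩ := ih
        obtain ⟨h3, h4, h5⟩ := sqApprox_mem h0 h1 m
        rw [Function.iterate_succ_apply']
        refine ⟨h3, h4, ?_⟩
        set z := (sqApprox m)^[k] |t|
        set u := |t| ^ 2 ^ k with hu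
        have hu0 : 0 ≤ u := by positivity
        have hu1 : u ≤ 1 := pow_le_one₀ (abs_nonneg t) ht
        have h6 : |z ^ 2 - u ^ 2| ≤ 2 * ((2 ^ k - 1) * (4 ^ m)⁻¹) := by
          rw [sq_sub_sq, abs_mul, abs_of_nonneg (by linarith : 0 ≤ z + u)]
          exact mul_le_mul (by linarith) h2 (abs_nonneg _) (by norm_num)
        rw [pow_succ 2 k, pow_mul, ← hu]
        calc |sqApprox m z - u ^ 2| = |(sqApprox m z - z ^ 2) + (z ^ 2 - u ^ 2)| := by ring_nf
          _ ≤ _ := abs_add_le _ _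
          _ ≤ (4 ^ m)⁻¹ + 2 * ((2 ^ k - 1) * (4 ^ m)⁻¹) := add_le_add h5 h6
          _ = _ := by ring
    have heven : Even (2 ^ k) := by
      rw [Nat.even_pow]; exact ⟨even_two, hk⟩
    rw [← heven.pow_abs t]
    refine (key k).2.2.trans ?_
    gcongr
    linarith
  · intro d w D₀ f hf
    have h0 : NetComputable 1 d (max w 3) (D₀ + 1) {fun x => |f x|} := by
      have h : NetComputable 1 d (max w 3) (D₀ + 1)
          {repu 1 ∘ f, repu 1 ∘ (fun x => -1 * f x)} := by
        refine (hf.mono (le_max_left _ _)).step (Set.toFinite _)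
          ((ncard_pair_le _ _).trans (by omega)) ?_
        rintro g (rfl | rfl)
        · exact ⟨_, subset_affSpan _ rfl, Or.inr rfl⟩
        · exact ⟨_, Submodule.smul_mem _ (-1) (subset_affSpan _ rfl), Or.inr rfl⟩
      refine h.affSpan ?_
      rintro _ rfl
      have h1 : repu 1 ∘ f ∈ affSpan {repu 1 ∘ f, repu 1 ∘ (fun x => -1 * f x)} :=
        subset_affSpan _ (by simp)
      have h2 : repu 1 ∘ (fun x => -1 * f x) ∈
          affSpan {repu 1 ∘ f, repu 1 ∘ (fun x => -1 * f x)} := subset_affSpan _ (by simp)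
      change _ ∈ affSpan _
      convert Submodule.add_mem _ h1 h2 using 1
      ext x
      simp only [Pi.add_apply, Function.comp_apply, repu_one]
      rcases le_total 0 (f x) with h | h
      · rw [abs_of_nonneg h, max_eq_right h, max_eq_left (by linarith), add_zero]
      · rw [abs_of_nonpos h, max_eq_left h, max_eq_right (by linarith)]; ring
    have h : ∀ k : ℕ, NetComputable 1 d (max w 3) (D₀ + 1 + k * m)
        {fun x => (sqApprox m)^[k] |f x|} := by
      intro k
      induction k with
      | zero => simpa using h0
      | succ k ih =>
        have := ih.sqApprox (le_max_right _ _) m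
        simp only [Function.iterate_succ_apply']
        convert this using 1
        ring
    rw [← add_assoc]
    exact h k

/-! ### Products -/

/-- These are iterated finite differences of a power in the directions `y i`. Splitting the subsets
according to whether they contain `a` and expanding binomially cancels the top term, so each
direction lowers the degree by one. The shift `t` is there for the induction. -/
theorem sum_powerset_neg_one_pow_mul_add_sum_pow {ι : Type*} [DecidableEq ι] (s : Finset ι)
    (y : ι → ℝ) :
    (∀ k < s.card, ∀ t : ℝ,
      ∑ S ∈ s.powerset, (-1) ^ S.card * (t + ∑ i ∈ S, y i) ^ k = 0) ∧
    ∀ t : ℝ, ∑ S ∈ s.powerset, (-1) ^ S.card * (t + ∑ i ∈ S, y i) ^ s.card =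
      (-1) ^ s.card * s.card.factorial * ∏ i ∈ s, y i := by
  induction s using Finset.induction_on with
  | empty => simp
  | insert a s ha ih =>
    have key : ∀ (k : ℕ) (t : ℝ),
        ∑ S ∈ (insert a s).powerset, (-1) ^ S.card * (t + ∑ i ∈ S, y i) ^ k =
        -∑ j ∈ Finset.range k, (k.choose j * y a ^ (k - j)) *
          ∑ S ∈ s.powerset, (-1) ^ S.card * (t + ∑ i ∈ S, y i) ^ j := by
      intro k t
      rw [Finset.sum_powerset_insert ha, ← Finset.sum_add_distrib]
      simp_rw [Finset.mul_sum]
      rw [Finset.sum_comm, ← Finset.sum_neg_distrib]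
      refine Finset.sum_congr rfl fun S hS => ?_
      have haS : a ∉ S := fun h => ha (Finset.mem_powerset.1 hS h)
      rw [Finset.sum_insert haS, Finset.card_insert_of_notMem haS,
        show t + (y a + ∑ i ∈ S, y i) = (t + ∑ i ∈ S, y i) + y a by ring,
        add_pow (t + ∑ i ∈ S, y i) (y a) k,
        Finset.sum_range_succ]
      simp only [Nat.sub_self, pow_zero, Nat.choose_self, Nat.cast_one, mul_one]
      rw [mul_add, pow_succ, Finset.mul_sum]
      have : ∀ u v : ℝ, (-1) ^ S.card * u + (v + (-1) ^ S.card * -1 * u) = v := by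
        intros; ring
      rw [this, ← Finset.sum_neg_distrib]
      refine Finset.sum_congr rfl fun j _ => ?_
      ring
    rw [Finset.card_insert_of_notMem ha]
    constructor
    · intro k hk t
      rw [key, Finset.sum_eq_zero, neg_zero]
      intro j hj
      rw [ih.1 j (by have := Finset.mem_range.1 hj; omega), mul_zero]
    · intro t
      rw [key, Finset.sum_range_succ, Finset.sum_eq_zero, ih.2, Finset.prod_insert ha]
      · rw [Nat.choose_succ_self_right, Nat.factorial_succ]
        push_cast
        rw [Nat.add_sub_cancel_left]
        ring
      · intro j hj
        rw [ih.1 j (Finset.mem_range.1 hj), mul_zero]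

/-- Dividing by the number of factors keeps the arguments of the power in `[-1, 1]`. The price is `n
^ n / n!`, which is only exponential. -/
theorem prod_eq_sum_powerset {ι : Type*} [Fintype ι] [DecidableEq ι] (y : ι → ℝ) :
    ∏ i, y i = (-1) ^ Fintype.card ι * ((Fintype.card ι : ℝ) ^ Fintype.card ι /
      (Fintype.card ι).factorial) * ∑ S ∈ (Finset.univ : Finset ι).powerset,
      (-1) ^ S.card * ((∑ i ∈ S, y i) / Fintype.card ι) ^ Fintype.card ι := by
  have h := (sum_powerset_neg_one_pow_mul_add_sum_pow (Finset.univ : Finset ι) y).2 0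
  simp only [zero_add, Finset.card_univ] at h
  rcases (Fintype.card ι).eq_zero_or_pos with h0 | h0
  · have := Fintype.card_eq_zero_iff.1 h0
    simp
  have h1 : (Fintype.card ι : ℝ) ^ Fintype.card ι ≠ 0 := by positivity
  simp_rw [div_pow, ← mul_div_assoc]
  rw [← Finset.sum_div, h]
  field_simp
  rw [← pow_mul, mul_comm _ 2, pow_mul]
  simp

theorem pow_self_div_factorial_le (N : ℕ) : (N : ℝ) ^ N / N.factorial ≤ 3 ^ N := by
  refine (Real.pow_div_factorial_le_exp (x := (N : ℝ)) (by positivity) N).trans ?_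
  rw [← mul_one (N : ℝ), Real.exp_nat_mul]
  gcongr
  exact Real.exp_one_lt_three.le

/-- The subsets `S` and `S ∪ {i}` give equal arguments and opposite signs. Nothing is used about
`Q`, so exact zeros survive any approximation of the power. -/
theorem sum_powerset_eq_zero {ι : Type*} [Fintype ι] [DecidableEq ι] (Q : ℝ → ℝ) {y : ι → ℝ}
    {i : ι} (hi : y i = 0) :
    ∑ S ∈ (Finset.univ : Finset ι).powerset, (-1 : ℝ) ^ S.card * Q (∑ j ∈ S, y j) = 0 := by
  rw [← Finset.insert_erase (Finset.mem_univ i),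
    Finset.sum_powerset_insert (Finset.notMem_erase i _), ← Finset.sum_add_distrib]
  refine Finset.sum_eq_zero fun S hS => ?_
  have hiS : i ∉ S := fun h => Finset.notMem_erase i _ (Finset.mem_powerset.1 hS h)
  rw [Finset.sum_insert hiS, Finset.card_insert_of_notMem hiS, hi, pow_succ]
  ring_nf

/-- An approximation of the product which is exact as soon as one of the factors vanishes. -/
theorem exists_prodApprox {r N D : ℕ} {δ : ℝ} {Q : ℝ → ℝ} (hQ : IsPowerApprox r N D δ Q)
    {ι : Type*} [Fintype ι] (hN : Fintype.card ι ≤ N) :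
    ∃ μ : (ι → ℝ) → ℝ, (∀ y, (∃ i, y i = 0) → μ y = 0) ∧
      (∀ y, (∀ i, |y i| ≤ 1) → |μ y - ∏ i, y i| ≤ 6 ^ N * δ) ∧
      ∀ {d w D₀ : ℕ} {f : ι → (Fin d → ℝ) → ℝ}, (∀ i, NetComputable r d w D₀ {f i}) →
        NetComputable r d (2 ^ N * max (N * w) 3) (D₀ + D) {fun x => μ fun i => f i x} := by
  classical
  -- Padding with factors equal to one makes the number of factors equal to the exponent `N` that
  -- `Q` approximates.
  set κ := ι ⊕ Fin (N - Fintype.card ι) with hκ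
  have hcard : Fintype.card κ = N := by
    simp [hκ]; omega
  set c : ℝ := (-1) ^ N * ((N : ℝ) ^ N / N.factorial) with hc
  have hc' : |c| ≤ 3 ^ N := by
    rw [hc, abs_mul, abs_pow, abs_neg, abs_one, one_pow, one_mul, abs_of_nonneg (by positivity)]
    exact pow_self_div_factorial_le N
  have hδ : 0 ≤ δ := (abs_nonneg _).trans (hQ.abs_sub_le 0 (by simp))
  have hpow : ((Finset.univ : Finset κ).powerset).card = 2 ^ N := by
    rw [Finset.card_powerset, Finset.card_univ, hcard]
  refine ⟨fun y => c * ∑ S ∈ (Finset.univ : Finset κ).powerset,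
    (-1) ^ S.card * Q ((∑ j ∈ S, Sum.elim y 1 j) / N), ?_, ?_, ?_⟩
  · rintro y ⟨i, hi⟩
    have := sum_powerset_eq_zero (fun t => Q (t / N)) (y := (Sum.elim y 1 : κ → ℝ))
      (i := Sum.inl i) hi
    exact mul_eq_zero_of_right _ this
  · intro y hy
    have hy' : ∀ j : κ, |(Sum.elim y 1 : κ → ℝ) j| ≤ 1 := by
      rintro (i | j)
      · exact hy i
      · simp
    have hprod : ∏ i, y i = ∏ j : κ, (Sum.elim y 1 : κ → ℝ) j := by
      rw [Fintype.prod_sum_type]; simp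
    rw [hprod, prod_eq_sum_powerset, hcard, ← hc, ← mul_sub, ← Finset.sum_sub_distrib, abs_mul]
    have hsum : |∑ S ∈ (Finset.univ : Finset κ).powerset,
        ((-1) ^ S.card * Q ((∑ j ∈ S, Sum.elim y 1 j) / N) -
          (-1) ^ S.card * ((∑ j ∈ S, Sum.elim y 1 j) / (N : ℝ)) ^ N)| ≤ 2 ^ N * δ := by
      refine (Finset.abs_sum_le_sum_abs _ _).trans ?_
      have : ∀ S ∈ (Finset.univ : Finset κ).powerset,
          |(-1) ^ S.card * Q ((∑ j ∈ S, Sum.elim y 1 j) / N) -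
          (-1) ^ S.card * ((∑ j ∈ S, Sum.elim y 1 j) / (N : ℝ)) ^ N| ≤ δ := by
        intro S _
        rw [← mul_sub, abs_mul, abs_pow, abs_neg, abs_one, one_pow, one_mul]
        apply hQ.abs_sub_le
        rw [abs_div, Nat.abs_cast]
        apply div_le_one_of_le₀ _ (by positivity)
        refine (Finset.abs_sum_le_sum_abs _ _).trans ?_
        refine (Finset.sum_le_card_nsmul _ _ 1 fun j _ => hy' j).trans ?_
        simp only [nsmul_eq_mul, mul_one]
        exact_mod_cast (Finset.card_le_univ S).trans hcard.le
      refine (Finset.sum_le_card_nsmul _ _ _ this).trans ?_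
      rw [hpow, nsmul_eq_mul]
      push_cast
      rfl
    calc _ ≤ (3 : ℝ) ^ N * (2 ^ N * δ) := mul_le_mul hc' hsum (abs_nonneg _) (by positivity)
      _ = 6 ^ N * δ := by rw [← mul_assoc, ← mul_pow]; norm_num
  · intro d w D₀ f hf
    rw [← hpow]
    refine NetComputable.const_mul (NetComputable.sum _ fun S _ => ?_) _
    refine NetComputable.const_mul (hQ.computable
      (f := fun x => (∑ j ∈ S, (Sum.elim (fun i => f i x) 1 : κ → ℝ) j) / N) ?_) _
    simp_rw [div_eq_inv_mul]
    refine NetComputable.const_mul ?_ _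
    have h : ∀ j ∈ S, NetComputable r d w D₀
        {fun x => (Sum.elim (fun i => f i x) 1 : κ → ℝ) j} := by
      rintro (i | j) _
      · exact hf i
      · exact (NetComputable.const r d D₀ 1).mono (Nat.zero_le _)
    refine (NetComputable.sum S h).mono ?_
    exact Nat.mul_le_mul_right _ ((Finset.card_le_univ S).trans hcard.le)

/-! ### Conjunctions -/

theorem repu_nonneg (r : ℕ) (t : ℝ) : 0 ≤ repu r t := by
  unfold repu
  positivity

theorem repu_of_nonpos {r : ℕ} (hr : r ≠ 0) {t : ℝ} (ht : t ≤ 0) : repu r t = 0 := by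
  rw [repu, max_eq_left ht, zero_pow hr]

/-- A nonnegative function which is positive exactly where all of `2 ^ k` given nonnegative
functions are positive. -/
theorem exists_computable_forall_pos {r : ℕ} (hr : r ≠ 0) {d w D : ℕ} (hw : 1 ≤ w) (k : ℕ)
    (f : ℕ → (Fin d → ℝ) → ℝ) (hf : ∀ i, NetComputable r d w D {f i}) (h0 : ∀ i x, 0 ≤ f i x) :
    ∃ g, NetComputable r d (3 ^ k * w) (D + k) {g} ∧ (∀ x, 0 ≤ g x) ∧
      ∀ x, 0 < g x ↔ ∀ i < 2 ^ k, 0 < f i x := by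
  induction k generalizing f with
  | zero => exact ⟨f 0, by simpa using hf 0, h0 0, fun x => by simp⟩
  | succ k ih =>
    obtain ⟨a, ha, ha0, hap⟩ := ih f hf h0
    obtain ⟨b, hb, hb0, hbp⟩ := ih (fun i => f (i + 2 ^ k)) (fun i => hf _) fun i => h0 _
    have hw' : 1 ≤ 3 ^ k * w := Nat.mul_pos (by positivity) hw
    -- This is `min a b` for `r = 1`. For any `r ≠ 0`, strict monotonicity of `ρ_r` on `[0, ∞)`
    -- makes it positive exactly when both `a` and `b` are.
    refine ⟨fun x => repu r (a x) - repu r (a x - b x), ?_, ?_, ?_⟩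
    · refine ((ha.repu hw').sub ((ha.sub hb).repu (by omega))).mono ?_
      rw [pow_succ]
      linarith
    · intro x
      rw [sub_nonneg]
      unfold repu
      have := hb0 x
      gcongr
      linarith
    · intro x
      have h1 : (0 < repu r (a x) - repu r (a x - b x)) ↔ 0 < a x ∧ 0 < b x := by
        constructor
        · intro h
          refine ⟨(ha0 x).lt_of_ne' fun hz => ?_, (hb0 x).lt_of_ne' fun hz => ?_⟩
          · rw [hz, repu_of_nonpos hr le_rfl] at h
            linarith [repu_nonneg r (0 - b x)]
          · rw [hz, sub_zero, sub_self] at h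
            exact h.false
        · rintro ⟨h1, h2⟩
          rw [sub_pos]
          unfold repu
          apply pow_lt_pow_left₀ _ (le_max_left _ _) hr
          rw [max_eq_right h1.le]
          exact max_lt h1 (by linarith)
      rw [h1, hap, hbp]
      constructor
      · rintro ⟨h1, h2⟩ i hi
        rcases lt_or_ge i (2 ^ k) with h | h
        · exact h1 i h
        · have := h2 (i - 2 ^ k) (by rw [pow_succ] at hi; omega)
          rwa [Nat.sub_add_cancel h] at this
      · intro h
        exact ⟨fun i hi => h i (by rw [pow_succ]; omega),
          fun i hi => h _ (by rw [pow_succ]; omega)⟩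

/-! ### Lagrange interpolation at equidistant nodes -/

theorem prod_erase_abs_sub {n m : ℕ} (hm : m ≤ n) :
    ∏ l ∈ (Finset.range (n + 1)).erase m, |(m : ℝ) - l| =
      (m.factorial : ℝ) * (n - m).factorial := by
  obtain ⟨k, rfl⟩ := Nat.exists_eq_add_of_le hm
  have h1 : ∏ l ∈ (Finset.range (m + k + 1)).erase m, |(m : ℝ) - l| =
      ∏ l ∈ Finset.range (m + k + 1), if l = m then 1 else |(m : ℝ) - l| := by
    rw [← Finset.mul_prod_erase (Finset.range (m + k + 1)) _ (a := m) (by simp)]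
    rw [if_pos rfl, one_mul]
    exact Finset.prod_congr rfl fun l hl => (if_neg (Finset.ne_of_mem_erase hl)).symm
  rw [h1, show m + k + 1 = m + 1 + k by ring, Finset.prod_range_add, Finset.prod_range_succ,
    if_pos rfl, mul_one, Nat.add_sub_cancel_left, ← Finset.prod_range_add_one_eq_factorial,
    ← Finset.prod_range_add_one_eq_factorial, ← Finset.prod_range_reflect]
  push_cast
  congr 1
  · refine Finset.prod_congr rfl fun l hl => ?_
    have hl := Finset.mem_range.1 hl
    rw [if_neg (by omega)]
    have : ((m - 1 - l : ℕ) : ℝ) + 1 = m - l := by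
      rw [Nat.sub_sub, Nat.cast_sub (by omega)]; push_cast; ring
    have h3 : ((m - 1 - l : ℕ) : ℝ) = m - l - 1 := by linarith
    rw [h3]
    have : (0 : ℝ) ≤ l := by positivity
    rw [abs_of_nonneg (by linarith)]
    ring
  · refine Finset.prod_congr rfl fun l _ => ?_
    rw [if_neg (by omega), abs_sub_comm, abs_of_nonneg (by linarith [(l.cast_nonneg : (0:ℝ) ≤ l)])]
    ring

/-- With `n = L - 1`, the Lagrange weights are at most `n ^ n / (m! (n - m)!) = (n choose m) n ^ n /
n! ≤ 2 ^ n * 3 ^ n`, and there are `L ≤ 2 ^ L` of them. For `L = 1` the only node is `0 / 0 = 0`. -/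
theorem exists_lagrange {L : ℕ} (hL : L ≠ 0) (R : Polynomial ℝ)
    (hR : R.degree < (L : WithBot ℕ)) {M : ℝ} (hM : ∀ z, 0 ≤ z → z ≤ 1 → |R.eval z| ≤ M) :
    ∃ κ : Fin L → ℝ, ∑ m, |κ m| ≤ 12 ^ L * M ∧
      ∀ z, R.eval z = ∑ m, κ m * ∏ l ∈ Finset.univ.erase m, (z - (l : ℕ) / ((L : ℝ) - 1)) := by
  obtain ⟨n, rfl⟩ := Nat.exists_eq_succ_of_ne_zero hL
  set v : Fin (n + 1) → ℝ := fun l => (l : ℕ) / (((n + 1 : ℕ) : ℝ) - 1) with hv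
  have hvn : ∀ l : Fin (n + 1), v l = (l : ℕ) / (n : ℝ) := fun l => by simp [hv]
  have hinj : Set.InjOn v (Finset.univ : Finset (Fin (n + 1))) := by
    intro a _ b _ hab
    rcases n.eq_zero_or_pos with rfl | hn
    · exact Fin.ext (by omega)
    · rw [hvn, hvn, div_left_inj' (by positivity)] at hab
      exact Fin.ext (by exact_mod_cast hab)
  have hM0 : 0 ≤ M := (abs_nonneg _).trans (hM 0 le_rfl zero_le_one)
  refine ⟨fun m => R.eval (v m) * ∏ l ∈ Finset.univ.erase m, (v m - v l)⁻¹, ?_, ?_⟩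
  · have hw : ∀ m : Fin (n + 1), |∏ l ∈ Finset.univ.erase m, (v m - v l)⁻¹| ≤ 6 ^ n := by
      intro m
      have hm : (m : ℕ) ≤ n := Nat.lt_succ_iff.1 m.2
      have h1 : ∏ l ∈ Finset.univ.erase m, |((m : ℕ) : ℝ) - (l : ℕ)| =
          ((m : ℕ).factorial : ℝ) * (n - m).factorial := by
        rw [← prod_erase_abs_sub hm]
        refine Finset.prod_bij (fun l _ => (l : ℕ)) ?_ ?_ ?_ ?_
        · intro l hl
          have := Finset.ne_of_mem_erase hl
          simpa [Fin.val_inj, this] using Nat.lt_succ_iff.1 l.2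
        · exact fun a _ b _ h => Fin.ext h
        · intro b hb
          simp only [Finset.mem_erase, Finset.mem_range] at hb
          exact ⟨⟨b, hb.2⟩, by simp [Fin.ext_iff, hb.1], rfl⟩
        · exact fun _ _ => rfl
      rw [Finset.abs_prod]
      have h2 : ∀ l : Fin (n + 1), |(v m - v l)⁻¹| = n * |((m : ℕ) : ℝ) - (l : ℕ)|⁻¹ := by
        intro l
        rw [hvn, hvn, ← sub_div, abs_inv, abs_div, Nat.abs_cast, inv_div, div_eq_mul_inv]
      simp_rw [h2]
      rw [Finset.prod_mul_distrib, Finset.prod_inv_distrib, h1, Finset.prod_const,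
        Finset.card_erase_of_mem (Finset.mem_univ _), Finset.card_univ, Fintype.card_fin,
        Nat.add_sub_cancel]
      have h3 := pow_self_div_factorial_le n
      have h4 : ((n.choose m : ℕ) : ℝ) ≤ 2 ^ n := by exact_mod_cast Nat.choose_le_two_pow n m
      have h5 : (n : ℝ) ^ n * ((m : ℕ).factorial * (n - m).factorial : ℝ)⁻¹ =
          n.choose m * ((n : ℝ) ^ n / n.factorial) := by
        rw [Nat.cast_choose ℝ hm]
        field_simp
      rw [h5]
      calc _ ≤ (2 : ℝ) ^ n * 3 ^ n := by gcongr
        _ = 6 ^ n := by rw [← mul_pow]; norm_num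
    have hterm : ∀ m ∈ (Finset.univ : Finset (Fin (n + 1))),
        |R.eval (v m) * ∏ l ∈ Finset.univ.erase m, (v m - v l)⁻¹| ≤ M * 6 ^ n := by
      intro m _
      rw [abs_mul]
      refine mul_le_mul (hM _ ?_ ?_) (hw m) (abs_nonneg _) hM0
      · rw [hvn]; positivity
      · rw [hvn]
        exact div_le_one_of_le₀ (by exact_mod_cast Nat.lt_succ_iff.1 m.2) (by positivity)
    refine (Finset.sum_le_card_nsmul _ _ _ hterm).trans ?_
    rw [Finset.card_univ, Fintype.card_fin, nsmul_eq_mul]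
    have h2 : ((n + 1 : ℕ) : ℝ) ≤ 2 ^ (n + 1) := by exact_mod_cast Nat.lt_two_pow_self.le
    calc ((n + 1 : ℕ) : ℝ) * (M * 6 ^ n) ≤ 2 ^ (n + 1) * (M * 6 ^ (n + 1)) := by
          gcongr
          · norm_num
          · omega
      _ = 12 ^ (n + 1) * M := by
          rw [show (12 : ℝ) = 2 * 6 by norm_num, mul_pow]; ring
  · intro z
    have h := Lagrange.eq_interpolate (s := Finset.univ) hinj (f := R) (by simpa using hR)
    conv_lhs => rw [h, Lagrange.interpolate_apply, Polynomial.eval_finsetSum]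
    refine Finset.sum_congr rfl fun m _ => ?_
    rw [Polynomial.eval_mul, Polynomial.eval_C, Lagrange.basis, Polynomial.eval_prod, mul_assoc,
      ← Finset.prod_mul_distrib]
    congr 1
    refine Finset.prod_congr rfl fun l _ => ?_
    simp only [Lagrange.basisDivisor, Polynomial.eval_mul, Polynomial.eval_C, Polynomial.eval_sub,
      Polynomial.eval_X]
    rfl

/-! ### Cutoff functions -/

/-- A continuous function which is `0` on `(-∞, 0]`, `1` on `[1, ∞)`, and lies in `(0, 1]`
on `(0, ∞)`. -/
def smoothStep (r : ℕ) (t : ℝ) : ℝ := 1 - repu r (1 - repu r t)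

theorem smoothStep_of_nonpos {r : ℕ} (hr : r ≠ 0) {t : ℝ} (ht : t ≤ 0) : smoothStep r t = 0 := by
  rw [smoothStep, repu_of_nonpos hr ht]
  simp [repu]

theorem smoothStep_of_one_le {r : ℕ} (hr : r ≠ 0) {t : ℝ} (ht : 1 ≤ t) : smoothStep r t = 1 := by
  have h : 1 ≤ repu r t := by
    rw [repu, max_eq_right (by linarith)]
    exact one_le_pow₀ ht
  rw [smoothStep, repu_of_nonpos hr (by linarith), sub_zero]

theorem smoothStep_nonneg (r : ℕ) (t : ℝ) : 0 ≤ smoothStep r t := by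
  rw [smoothStep, sub_nonneg, repu]
  refine pow_le_one₀ (le_max_left _ _) (max_le zero_le_one ?_)
  linarith [repu_nonneg r t]

theorem smoothStep_le_one (r : ℕ) (t : ℝ) : smoothStep r t ≤ 1 := by
  rw [smoothStep]
  linarith [repu_nonneg r (1 - repu r t)]

theorem smoothStep_pos {r : ℕ} (hr : r ≠ 0) {t : ℝ} (ht : 0 < t) : 0 < smoothStep r t := by
  have h : 0 < repu r t := by
    rw [repu, max_eq_right ht.le]
    positivity
  rw [smoothStep, sub_pos, repu]
  refine pow_lt_one₀ (le_max_left _ _) (max_lt zero_lt_one (by linarith)) hr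

/-- For `a < b` and `K (b - a) ≥ 2`, a function on `ℝ` with values in `[0, 1]`, which is positive
exactly on `(a, b)`, and equal to `1` at distance at least `1 / K` from its complement. -/
def plateau (r : ℕ) (K a b x : ℝ) : ℝ :=
  smoothStep r (K * (x - a)) + smoothStep r (K * (b - x)) - 1

theorem NetComputable.smoothStep {r d w D : ℕ} {f : (Fin d → ℝ) → ℝ}
    (hf : NetComputable r d w D {f}) (hw : 1 ≤ w) :
    NetComputable r d w (D + 2) {fun x => smoothStep r (f x)} :=
  (((hf.repu hw).const_sub 1).repu hw).const_sub 1

theorem netComputable_plateau (r : ℕ) (K a b : ℝ) {d : ℕ} (i : Fin d) :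
    NetComputable r d 2 2 {fun x => plateau r K a b (x i)} := by
  have h := (NetComputable.coord r i).mono (Nat.zero_le 1)
  have h1 := (((h.add_const (-a)).const_mul K).smoothStep le_rfl).add
    (((h.const_sub b).const_mul K).smoothStep le_rfl)
  exact h1.add_const (-1)

/-- The two ramps, of width `1 / K` each, do not overlap, so at every point at least one of them is
saturated. -/
theorem plateau_cases {r : ℕ} (hr : r ≠ 0) {K a b x : ℝ} (hK : 2 ≤ K * (b - a)) :
    (plateau r K a b x = smoothStep r (K * (x - a)) ∧ 1 ≤ K * (b - x)) ∨
      (plateau r K a b x = smoothStep r (K * (b - x)) ∧ 1 ≤ K * (x - a)) := by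
  rcases le_total 1 (K * (b - x)) with h | h
  · left
    rw [plateau, smoothStep_of_one_le hr h]
    exact ⟨by ring, h⟩
  · right
    have : 1 ≤ K * (x - a) := by nlinarith
    rw [plateau, smoothStep_of_one_le hr this]
    exact ⟨by ring, this⟩

theorem plateau_mem {r : ℕ} (hr : r ≠ 0) {K a b : ℝ} (hK : 2 ≤ K * (b - a)) (x : ℝ) :
    0 ≤ plateau r K a b x ∧ plateau r K a b x ≤ 1 := by
  rcases plateau_cases hr (x := x) hK with ⟨h, _⟩ | ⟨h, _⟩ <;> rw [h] <;>
    exact ⟨smoothStep_nonneg _ _, smoothStep_le_one _ _⟩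

theorem plateau_pos_iff {r : ℕ} (hr : r ≠ 0) {K a b x : ℝ} (hK0 : 0 < K)
    (hK : 2 ≤ K * (b - a)) : 0 < plateau r K a b x ↔ x ∈ Set.Ioo a b := by
  have key : ∀ t, 0 < smoothStep r (K * t) ↔ 0 < t := by
    intro t
    refine ⟨fun h => ?_, fun h => smoothStep_pos hr (by positivity)⟩
    by_contra! ht
    rw [smoothStep_of_nonpos hr (by nlinarith)] at h
    exact h.false
  rcases plateau_cases hr (x := x) hK with ⟨h, h1⟩ | ⟨h, h1⟩ <;> rw [h, key, Set.mem_Ioo]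
  · exact ⟨fun h => ⟨by linarith, by nlinarith⟩, fun h => by linarith [h.1]⟩
  · exact ⟨fun h => ⟨by nlinarith, by linarith⟩, fun h => by linarith [h.2]⟩

theorem plateau_eq_zero {r : ℕ} (hr : r ≠ 0) {K a b x : ℝ} (hK0 : 0 < K)
    (hK : 2 ≤ K * (b - a)) (hx : x ∉ Set.Ioo a b) : plateau r K a b x = 0 :=
  le_antisymm (not_lt.1 fun h => hx ((plateau_pos_iff hr hK0 hK).1 h)) (plateau_mem hr hK x).1

theorem plateau_eq_one {r : ℕ} (hr : r ≠ 0) {K a b x : ℝ} (ha : 1 ≤ K * (x - a))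
    (hb : 1 ≤ K * (b - x)) : plateau r K a b x = 1 := by
  rw [plateau, smoothStep_of_one_le hr ha, smoothStep_of_one_le hr hb]
  ring

/-- In the degenerate case `a = b = t` the plateau formula yields the negative of a bump of height
one and radius `1 / K` at `t`. Breakpoints and intervals can thus be treated by the same formula. -/
theorem plateau_self_cases {r : ℕ} (hr : r ≠ 0) {K t x : ℝ} (hK0 : 0 < K) :
    (t ≤ x ∧ plateau r K t t x = smoothStep r (K * (x - t)) - 1) ∨
      (x ≤ t ∧ plateau r K t t x = smoothStep r (K * (t - x)) - 1) := by
  rcases le_total t x with h | h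
  · left
    rw [plateau, smoothStep_of_nonpos hr (t := K * (t - x)) (by nlinarith)]
    exact ⟨h, by ring⟩
  · right
    rw [plateau, smoothStep_of_nonpos hr (t := K * (x - t)) (by nlinarith)]
    exact ⟨h, by ring⟩

theorem plateau_self_mem {r : ℕ} (hr : r ≠ 0) {K t : ℝ} (hK0 : 0 < K) (x : ℝ) :
    0 ≤ -plateau r K t t x ∧ -plateau r K t t x ≤ 1 := by
  rcases plateau_self_cases hr (t := t) (x := x) hK0 with ⟨_, h⟩ | ⟨_, h⟩ <;> rw [h] <;>
    constructor <;> linarith [smoothStep_nonneg r (K * (x - t)), smoothStep_le_one r (K * (x - t)),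
      smoothStep_nonneg r (K * (t - x)), smoothStep_le_one r (K * (t - x))]

theorem plateau_self_eq_zero {r : ℕ} (hr : r ≠ 0) {K t x : ℝ} (hK0 : 0 < K)
    (hx : 1 ≤ K * |x - t|) : plateau r K t t x = 0 := by
  rcases plateau_self_cases hr (t := t) (x := x) hK0 with ⟨h0, h⟩ | ⟨h0, h⟩
  · rw [abs_of_nonneg (by linarith)] at hx
    rw [h, smoothStep_of_one_le hr hx, sub_self]
  · rw [abs_of_nonpos (by linarith), neg_sub] at hx
    rw [h, smoothStep_of_one_le hr hx, sub_self]

theorem plateau_self_self {r : ℕ} (hr : r ≠ 0) (K t : ℝ) : plateau r K t t t = -1 := by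
  rw [plateau, sub_self, mul_zero, smoothStep_of_nonpos hr le_rfl]
  ring

/-! ### Approximation of piecewise polynomials in one variable -/

/-- The pairs of consecutive elements of a finite set. -/
def gaps (T : Finset ℝ) : Finset (ℝ × ℝ) :=
  (T ×ˢ T).filter fun q => q.1 < q.2 ∧ ∀ t ∈ T, t ≤ q.1 ∨ q.2 ≤ t

theorem mem_gaps {T : Finset ℝ} {q : ℝ × ℝ} :
    q ∈ gaps T ↔ (q.1 ∈ T ∧ q.2 ∈ T) ∧ q.1 < q.2 ∧ ∀ t ∈ T, t ≤ q.1 ∨ q.2 ≤ t := by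
  simp [gaps]

theorem eq_of_mem_gaps {T : Finset ℝ} {q q' : ℝ × ℝ} (hq : q ∈ gaps T) (hq' : q' ∈ gaps T)
    {x : ℝ} (hx : x ∈ Set.Ioo q.1 q.2) (hx' : x ∈ Set.Ioo q'.1 q'.2) : q = q' := by
  rw [mem_gaps] at hq hq'
  obtain ⟨⟨h1, h2⟩, -, h4⟩ := hq
  obtain ⟨⟨h1', h2'⟩, -, h4'⟩ := hq'
  obtain ⟨hx1, hx2⟩ := hx
  obtain ⟨hx1', hx2'⟩ := hx'
  refine Prod.ext (le_antisymm ?_ ?_) (le_antisymm ?_ ?_)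
  · exact (h4' _ h1).resolve_right (by intro; linarith)
  · exact (h4 _ h1').resolve_right (by intro; linarith)
  · exact (h4 _ h2').resolve_left (by intro; linarith)
  · exact (h4' _ h2).resolve_left (by intro; linarith)

theorem notMem_of_mem_gap {T : Finset ℝ} {q : ℝ × ℝ} (hq : q ∈ gaps T) {x : ℝ}
    (hx : x ∈ Set.Ioo q.1 q.2) : x ∉ T := fun h => by
  rcases (mem_gaps.1 hq).2.2 x h with h1 | h1
  · exact h1.not_gt hx.1
  · exact h1.not_gt hx.2

/-- `f` is given by the polynomials `P q` on the bounded intervals `q` between breakpoints, and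
vanishes outside of these. -/
structure IsPieces (L : ℕ) (f : ℝ → ℝ) (T : Finset ℝ) (P : ℝ × ℝ → Polynomial ℝ) : Prop where
  degree_lt : ∀ q ∈ gaps T, (P q).degree < (L : WithBot ℕ)
  eq_eval : ∀ q ∈ gaps T, ∀ x ∈ Set.Ioo q.1 q.2, f x = (P q).eval x
  eq_zero : ∀ x ∉ T, (∀ q ∈ gaps T, x ∉ Set.Ioo q.1 q.2) → f x = 0

/-- On the two unbounded components the polynomial has infinitely many zeros by compactness of the
support, so it is zero. -/
theorem IsPiecewisePolynomial.exists_isPieces {L N : ℕ} {f : ℝ → ℝ}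
    (h : IsPiecewisePolynomial L N f) (hf : HasCompactSupport f) :
    ∃ T : Finset ℝ, T.card ≤ N ∧ ∃ P, IsPieces L f T P := by
  obtain ⟨T, hT, h⟩ := h
  refine ⟨T, hT, ?_⟩
  have h1 : ∀ q : ℝ × ℝ, ∃ P : Polynomial ℝ, q ∈ gaps T →
      P.degree < (L : WithBot ℕ) ∧ ∀ x ∈ Set.Ioo q.1 q.2, f x = P.eval x := by
    intro q
    by_cases hq : q ∈ gaps T
    · obtain ⟨P, hP⟩ := h (Set.Ioo q.1 q.2) Set.ordConnected_Ioo
        (Set.disjoint_left.2 fun x hx hxT => notMem_of_mem_gap hq hx hxT)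
      exact ⟨P, fun _ => hP⟩
    · exact ⟨0, fun h => absurd h hq⟩
  choose P hP using h1
  refine ⟨P, fun q hq => (hP q hq).1, fun q hq => (hP q hq).2, fun x hx hxq => ?_⟩
  have hzero : ∀ Q : Polynomial ℝ, {y | f y = 0 ∧ f y = Q.eval y}.Infinite → Q = 0 := by
    intro Q hQ
    refine Q.eq_zero_of_infinite_isRoot (hQ.mono ?_)
    rintro y ⟨h1, h2⟩
    exact h2.symm.trans h1
  obtain ⟨R, hR⟩ := hf.isCompact.isBounded.subset_closedBall 0
  have hR' : ∀ y, R < |y| → f y = 0 := by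
    intro y hy
    by_contra h0
    have := hR (subset_tsupport f h0)
    rw [Metric.mem_closedBall, dist_zero_right, Real.norm_eq_abs] at this
    exact this.not_gt hy
  by_cases hl : ∃ t ∈ T, t < x
  · by_cases hr : ∃ t ∈ T, x < t
    · exfalso
      have hl' : (T.filter (· < x)).Nonempty := by
        obtain ⟨t, ht, htx⟩ := hl
        exact ⟨t, Finset.mem_filter.2 ⟨ht, htx⟩⟩
      have hr' : (T.filter (x < ·)).Nonempty := by
        obtain ⟨t, ht, htx⟩ := hr
        exact ⟨t, Finset.mem_filter.2 ⟨ht, htx⟩⟩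
      have ha := Finset.mem_filter.1 ((T.filter (· < x)).max'_mem hl')
      have hb := Finset.mem_filter.1 ((T.filter (x < ·)).min'_mem hr')
      refine hxq ((T.filter (· < x)).max' hl', (T.filter (x < ·)).min' hr') ?_ ⟨ha.2, hb.2⟩
      refine mem_gaps.2 ⟨⟨ha.1, hb.1⟩, ha.2.trans hb.2, fun t ht => ?_⟩
      rcases lt_trichotomy t x with h1 | rfl | h1
      · exact Or.inl (Finset.le_max' _ _ (Finset.mem_filter.2 ⟨ht, h1⟩))
      · exact absurd ht hx
      · exact Or.inr (Finset.min'_le _ _ (Finset.mem_filter.2 ⟨ht, h1⟩))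
    · push Not at hr
      obtain ⟨Q, -, hQ⟩ := h (Set.Ici x) Set.ordConnected_Ici (Set.disjoint_left.2 fun y hy hyT =>
        hx (le_antisymm (hr y hyT) hy ▸ hyT))
      have := hzero Q ((Set.Ioi_infinite (max R x)).mono fun y hy => by
        have h1 := (le_max_left R x).trans_lt hy
        have h2 := (le_max_right R x).trans_lt hy
        exact ⟨hR' y (h1.trans_le (le_abs_self y)), hQ y h2.le⟩)
      rw [hQ x Set.self_mem_Ici, this, Polynomial.eval_zero]
  · push Not at hl
    obtain ⟨Q, -, hQ⟩ := h (Set.Iic x) Set.ordConnected_Iic (Set.disjoint_left.2 fun y hy hyT =>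
      hx (le_antisymm (hl y hyT) hy ▸ hyT))
    have := hzero Q ((Set.Iio_infinite (min (-R) x)).mono fun y hy => by
      have h1 := hy.trans_le (min_le_left (-R) x)
      have h2 := hy.trans_le (min_le_right (-R) x)
      exact ⟨hR' y ((lt_neg_of_lt_neg h1).trans_le (neg_le_abs y)), hQ y h2.le⟩)
    rw [hQ x Set.self_mem_Iic, this, Polynomial.eval_zero]

open Classical in
/-- The intervals between breakpoints on which the function does not vanish identically. -/
def activeGaps (T : Finset ℝ) (P : ℝ × ℝ → Polynomial ℝ) : Finset (ℝ × ℝ) :=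
  (gaps T).filter fun q => P q ≠ 0

theorem mem_activeGaps {T : Finset ℝ} {P : ℝ × ℝ → Polynomial ℝ} {q : ℝ × ℝ} :
    q ∈ activeGaps T P ↔ q ∈ gaps T ∧ P q ≠ 0 := by
  simp [activeGaps]

/-- The union of the intervals between breakpoints on which the function does not vanish
identically. -/
def activeSet (T : Finset ℝ) (P : ℝ × ℝ → Polynomial ℝ) : Set ℝ :=
  ⋃ q ∈ activeGaps T P, Set.Ioo q.1 q.2

theorem mem_activeSet {T : Finset ℝ} {P : ℝ × ℝ → Polynomial ℝ} {x : ℝ} :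
    x ∈ activeSet T P ↔ ∃ q ∈ activeGaps T P, x ∈ Set.Ioo q.1 q.2 := by
  simp only [activeSet, Set.mem_iUnion, exists_prop]

theorem isOpen_activeSet (T : Finset ℝ) (P : ℝ × ℝ → Polynomial ℝ) : IsOpen (activeSet T P) :=
  isOpen_biUnion fun _ _ => isOpen_Ioo

theorem mem_activeSet_of_ne_zero {L : ℕ} {f : ℝ → ℝ} {T : Finset ℝ} {P : ℝ × ℝ → Polynomial ℝ}
    (h : IsPieces L f T P) {x : ℝ} (hx : x ∉ T) (h0 : f x ≠ 0) : x ∈ activeSet T P := by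
  by_contra hn
  refine h0 (h.eq_zero x hx fun q hq hxq => hn (mem_activeSet.2 ⟨q, ?_, hxq⟩))
  refine mem_activeGaps.2 ⟨hq, fun hP => h0 ?_⟩
  rw [h.eq_eval q hq x hxq, hP, Polynomial.eval_zero]

/-- The exceptional points are the breakpoints and the roots of the nonzero pieces. This identifies
the essential support with the closure of an explicit open set. -/
theorem exists_finite_ne_zero_iff {L : ℕ} {f : ℝ → ℝ} {T : Finset ℝ}
    {P : ℝ × ℝ → Polynomial ℝ} (h : IsPieces L f T P) :
    ∃ Z : Set ℝ, Z.Finite ∧ ∀ x ∉ Z, (f x ≠ 0 ↔ x ∈ activeSet T P) := by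
  refine ⟨(T : Set ℝ) ∪ ⋃ q ∈ activeGaps T P, {x | (P q).IsRoot x}, ?_, fun x hx => ?_⟩
  · refine T.finite_toSet.union (Set.Finite.biUnion (Finset.finite_toSet _) fun q hq => ?_)
    exact Polynomial.finite_setOfPred_isRoot (mem_activeGaps.1 hq).2
  · rw [Set.mem_union, not_or] at hx
    refine ⟨mem_activeSet_of_ne_zero h hx.1, fun hxa h0 => hx.2 ?_⟩
    obtain ⟨q, hq, hxq⟩ := mem_activeSet.1 hxa
    refine Set.mem_biUnion hq ?_
    exact (h.eq_eval q (mem_activeGaps.1 hq).1 x hxq).symm.trans h0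

/-- The set where the bound fails is open, so it would have positive measure if it were nonempty. -/
theorem abs_le_of_ae_of_continuousOn {g : ℝ → ℝ} {M : ℝ} {U : Set ℝ} (hU : IsOpen U)
    (hg : ContinuousOn g U) (h : ∀ᵐ x : ℝ, x ∈ U → |g x| ≤ M) : ∀ x ∈ U, |g x| ≤ M := by
  by_contra! hn
  obtain ⟨x, hx, hxM⟩ := hn
  have ho : IsOpen (U ∩ (fun x => |g x|) ⁻¹' Set.Ioi M) :=
    hg.abs.isOpen_inter_preimage hU isOpen_Ioi
  have hpos := ho.measure_pos volume ⟨x, hx, hxM⟩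
  refine hpos.ne' (measure_mono_null ?_ h)
  rintro y ⟨hy, hyM⟩ hc
  exact (hc hy).not_gt hyM

theorem IsPieces.abs_eval_le {L : ℕ} {f : ℝ → ℝ} {T : Finset ℝ} {P : ℝ × ℝ → Polynomial ℝ}
    (h : IsPieces L f T P) {M : ℝ} (hM : ∀ᵐ x : ℝ, |f x| ≤ M) {q : ℝ × ℝ} (hq : q ∈ gaps T)
    {x : ℝ} (hx : x ∈ Set.Icc q.1 q.2) : |(P q).eval x| ≤ M := by
  have hc : Continuous fun y => |(P q).eval y| := (P q).continuous.abs
  have h1 : Set.Ioo q.1 q.2 ⊆ {y | |(P q).eval y| ≤ M} := by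
    refine abs_le_of_ae_of_continuousOn isOpen_Ioo (P q).continuous.continuousOn ?_
    filter_upwards [hM] with y hy hyq
    rwa [← h.eq_eval q hq y hyq]
  have h2 := closure_minimal h1 (isClosed_le hc continuous_const)
  rw [closure_Ioo (mem_gaps.1 hq).2.1.ne] at h2
  exact h2 hx

/-! ### Cutoff approximation at the scale `1 / K`. -/

/-- The breakpoints are far apart on the scale `1 / K`. -/
def IsSeparated (T : Finset ℝ) (K : ℝ) : Prop :=
  0 < K ∧ ∀ a ∈ T, ∀ b ∈ T, a < b → 2 ≤ K * (b - a)

theorem eventually_isSeparated (T : Finset ℝ) : ∀ᶠ K in Filter.atTop, IsSeparated T K := by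
  refine (Filter.eventually_gt_atTop 0).and ?_
  refine (Filter.eventually_all_finset T).2 fun a _ => (Filter.eventually_all_finset T).2 fun b _ => ?_
  by_cases hab : a < b
  · filter_upwards [Filter.eventually_ge_atTop (2 / (b - a))] with K hK _
    rwa [div_le_iff₀ (by linarith)] at hK
  · exact Filter.Eventually.of_forall fun K h => absurd h hab

/-- The approximation of `f` by means of cutoff functions at the scale `1 / K`, where `f` is
interpolated at the points in `T'`. -/
def cutoffApprox (r : ℕ) (f : ℝ → ℝ) (T T' : Finset ℝ) (P : ℝ × ℝ → Polynomial ℝ) (K x : ℝ) : ℝ :=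
  ∑ q ∈ activeGaps T P, plateau r K q.1 q.2 x * (P q).eval x +
    ∑ t ∈ T', -plateau r K t t x * f t

section

variable {r L : ℕ} {f : ℝ → ℝ} {T T' : Finset ℝ} {P : ℝ × ℝ → Polynomial ℝ} {K x : ℝ}

theorem sum_activeGaps_of_mem (hr : r ≠ 0) (h : IsPieces L f T P) (hK : IsSeparated T K)
    {q : ℝ × ℝ} (hq : q ∈ gaps T) (hx : x ∈ Set.Ioo q.1 q.2) :
    ∑ q ∈ activeGaps T P, plateau r K q.1 q.2 x * (P q).eval x =
      plateau r K q.1 q.2 x * f x := by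
  rw [h.eq_eval q hq x hx]
  refine Finset.sum_eq_single q (fun q' hq' hne => ?_) fun hn => ?_
  · have hq'' := (mem_activeGaps.1 hq').1
    have hg := mem_gaps.1 hq''
    rw [plateau_eq_zero hr hK.1 (hK.2 _ hg.1.1 _ hg.1.2 hg.2.1)
      (fun hx' => hne (eq_of_mem_gaps hq'' hq hx' hx)), zero_mul]
  · have : P q = 0 := by
      by_contra hP
      exact hn (mem_activeGaps.2 ⟨hq, hP⟩)
    rw [this, Polynomial.eval_zero, mul_zero]

theorem sum_activeGaps_of_notMem (hr : r ≠ 0) (hK : IsSeparated T K)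
    (hx : ∀ q ∈ gaps T, x ∉ Set.Ioo q.1 q.2) :
    ∑ q ∈ activeGaps T P, plateau r K q.1 q.2 x * (P q).eval x = 0 := by
  refine Finset.sum_eq_zero fun q' hq' => ?_
  have hq'' := (mem_activeGaps.1 hq').1
  have hg := mem_gaps.1 hq''
  rw [plateau_eq_zero hr hK.1 (hK.2 _ hg.1.1 _ hg.1.2 hg.2.1) (hx _ hq''), zero_mul]

theorem cutoffApprox_eq (hr : r ≠ 0) (h : IsPieces L f T P) (hK : IsSeparated T K)
    (hT' : T' ⊆ T) (hx : ∀ t ∈ T, 1 ≤ K * |x - t|) : cutoffApprox r f T T' P K x = f x := by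
  have h2 : ∑ t ∈ T', -plateau r K t t x * f t = 0 := Finset.sum_eq_zero fun t ht => by
    rw [plateau_self_eq_zero hr hK.1 (hx t (hT' ht)), neg_zero, zero_mul]
  rw [cutoffApprox, h2, add_zero]
  by_cases hq : ∃ q ∈ gaps T, x ∈ Set.Ioo q.1 q.2
  · obtain ⟨q, hq, hxq⟩ := hq
    have hg := mem_gaps.1 hq
    have h3 := hx _ hg.1.1
    have h4 := hx _ hg.1.2
    rw [abs_of_pos (sub_pos.2 hxq.1)] at h3
    rw [abs_of_neg (sub_neg.2 hxq.2), neg_sub] at h4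
    rw [sum_activeGaps_of_mem hr h hK hq hxq, plateau_eq_one hr h3 h4, one_mul]
  · push Not at hq
    rw [sum_activeGaps_of_notMem hr hK hq, h.eq_zero x _ hq]
    intro hxT
    have := hx x hxT
    norm_num at this

theorem plateau_self_eq_zero_of_ne (hr : r ≠ 0) (hK : IsSeparated T K) {s t : ℝ} (hs : s ∈ T)
    (ht : t ∈ T) (hne : s ≠ t) : plateau r K t t s = 0 := by
  refine plateau_self_eq_zero hr hK.1 ?_
  rcases lt_or_gt_of_ne hne with h | h
  · rw [abs_of_neg (sub_neg.2 h), neg_sub]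
    linarith [hK.2 s hs t ht h]
  · rw [abs_of_pos (sub_pos.2 h)]
    linarith [hK.2 t ht s hs h]

/-- The bumps at the two endpoints are complementary to the ramps of the plateau, and all other
bumps vanish on the gap. Plateau and bumps thus form a partition of unity there. -/
theorem one_sub_plateau_eq_sum (hr : r ≠ 0) (hK : IsSeparated T K) {q : ℝ × ℝ} (hq : q ∈ gaps T)
    (hx : x ∈ Set.Ioo q.1 q.2) :
    1 - plateau r K q.1 q.2 x = ∑ t ∈ T, -plateau r K t t x := by
  have hg := mem_gaps.1 hq
  have hK0 := hK.1
  rw [Finset.sum_eq_add_of_mem q.1 q.2 hg.1.1 hg.1.2 hg.2.1.ne]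
  · have h1 : plateau r K q.1 q.1 x = smoothStep r (K * (x - q.1)) - 1 := by
      rw [plateau, smoothStep_of_nonpos hr (t := K * (q.1 - x)) (by nlinarith [hx.1])]
      ring
    have h2 : plateau r K q.2 q.2 x = smoothStep r (K * (q.2 - x)) - 1 := by
      rw [plateau, smoothStep_of_nonpos hr (t := K * (x - q.2)) (by nlinarith [hx.2])]
      ring
    rw [h1, h2, plateau]
    ring
  · rintro t ht ⟨hne1, hne2⟩
    rw [plateau_self_eq_zero hr hK0, neg_zero]
    rcases hg.2.2 t ht with h1 | h1
    · have := hK.2 t ht q.1 hg.1.1 (lt_of_le_of_ne h1 hne1)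
      rw [abs_of_pos (by linarith [hx.1])]
      nlinarith [hx.1]
    · have := hK.2 q.2 hg.1.2 t ht (lt_of_le_of_ne h1 hne2.symm)
      rw [abs_of_neg (by linarith [hx.2])]
      nlinarith [hx.2]

/-- By the partition of unity the error is the sum over `t ∈ T` of the bump at `t` times `f t - f
x`, where only `t` closer than `1 / K` to `x` matter. Breakpoints with `f t = 0` may be dropped from
the interpolation. -/
theorem abs_cutoffApprox_sub_le (hr : r ≠ 0) (h : IsPieces L f T P) (hK : IsSeparated T K)
    (hT' : T' = T.filter (f · ≠ 0)) {ε : ℝ}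
    (hf : ∀ s t, K * |s - t| < 1 → |f s - f t| ≤ ε) :
    |cutoffApprox r f T T' P K x - f x| ≤ T.card * ε := by
  have hε : 0 ≤ ε := (abs_nonneg _).trans (hf 0 0 (by simp))
  have h2 : ∑ t ∈ T', -plateau r K t t x * f t = ∑ t ∈ T, -plateau r K t t x * f t := by
    rw [hT', Finset.sum_filter_of_ne]
    exact fun t _ ht => right_ne_zero_of_mul ht
  have key : cutoffApprox r f T T' P K x - f x =
      ∑ t ∈ T, -plateau r K t t x * (f t - f x) := by
    simp_rw [mul_sub, Finset.sum_sub_distrib, ← Finset.sum_mul]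
    rw [cutoffApprox, h2]
    by_cases hq : ∃ q ∈ gaps T, x ∈ Set.Ioo q.1 q.2
    · obtain ⟨q, hq, hxq⟩ := hq
      rw [sum_activeGaps_of_mem hr h hK hq hxq, ← one_sub_plateau_eq_sum hr hK hq hxq]
      ring
    · push Not at hq
      rw [sum_activeGaps_of_notMem hr hK hq]
      by_cases hxT : x ∈ T
      · have : ∑ t ∈ T, -plateau r K t t x = 1 := by
          rw [Finset.sum_eq_single_of_mem x hxT, plateau_self_self hr, neg_neg]
          intro t ht hne
          rw [plateau_self_eq_zero_of_ne hr hK hxT ht hne.symm, neg_zero]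
        rw [this]
        ring
      · rw [h.eq_zero x hxT hq]
        ring
  rw [key]
  refine (Finset.abs_sum_le_sum_abs _ _).trans ?_
  rw [← nsmul_eq_mul]
  refine Finset.sum_le_card_nsmul _ _ _ fun t _ => ?_
  by_cases hxt : K * |t - x| < 1
  · rw [abs_mul]
    have h3 := plateau_self_mem hr (t := t) hK.1 x
    rw [abs_of_nonneg h3.1]
    calc _ ≤ 1 * ε := mul_le_mul h3.2 (hf t x hxt) (abs_nonneg _) zero_le_one
      _ = ε := one_mul ε
  · rw [plateau_self_eq_zero hr hK.1 (by rw [abs_sub_comm]; exact not_lt.1 hxt)]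
    simpa using hε

theorem eventually_abs_cutoffApprox_sub_le (hr : r ≠ 0) (h : IsPieces L f T P)
    (hf : Continuous f) (hf' : HasCompactSupport f) (hT' : T' = T.filter (f · ≠ 0)) {ε : ℝ}
    (hε : 0 < ε) : ∀ᶠ K in Filter.atTop, ∀ x, |cutoffApprox r f T T' P K x - f x| ≤ ε := by
  have hu := hf'.uniformContinuous_of_continuous hf
  obtain ⟨δ, hδ, hfδ⟩ := Metric.uniformContinuous_iff.1 hu (ε / (T.card + 1)) (by positivity)
  filter_upwards [eventually_isSeparated T, Filter.eventually_ge_atTop (1 / δ)] with K hK hKδ x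
  refine (abs_cutoffApprox_sub_le hr h hK hT' (ε := ε / (T.card + 1)) fun s t hst => ?_).trans ?_
  · refine (hfδ ?_).le
    rw [Real.dist_eq]
    rw [div_le_iff₀ hδ] at hKδ
    by_contra! hn
    nlinarith [hK.1]
  · rw [mul_div_assoc', div_le_iff₀ (by positivity)]
    nlinarith

/-- Near a point with `f t ≠ 0` every point that is not a breakpoint is active, and these are dense.
So the bumps used do not enlarge the support; a bump at a zero of `f` could. -/
theorem eventually_mem_closure_activeSet (h : IsPieces L f T P) (hf : Continuous f)
    (hT' : ∀ t ∈ T', f t ≠ 0) :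
    ∀ᶠ K in Filter.atTop, ∀ t ∈ T', ∀ x, K * |x - t| < 1 → x ∈ closure (activeSet T P) := by
  refine (Filter.eventually_all_finset T').2 fun t ht => ?_
  have h0 : ∀ᶠ y in 𝓝 t, f y ≠ 0 := hf.continuousAt.eventually_ne (hT' t ht)
  obtain ⟨δ, hδ, hb⟩ := Metric.eventually_nhds_iff_ball.1 h0
  filter_upwards [Filter.eventually_ge_atTop (1 / δ)] with K hK x hx
  rw [div_le_iff₀ hδ] at hK
  have hxb : x ∈ Metric.ball t δ := by
    rw [Metric.mem_ball, Real.dist_eq]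
    by_contra! hn
    have : 0 < K := by
      by_contra! hK0
      nlinarith
    nlinarith
  have hd : Dense ((T : Set ℝ)ᶜ) := T.finite_toSet.countable.dense_compl ℝ
  refine mem_closure_iff_nhds.2 fun U hU => ?_
  obtain ⟨y, hy, hyT⟩ := hd.inter_nhds_nonempty
    (Filter.inter_mem hU (Metric.isOpen_ball.mem_nhds hxb))
  exact ⟨y, hyT.1, mem_activeSet_of_ne_zero h hy (hb y hyT.2)⟩

end

/-! ### Decomposition into cutoffs times polynomials in Lagrange form. -/

/-- A decomposition of `v : ℝ → ℝ` into at most `n` pieces, each a cutoff function times a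
polynomial of degree less than `L` in Lagrange form. -/
structure PieceSystem (r L n : ℕ) (B : ℝ) (O : Set ℝ) (v : ℝ → ℝ) where
  J : Finset (ℝ × ℝ)
  cutoff : ℝ × ℝ → ℝ → ℝ
  coord : ℝ × ℝ → ℝ → ℝ
  coeff : ℝ × ℝ → Fin L → ℝ
  card_le : J.card ≤ n
  cutoff_mem : ∀ q ∈ J, ∀ x, 0 ≤ cutoff q x ∧ cutoff q x ≤ 1
  coord_mem : ∀ q ∈ J, ∀ x, cutoff q x ≠ 0 → 0 ≤ coord q x ∧ coord q x ≤ 1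
  card_active_le : ∀ x, (J.filter fun q => cutoff q x ≠ 0).card ≤ 2
  sum_coeff_le : ∀ q ∈ J, ∑ m, |coeff q m| ≤ B
  eq_sum : ∀ x, v x = ∑ q ∈ J, cutoff q x *
    ∑ m, coeff q m * ∏ l ∈ Finset.univ.erase m, (coord q x - (l : ℕ) / ((L : ℝ) - 1))
  cutoff_eq_zero : ∀ q ∈ J, ∀ x ∉ closure O, cutoff q x = 0
  computable_cutoff : ∀ (q : ℝ × ℝ) {d : ℕ} (i : Fin d),
    NetComputable r d 2 2 {fun x => cutoff q (x i)}
  computable_coord : ∀ (q : ℝ × ℝ) {d : ℕ} (i : Fin d),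
    NetComputable r d 2 2 {fun x => coord q (x i)}

/-- Both kinds of pieces are indexed by pairs: a gap `(a, b)` carries its plateau and polynomial, a
diagonal pair `(t, t)` the bump at `t` with the constant `f t`. The plateaus are supported on
disjoint gaps and the bumps are disjoint by separation, so at most one of each kind is active at a
point. -/
theorem exists_pieceSystem {r L : ℕ} (hr : r ≠ 0) (hL : L ≠ 0) {f : ℝ → ℝ} {T T' : Finset ℝ}
    {P : ℝ × ℝ → Polynomial ℝ} (h : IsPieces L f T P) {M : ℝ}
    (hP : ∀ q ∈ gaps T, ∀ x ∈ Set.Icc q.1 q.2, |(P q).eval x| ≤ M) (hT' : T' ⊆ T)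
    (hfT : ∀ t ∈ T', |f t| ≤ M) {K : ℝ} (hK : IsSeparated T K)
    (hcl : ∀ t ∈ T', ∀ x, K * |x - t| < 1 → x ∈ closure (activeSet T P)) :
    Nonempty (PieceSystem r L (T.card * T.card + T.card) (12 ^ L * M) (activeSet T P)
      (cutoffApprox r f T T' P K)) := by
  classical
  set D : Finset (ℝ × ℝ) := T'.image fun t => (t, t) with hD
  have hsep : ∀ q ∈ activeGaps T P, q.1 < q.2 ∧ 2 ≤ K * (q.2 - q.1) := fun q hq => by
    have hg := mem_gaps.1 (mem_activeGaps.1 hq).1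
    exact ⟨hg.2.1, hK.2 _ hg.1.1 _ hg.1.2 hg.2.1⟩
  have hdisj : Disjoint (activeGaps T P) D := by
    rw [Finset.disjoint_left]
    rintro q hq hqD
    obtain ⟨t, -, rfl⟩ := Finset.mem_image.1 hqD
    exact (hsep _ hq).1.false
  set β : ℝ × ℝ → ℝ → ℝ := fun q x =>
    if q.1 < q.2 then plateau r K q.1 q.2 x else -plateau r K q.1 q.2 x with hβ
  have hβa : ∀ q ∈ activeGaps T P, ∀ x, β q x = plateau r K q.1 q.2 x :=
    fun q hq x => if_pos (hsep q hq).1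
  have hβd : ∀ t x, β (t, t) x = -plateau r K t t x := fun t x => if_neg (lt_irrefl t)
  have ha : ∀ q ∈ activeGaps T P, ∀ x, β q x ≠ 0 → x ∈ Set.Ioo q.1 q.2 := by
    intro q hq x hx
    by_contra hn
    rw [hβa q hq, plateau_eq_zero hr hK.1 (hsep q hq).2 hn] at hx
    exact hx rfl
  have hd : ∀ t x, β (t, t) x ≠ 0 → K * |x - t| < 1 := by
    intro t x hx
    by_contra! hn
    rw [hβd, plateau_self_eq_zero hr hK.1 hn] at hx
    simp at hx
  -- On a diagonal pair this is a division by zero, hence `0`, which is an admissible coordinate for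
  -- a constant polynomial.
  set z : ℝ × ℝ → ℝ → ℝ := fun q x => (x - q.1) / (q.2 - q.1) with hz
  have hcoeff : ∀ q : ℝ × ℝ, ∃ κ : Fin L → ℝ, q ∈ activeGaps T P ∪ D →
      ∑ m, |κ m| ≤ 12 ^ L * M ∧
      ∀ x, (if q.1 < q.2 then (P q).eval x else f q.1) =
        ∑ m, κ m * ∏ l ∈ Finset.univ.erase m, (z q x - (l : ℕ) / ((L : ℝ) - 1)) := by
    intro q
    by_cases hq : q ∈ activeGaps T P
    · have hlt := (hsep q hq).1
      have hq' := mem_activeGaps.1 hq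
      set A : Polynomial ℝ := Polynomial.C (q.2 - q.1) * Polynomial.X + Polynomial.C q.1 with hA
      have hAz : ∀ x, A.eval (z q x) = x := by
        intro x
        have : q.2 - q.1 ≠ 0 := by linarith
        simp only [hA, hz, Polynomial.eval_add, Polynomial.eval_mul, Polynomial.eval_C,
          Polynomial.eval_X]
        field_simp
        ring
      have hdeg : ((P q).comp A).degree < (L : WithBot ℕ) := by
        refine Polynomial.degree_le_natDegree.trans_lt ?_
        rw [Polynomial.natDegree_comp]
        have h1 : (P q).natDegree < L :=
          (Polynomial.natDegree_lt_iff_degree_lt hq'.2).2 (h.degree_lt q hq'.1)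
        have h2 : A.natDegree ≤ 1 := Polynomial.natDegree_linear_le
        exact_mod_cast (Nat.mul_le_mul_left _ h2).trans_lt (by simpa using h1)
      obtain ⟨κ, h1, h2⟩ := exists_lagrange hL _ hdeg (M := M) fun y hy0 hy1 => by
        rw [Polynomial.eval_comp]
        refine hP q hq'.1 _ ?_
        simp only [hA, Polynomial.eval_add, Polynomial.eval_mul, Polynomial.eval_C,
          Polynomial.eval_X]
        constructor <;> nlinarith
      refine ⟨κ, fun _ => ⟨h1, fun x => ?_⟩⟩
      rw [if_pos hlt, ← h2, Polynomial.eval_comp, hAz]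
    · by_cases hqD : q ∈ D
      · obtain ⟨t, ht, rfl⟩ := Finset.mem_image.1 hqD
        have hdeg : (Polynomial.C (f t)).degree < (L : WithBot ℕ) :=
          Polynomial.degree_C_le.trans_lt (by exact_mod_cast Nat.pos_of_ne_zero hL)
        obtain ⟨κ, h1, h2⟩ := exists_lagrange hL _ hdeg (M := M) fun y _ _ => by
          rw [Polynomial.eval_C]; exact hfT t ht
        refine ⟨κ, fun _ => ⟨h1, fun x => ?_⟩⟩
        rw [← h2, if_neg (lt_irrefl _), Polynomial.eval_C]
      · refine ⟨0, fun hn => ?_⟩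
        rw [Finset.mem_union] at hn
        tauto
  choose κ hκ using hcoeff
  refine ⟨.mk (activeGaps T P ∪ D) β z κ ?_ ?_ ?_ ?_ ?_ ?_ ?_ ?_ ?_⟩
  · refine (Finset.card_union_le _ _).trans (add_le_add ?_ ?_)
    · refine (Finset.card_filter_le _ _).trans ((Finset.card_filter_le _ _).trans ?_)
      rw [Finset.card_product]
    · exact Finset.card_image_le.trans (Finset.card_le_card hT')
  · intro q hq x
    rcases Finset.mem_union.1 hq with hq | hq
    · rw [hβa q hq]
      exact plateau_mem hr (hsep q hq).2 x
    · obtain ⟨t, -, rfl⟩ := Finset.mem_image.1 hq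
      rw [hβd]
      exact plateau_self_mem hr hK.1 x
  · intro q hq x hx
    rcases Finset.mem_union.1 hq with hq | hq
    · have h1 := ha q hq x hx
      have h2 := (hsep q hq).1
      constructor
      · exact div_nonneg (by linarith [h1.1]) (by linarith)
      · exact div_le_one_of_le₀ (by linarith [h1.2]) (by linarith)
    · obtain ⟨t, -, rfl⟩ := Finset.mem_image.1 hq
      simp [hz]
  · intro x
    rw [Finset.filter_union]
    refine (Finset.card_union_le _ _).trans (Nat.add_le_add (b := 1) (d := 1) ?_ ?_)
    · refine Finset.card_le_one.2 fun q hq q' hq' => ?_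
      rw [Finset.mem_filter] at hq hq'
      exact eq_of_mem_gaps (mem_activeGaps.1 hq.1).1 (mem_activeGaps.1 hq'.1).1
        (ha q hq.1 x hq.2) (ha q' hq'.1 x hq'.2)
    · refine Finset.card_le_one.2 fun q hq q' hq' => ?_
      rw [Finset.mem_filter] at hq hq'
      obtain ⟨hq, hx⟩ := hq
      obtain ⟨hq', hx'⟩ := hq'
      obtain ⟨t, ht, rfl⟩ := Finset.mem_image.1 hq
      obtain ⟨s, hs, rfl⟩ := Finset.mem_image.1 hq'
      have h1 := hd t x hx
      have h2 := hd s x hx'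
      have h3 : K * |t - s| < 2 := by
        calc K * |t - s| ≤ K * (|x - t| + |x - s|) := by
              refine mul_le_mul_of_nonneg_left ?_ hK.1.le
              rw [abs_sub_comm x t]
              exact abs_sub_le t x s
          _ < 2 := by linarith
      rcases lt_trichotomy t s with hlt | rfl | hlt
      · have := hK.2 t (hT' ht) s (hT' hs) hlt
        rw [abs_of_neg (sub_neg.2 hlt)] at h3
        linarith
      · rfl
      · have := hK.2 s (hT' hs) t (hT' ht) hlt
        rw [abs_of_pos (sub_pos.2 hlt)] at h3
        linarith
  · exact fun q hq => (hκ q hq).1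
  · intro x
    rw [Finset.sum_union hdisj, cutoffApprox]
    congr 1
    · refine Finset.sum_congr rfl fun q hq => ?_
      rw [← (hκ q (Finset.mem_union_left _ hq)).2, if_pos (hsep q hq).1, hβa q hq]
    · rw [Finset.sum_image fun a _ b _ hab => (Prod.ext_iff.1 hab).1]
      refine Finset.sum_congr rfl fun t ht => ?_
      rw [← (hκ (t, t) (Finset.mem_union_right _ (Finset.mem_image_of_mem _ ht))).2,
        if_neg (lt_irrefl _), hβd]
  · intro q hq x hx
    by_contra hn
    rcases Finset.mem_union.1 hq with hq | hq
    · exact hx (subset_closure (mem_activeSet.2 ⟨q, hq, ha q hq x hn⟩))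
    · obtain ⟨t, ht, rfl⟩ := Finset.mem_image.1 hq
      exact hx (hcl t ht x (hd t x hn))
  · intro q d i
    by_cases hlt : q.1 < q.2
    · simp only [hβ, if_pos hlt]
      exact netComputable_plateau r K q.1 q.2 i
    · simp only [hβ, if_neg hlt]
      simpa using (netComputable_plateau r K q.1 q.2 i).const_mul (-1)
  · intro q d i
    have h1 := ((NetComputable.coord r i).add_const (-q.1)).const_mul (q.2 - q.1)⁻¹
    convert ((h1.mono (Nat.zero_le 2)).lift (by norm_num) 2) using 3
    simp only [hz, div_eq_inv_mul]
    ring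

theorem exists_computable_pos_iff_activeSet {r : ℕ} (hr : r ≠ 0) {T : Finset ℝ}
    (P : ℝ × ℝ → Polynomial ℝ) {K : ℝ} (hK : IsSeparated T K) :
    ∃ b : ℝ → ℝ, (∀ x, 0 ≤ b x) ∧ (∀ x, 0 < b x ↔ x ∈ activeSet T P) ∧
      ∀ {d : ℕ} (i : Fin d), NetComputable r d (2 * (T.card * T.card)) 2 {fun x => b (x i)} := by
  have hsep : ∀ q ∈ activeGaps T P, 2 ≤ K * (q.2 - q.1) := fun q hq => by
    have hg := mem_gaps.1 (mem_activeGaps.1 hq).1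
    exact hK.2 _ hg.1.1 _ hg.1.2 hg.2.1
  have h0 : ∀ x, ∀ q ∈ activeGaps T P, 0 ≤ plateau r K q.1 q.2 x :=
    fun x q hq => (plateau_mem hr (hsep q hq) x).1
  refine ⟨fun x => ∑ q ∈ activeGaps T P, plateau r K q.1 q.2 x,
    fun x => Finset.sum_nonneg (h0 x), fun x => ?_, fun i => ?_⟩
  · rw [mem_activeSet, Finset.sum_pos_iff_of_nonneg (h0 x)]
    refine exists_congr fun q => and_congr_right fun hq => ?_
    exact plateau_pos_iff hr hK.1 (hsep q hq)
  · refine (NetComputable.sum _ fun q _ => netComputable_plateau r K q.1 q.2 i).mono ?_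
    rw [mul_comm]
    refine Nat.mul_le_mul_left _ ?_
    refine (Finset.card_filter_le _ _).trans ((Finset.card_filter_le _ _).trans ?_)
    rw [Finset.card_product]

/-! ### Products of functions of one variable -/

/-- The product of the `v i (x i)` can be approximated by a network, and the approximation vanishes
where one of the cutoffs does. -/
theorem exists_computable_prod {r L n N D : ℕ} {B δ : ℝ} {Q : ℝ → ℝ} {d : ℕ} {O : Fin d → Set ℝ}
    {v : Fin d → ℝ → ℝ} (S : ∀ i, PieceSystem r L n B (O i) (v i))
    (hB0 : 0 ≤ B) (hQ : IsPowerApprox r N D δ Q) (hN : d * L ≤ N) :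
    ∃ G : (Fin d → ℝ) → ℝ,
      NetComputable r d (n ^ d * (L ^ d * (2 ^ N * max (N * 2) 3))) (2 + D) {G} ∧
      (∀ x, (∃ i, x i ∉ closure (O i)) → G x = 0) ∧
      ∀ x, |G x - ∏ i, v i (x i)| ≤ (2 * B) ^ d * (6 ^ N * δ) := by
  classical
  obtain ⟨μ, hμ0, hμ, hμc⟩ := exists_prodApprox hQ (ι := Fin d × Fin L) (by simpa using hN)
  -- The Lagrange product for the node `m i` omits the factor `l = m i`; the cutoff takes this free
  -- slot. Every term then has exactly `d * L` factors.
  set y : (Fin d → ℝ × ℝ) → (Fin d → Fin L) → (Fin d → ℝ) → Fin d × Fin L → ℝ :=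
    fun q m x j => if j.2 = m j.1 then (S j.1).cutoff (q j.1) (x j.1)
      else (S j.1).coord (q j.1) (x j.1) - (j.2 : ℕ) / ((L : ℝ) - 1) with hy
  set J := Fintype.piFinset fun i => (S i).J with hJ
  set c : (Fin d → ℝ × ℝ) → (Fin d → Fin L) → ℝ := fun q m => ∏ i, (S i).coeff (q i) (m i) with hc
  have hprod : ∀ q m x, ∏ j, y q m x j = ∏ i, (S i).cutoff (q i) (x i) *
      ∏ l ∈ Finset.univ.erase (m i), ((S i).coord (q i) (x i) - (l : ℕ) / ((L : ℝ) - 1)) := by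
    intro q m x
    rw [Fintype.prod_prod_type]
    refine Finset.prod_congr rfl fun i _ => ?_
    rw [← Finset.mul_prod_erase _ _ (Finset.mem_univ (m i))]
    congr 1
    · simp [hy]
    · refine Finset.prod_congr rfl fun l hl => ?_
      simp [hy, Finset.ne_of_mem_erase hl]
  have hzero : ∀ q m x, (∃ i, (S i).cutoff (q i) (x i) = 0) →
      μ (y q m x) = 0 ∧ ∏ j, y q m x j = 0 := by
    rintro q m x ⟨i, hi⟩
    have : y q m x (i, m i) = 0 := by simp [hy, hi]
    exact ⟨hμ0 _ ⟨_, this⟩, Finset.prod_eq_zero (Finset.mem_univ (i, m i)) this⟩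
  have hv : ∀ x, ∏ i, v i (x i) = ∑ q ∈ J, ∑ m : Fin d → Fin L, c q m * ∏ j, y q m x j := by
    intro x
    simp_rw [(S _).eq_sum]
    rw [Finset.prod_univ_sum]
    refine Finset.sum_congr rfl fun q _ => ?_
    simp_rw [Finset.mul_sum]
    rw [Finset.prod_univ_sum, Fintype.piFinset_univ]
    refine Finset.sum_congr rfl fun m _ => ?_
    rw [hprod, hc, ← Finset.prod_mul_distrib]
    refine Finset.prod_congr rfl fun i _ => ?_
    ring
  have herr : 0 ≤ 6 ^ N * δ := mul_nonneg (by positivity)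
    ((abs_nonneg _).trans (hQ.abs_sub_le 0 (by simp)))
  refine ⟨fun x => ∑ q ∈ J, ∑ m : Fin d → Fin L, c q m * μ (y q m x), ?_, ?_, ?_⟩
  · refine (NetComputable.sum J (w := L ^ d * (2 ^ N * max (N * 2) 3)) fun q _ => ?_).mono ?_
    · have := NetComputable.sum (r := r) (D := 2 + D) (w := 2 ^ N * max (N * 2) 3)
        (Finset.univ : Finset (Fin d → Fin L)) (F := fun m x => c q m * μ (y q m x)) fun m _ => ?_
      · refine this.mono ?_
        simp
      · refine NetComputable.const_mul (hμc (f := fun j x => y q m x j) fun j => ?_) _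
        by_cases hj : j.2 = m j.1
        · simp only [hy, if_pos hj]
          exact (S j.1).computable_cutoff _ _
        · simp only [hy, if_neg hj]
          exact ((S j.1).computable_coord _ _).add_const _
    · refine Nat.mul_le_mul_right _ ?_
      rw [hJ, Fintype.card_piFinset]
      refine (Finset.prod_le_pow_card _ _ n fun i _ => (S i).card_le).trans ?_
      simp
  · rintro x ⟨i, hi⟩
    refine Finset.sum_eq_zero fun q hq => Finset.sum_eq_zero fun m _ => ?_
    rw [(hzero q m x ⟨i, (S i).cutoff_eq_zero _ (Fintype.mem_piFinset.1 hq i) _ hi⟩).1, mul_zero]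
  · intro x
    rw [hv]
    simp_rw [← Finset.sum_sub_distrib, ← mul_sub]
    -- Inactive pieces cause no error, and the sum over active ones factors into univariate sums
    -- bounded by `2 * B`. The number `n` of pieces thus enters the width but not the error, which
    -- keeps the depth independent of the number of breakpoints.
    set ind : Fin d → ℝ × ℝ → ℝ := fun i q => if (S i).cutoff q (x i) ≠ 0 then 1 else 0 with hind
    have hterm : ∀ q ∈ J, ∀ m : Fin d → Fin L, |c q m * (μ (y q m x) - ∏ j, y q m x j)| ≤
        (∏ i, ind i (q i) * |(S i).coeff (q i) (m i)|) * (6 ^ N * δ) := by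
      intro q hq m
      by_cases hq0 : ∃ i, (S i).cutoff (q i) (x i) = 0
      · obtain ⟨h1, h2⟩ := hzero q m x hq0
        rw [h1, h2, sub_self, mul_zero, abs_zero]
        refine mul_nonneg (Finset.prod_nonneg fun i _ => mul_nonneg ?_ (abs_nonneg _)) herr
        simp only [hind]
        split_ifs <;> norm_num
      · push Not at hq0
        have h1 : ∏ i, ind i (q i) * |(S i).coeff (q i) (m i)| = |c q m| := by
          rw [hc, Finset.abs_prod]
          refine Finset.prod_congr rfl fun i _ => ?_
          simp [hind, hq0 i]
        rw [h1, abs_mul]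
        refine mul_le_mul_of_nonneg_left (hμ _ ?_) (abs_nonneg _)
        intro j
        have hqj := Fintype.mem_piFinset.1 hq j.1
        by_cases hj : j.2 = m j.1
        · simp only [hy, if_pos hj]
          have := (S j.1).cutoff_mem _ hqj (x j.1)
          rw [abs_of_nonneg this.1]
          exact this.2
        · simp only [hy, if_neg hj]
          have h2 := (S j.1).coord_mem _ hqj _ (hq0 j.1)
          have hjL : ((j.2 : ℕ) : ℝ) + 1 ≤ L := by exact_mod_cast j.2.2
          have h3 : (0 : ℝ) ≤ (j.2 : ℕ) / ((L : ℝ) - 1) :=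
            div_nonneg (by positivity) (by linarith [((j.2 : ℕ).cast_nonneg : (0 : ℝ) ≤ (j.2 : ℕ))])
          have h4 : ((j.2 : ℕ) : ℝ) / ((L : ℝ) - 1) ≤ 1 :=
            div_le_one_of_le₀ (by linarith)
              (by linarith [((j.2 : ℕ).cast_nonneg : (0 : ℝ) ≤ (j.2 : ℕ))])
          rw [abs_le]
          constructor <;> linarith [h2.1, h2.2]
    calc |∑ q ∈ J, ∑ m : Fin d → Fin L, c q m * (μ (y q m x) - ∏ j, y q m x j)|
        ≤ ∑ q ∈ J, ∑ m : Fin d → Fin L,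
            (∏ i, ind i (q i) * |(S i).coeff (q i) (m i)|) * (6 ^ N * δ) := by
          refine (Finset.abs_sum_le_sum_abs _ _).trans (Finset.sum_le_sum fun q hq => ?_)
          exact (Finset.abs_sum_le_sum_abs _ _).trans (Finset.sum_le_sum fun m _ => hterm q hq m)
      _ = (∏ i, ∑ q ∈ (S i).J, ∑ m, ind i q * |(S i).coeff q m|) * (6 ^ N * δ) := by
          rw [Finset.prod_univ_sum, Finset.sum_mul]
          refine Finset.sum_congr rfl fun q _ => ?_
          rw [Finset.prod_univ_sum, Fintype.piFinset_univ, Finset.sum_mul]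
      _ ≤ (2 * B) ^ d * (6 ^ N * δ) := by
          refine mul_le_mul_of_nonneg_right ?_ herr
          have h1 : ∀ i : Fin d, ∑ q ∈ (S i).J, ∑ m, ind i q * |(S i).coeff q m| ≤ 2 * B := by
            intro i
            simp_rw [← Finset.mul_sum, hind, ite_mul, one_mul, zero_mul]
            rw [← Finset.sum_filter]
            set F := (S i).J.filter fun q => (S i).cutoff q (x i) ≠ 0 with hF
            rcases F.eq_empty_or_nonempty with h0 | ⟨q₀, hq₀⟩
            · rw [h0, Finset.sum_empty]
              positivity
            · have hB : 0 ≤ B := (Finset.sum_nonneg fun m _ => abs_nonneg _).trans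
                ((S i).sum_coeff_le q₀ (Finset.mem_filter.1 hq₀).1)
              refine (Finset.sum_le_card_nsmul _ _ B fun q hq =>
                (S i).sum_coeff_le q (Finset.mem_filter.1 hq).1).trans ?_
              rw [nsmul_eq_mul]
              refine mul_le_mul_of_nonneg_right ?_ hB
              exact_mod_cast (S i).card_active_le (x i)
          refine (Finset.prod_le_prod (fun i _ => Finset.sum_nonneg fun q _ =>
            Finset.sum_nonneg fun m _ => mul_nonneg ?_ (abs_nonneg _)) fun i _ => h1 i).trans ?_
          · simp only [hind]
            split_ifs <;> norm_num
          · simp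

/-- At most two pieces are active, and each is bounded by its coefficient sum. The bound does not
see the scale `K`, so it controls the error near the breakpoints as `K → ∞`. -/
theorem PieceSystem.abs_le {r L n : ℕ} {B : ℝ} {O : Set ℝ} {v : ℝ → ℝ}
    (S : PieceSystem r L n B O v) (hB : 0 ≤ B) (x : ℝ) : |v x| ≤ 2 * B := by
  classical
  rw [S.eq_sum]
  refine (Finset.abs_sum_le_sum_abs _ _).trans ?_
  rw [← Finset.sum_filter_of_ne (p := fun q => S.cutoff q x ≠ 0)]
  · refine (Finset.sum_le_card_nsmul _ _ B fun q hq => ?_).trans ?_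
    · obtain ⟨hq, hne⟩ := Finset.mem_filter.1 hq
      have h1 := S.cutoff_mem q hq x
      have h2 := S.coord_mem q hq x hne
      have h3 : |∑ m, S.coeff q m *
          ∏ l ∈ Finset.univ.erase m, (S.coord q x - (l : ℕ) / ((L : ℝ) - 1))| ≤ B := by
        refine (Finset.abs_sum_le_sum_abs _ _).trans (le_trans ?_ (S.sum_coeff_le q hq))
        refine Finset.sum_le_sum fun m _ => ?_
        rw [abs_mul]
        refine mul_le_of_le_one_right (abs_nonneg _) ?_
        rw [Finset.abs_prod]
        refine Finset.prod_le_one (fun _ _ => abs_nonneg _) fun l _ => ?_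
        have h0 : (0 : ℝ) ≤ (l : ℕ) := Nat.cast_nonneg _
        have hl : ((l : ℕ) : ℝ) + 1 ≤ L := by exact_mod_cast l.2
        have h3 : (0 : ℝ) ≤ (l : ℕ) / ((L : ℝ) - 1) := div_nonneg h0 (by linarith)
        have h4 : ((l : ℕ) : ℝ) / ((L : ℝ) - 1) ≤ 1 :=
          div_le_one_of_le₀ (by linarith) (by linarith)
        rw [_root_.abs_le]
        constructor <;> linarith [h2.1, h2.2]
      rw [abs_mul, abs_of_nonneg h1.1]
      calc _ ≤ 1 * B := mul_le_mul h1.2 h3 (abs_nonneg _) zero_le_one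
        _ = B := one_mul B
    · rw [nsmul_eq_mul]
      exact mul_le_mul_of_nonneg_right (by exact_mod_cast S.card_active_le x) hB
  · intro q _ h h0
    rw [h0, zero_mul, abs_zero] at h
    exact h rfl

/-- The one-variable approximations of a compactly supported piecewise polynomial. -/
theorem IsPiecewisePolynomial.exists_approx {r L N : ℕ} (hr : r ≠ 0) (hL : L ≠ 0) {f : ℝ → ℝ}
    (h : IsPiecewisePolynomial L N f) (hf : HasCompactSupport f) {M : ℝ}
    (hM : ∀ᵐ x : ℝ, |f x| ≤ M) :
    ∃ (T : Finset ℝ) (O : Set ℝ) (v : ℝ → ℝ → ℝ), IsOpen O ∧ closure O ⊆ tsupport f ∧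
      (∃ Z : Set ℝ, Z.Finite ∧ ∀ x ∉ Z, (f x ≠ 0 ↔ x ∈ O)) ∧
      (∀ᶠ K in Filter.atTop, Nonempty (PieceSystem r L (N * N + N) (12 ^ L * M) O (v K)) ∧
        (∀ x, (∀ t ∈ T, 1 ≤ K * |x - t|) → v K x = f x) ∧
        ∃ b : ℝ → ℝ, (∀ x, 0 ≤ b x) ∧ (∀ x, 0 < b x ↔ x ∈ O) ∧
          ∀ {d : ℕ} (i : Fin d), NetComputable r d (2 * (N * N)) 2 {fun x => b (x i)}) ∧
      (Continuous f → ∀ ε > 0, ∀ᶠ K in Filter.atTop, ∀ x, |v K x - f x| ≤ ε) := by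
  classical
  obtain ⟨T, hTN, P, hP⟩ := h.exists_isPieces hf
  -- Without continuity the values at the breakpoints are meaningless, and no bumps are used.
  set T' : Finset ℝ := if Continuous f then T.filter (f · ≠ 0) else ∅ with hT'
  have hT'T : T' ⊆ T := by
    rw [hT']
    split_ifs
    · exact Finset.filter_subset _ _
    · exact Finset.empty_subset _
  have hfT : ∀ t ∈ T', |f t| ≤ M := by
    intro t ht
    by_cases hc : Continuous f
    · exact abs_le_of_ae_of_continuousOn isOpen_univ hc.continuousOn
        (by filter_upwards [hM] with x hx _ using hx) t (Set.mem_univ t)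
    · rw [hT', if_neg hc] at ht
      simp at ht
  have hcl : ∀ᶠ K in Filter.atTop, ∀ t ∈ T', ∀ x, K * |x - t| < 1 →
      x ∈ closure (activeSet T P) := by
    by_cases hc : Continuous f
    · refine eventually_mem_closure_activeSet hP hc fun t ht => ?_
      rw [hT', if_pos hc] at ht
      exact (Finset.mem_filter.1 ht).2
    · refine Filter.Eventually.of_forall fun K t ht => ?_
      rw [hT', if_neg hc] at ht
      simp at ht
  obtain ⟨Z, hZ, hfZ⟩ := exists_finite_ne_zero_iff hP
  refine ⟨T, activeSet T P, cutoffApprox r f T T' P, isOpen_activeSet T P, ?_, ⟨Z, hZ, hfZ⟩,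
    ?_, ?_⟩
  · refine closure_minimal (fun x hx => ?_) (isClosed_tsupport f)
    refine mem_closure_iff_nhds.2 fun U hU => ?_
    obtain ⟨y, hy, hyU⟩ := (hZ.countable.dense_compl ℝ).inter_nhds_nonempty
      (Filter.inter_mem hU ((isOpen_activeSet T P).mem_nhds hx))
    exact ⟨y, hyU.1, (hfZ y hy).2 hyU.2⟩
  · filter_upwards [eventually_isSeparated T, hcl] with K hK hclK
    have hNN : T.card * T.card ≤ N * N := Nat.mul_le_mul hTN hTN
    refine ⟨?_, fun x hx => cutoffApprox_eq hr hP hK hT'T hx, ?_⟩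
    · obtain ⟨S⟩ := exists_pieceSystem hr hL hP
        (fun q hq x hx => hP.abs_eval_le hM hq hx) hT'T hfT hK hclK
      exact ⟨{ S with card_le := S.card_le.trans (add_le_add hNN hTN) }⟩
    · obtain ⟨b, h1, h2, h3⟩ := exists_computable_pos_iff_activeSet hr P hK
      exact ⟨b, h1, h2, fun i => (h3 i).mono (Nat.mul_le_mul_left _ hNN)⟩
  · intro hc ε hε
    exact eventually_abs_cutoffApprox_sub_le hr hP hc hf (by rw [hT', if_pos hc]) hε

/-! ### Supports -/

/-- Where `B > 0`, the equation `G + η B = 0` determines `η`. The interiors for different `η` are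
therefore disjoint open sets, and in a separable space only countably many of them can be nonempty.
-/
theorem exists_interior_eq_empty {X : Type*} [TopologicalSpace X]
    [TopologicalSpace.SeparableSpace X] (G B : X → ℝ) {η₀ : ℝ} (hη₀ : 0 < η₀) :
    ∃ η, 0 < η ∧ η < η₀ ∧ interior {x | 0 < B x ∧ G x + η * B x = 0} = ∅ := by
  by_contra! hn
  set A : ℝ → Set X := fun η => interior {x | 0 < B x ∧ G x + η * B x = 0} with hA
  have hd : (Set.Ioo 0 η₀).PairwiseDisjoint A := by
    intro s _ t _ hst
    refine Set.disjoint_left.2 fun x hs ht => hst ?_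
    have h1 := interior_subset hs
    have h2 := interior_subset ht
    exact mul_right_cancel₀ h1.1.ne' (by linarith [h1.2, h2.2])
  have hc : (Set.Ioo 0 η₀).Countable :=
    hd.countable_of_isOpen (fun _ _ => isOpen_interior) fun η hη => hn η hη.1 hη.2
  exact (Cardinal.Real.Ioo_countable_iff.1 hc).not_gt hη₀

theorem tsupport_add_eq {X : Type*} [TopologicalSpace X] {G B : X → ℝ} {η : ℝ} {O : Set X}
    (hB : ∀ x, 0 ≤ B x) (hBO : ∀ x, 0 < B x ↔ x ∈ O) (hG : ∀ x ∉ closure O, G x = 0)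
    (hη : interior {x | 0 < B x ∧ G x + η * B x = 0} = ∅) (hO : IsOpen O) :
    tsupport (fun x => G x + η * B x) = closure O := by
  refine subset_antisymm (closure_minimal (fun x hx => ?_) isClosed_closure)
    (closure_minimal (fun x hx => ?_) (isClosed_tsupport _))
  · by_contra hn
    have : B x = 0 := le_antisymm (not_lt.1 fun h => hn (subset_closure ((hBO x).1 h))) (hB x)
    rw [Function.mem_support, hG x hn, this] at hx
    simp at hx
  · refine mem_closure_iff_nhds.2 fun U hU => ?_
    by_contra hn
    rw [Set.not_nonempty_iff_eq_empty] at hn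
    have : x ∈ interior {x | 0 < B x ∧ G x + η * B x = 0} := by
      refine mem_interior_iff_mem_nhds.2 (Filter.mem_of_superset
        (Filter.inter_mem hU (hO.mem_nhds hx)) fun y hy => ⟨(hBO y).2 hy.2, ?_⟩)
      by_contra h0
      have : y ∈ U ∩ Function.support fun x => G x + η * B x := ⟨hy.1, h0⟩
      rw [hn] at this
      exact this
    rw [hη] at this
    exact this

theorem essSupport_eq_closure {d : ℕ} {f : (Fin d → ℝ) → ℝ} {O : Set (Fin d → ℝ)} (hO : IsOpen O)
    (h : ∀ᵐ x, f x ≠ 0 ↔ x ∈ O) : essSupport f = closure O := by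
  ext x
  have h1 : ∀ U : Set (Fin d → ℝ), volume (U ∩ {y | f y ≠ 0}) = volume (U ∩ O) := by
    intro U
    refine measure_congr ?_
    filter_upwards [h] with y hy
    exact propext (and_congr_right fun _ => hy)
  simp only [essSupport, h1]
  constructor
  · intro hx
    exact mem_closure_iff_nhds.2 fun U hU => nonempty_of_measure_ne_zero (hx U hU).ne'
  · intro hx U hU
    obtain ⟨V, hVU, hV, hxV⟩ := mem_nhds_iff.1 hU
    obtain ⟨y, hyV, hy⟩ := mem_closure_iff.1 hx V hV hxV
    exact ((hV.inter hO).measure_pos volume ⟨y, hyV, hy⟩).trans_le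
      (measure_mono (Set.inter_subset_inter_left _ hVU))

theorem ae_forall_coord {d : ℕ} {p : Fin d → ℝ → Prop} (h : ∀ i, ∀ᵐ t : ℝ, p i t) :
    ∀ᵐ x : Fin d → ℝ, ∀ i, p i (x i) := by
  refine ae_all_iff.2 fun i => ?_
  exact (Measure.quasiMeasurePreserving_eval (μ := fun _ : Fin d => (volume : Measure ℝ)) i).ae
    (h i)

theorem ae_prod_ne_zero_iff {d : ℕ} {f : Fin d → ℝ → ℝ} {O : Fin d → Set ℝ}
    (h : ∀ i, ∃ Z : Set ℝ, Z.Finite ∧ ∀ x ∉ Z, (f i x ≠ 0 ↔ x ∈ O i)) :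
    ∀ᵐ x : Fin d → ℝ, (∏ i, f i (x i) ≠ 0 ↔ x ∈ Set.pi Set.univ O) := by
  choose Z hZ hfZ using h
  have h1 : ∀ᵐ x : Fin d → ℝ, ∀ i, x i ∉ Z i :=
    ae_forall_coord (p := fun i t => t ∉ Z i) fun i =>
      measure_eq_zero_iff_ae_notMem.1 ((hZ i).measure_zero _)
  filter_upwards [h1] with x hx
  rw [Finset.prod_ne_zero_iff, Set.mem_univ_pi]
  simp only [Finset.mem_univ, true_implies]
  exact forall_congr' fun i => hfZ i (x i) (hx i)

/-- A function positive exactly on a product of sets. -/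
theorem exists_computable_pos_iff_pi {r : ℕ} (hr : r ≠ 0) {d w : ℕ} {O : Fin d → Set ℝ}
    (h : ∀ i : Fin d, ∃ b : ℝ → ℝ, (∀ x, 0 ≤ b x) ∧ (∀ x, 0 < b x ↔ x ∈ O i) ∧
      NetComputable r d w 2 {fun x => b (x i)}) :
    ∃ B, NetComputable r d (3 ^ Nat.clog 2 d * (w + 1)) (2 + Nat.clog 2 d) {B} ∧
      (∀ x, 0 ≤ B x) ∧ ∀ x, 0 < B x ↔ x ∈ Set.pi Set.univ O := by
  choose b hb0 hbO hbc using h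
  -- The list is padded with the constant one, because the conjunction takes a power of two of
  -- arguments.
  set F : ℕ → (Fin d → ℝ) → ℝ := fun j x => if hj : j < d then b ⟨j, hj⟩ (x ⟨j, hj⟩) else 1 with hF
  have hFc : ∀ j, NetComputable r d (w + 1) 2 {F j} := by
    intro j
    by_cases hj : j < d
    · simp only [hF, dif_pos hj]
      exact (hbc ⟨j, hj⟩).mono (by omega)
    · simp only [hF, dif_neg hj]
      exact (NetComputable.const r d 2 1).mono (by omega)
  have hF0 : ∀ j x, 0 ≤ F j x := by
    intro j x
    simp only [hF]
    split_ifs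
    · exact hb0 _ _
    · exact zero_le_one
  obtain ⟨g, h1, h2, h3⟩ :=
    exists_computable_forall_pos hr (by omega : 1 ≤ w + 1) (Nat.clog 2 d) F hFc hF0
  refine ⟨g, h1, h2, fun x => ?_⟩
  rw [h3, Set.mem_univ_pi]
  constructor
  · intro h i
    have := h i (i.2.trans_le (Nat.le_pow_clog one_lt_two d))
    simp only [hF, dif_pos i.2] at this
    exact (hbO i _).1 this
  · intro h j _
    simp only [hF]
    split_ifs with hj
    · exact (hbO _ _).2 (h _)
    · exact one_pos

/-- The approximation of a product by a network with prescribed support. -/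
theorem exists_computable_prod_tsupport_eq {r L n N D w : ℕ} (hr : r ≠ 0) {B δ η₀ : ℝ}
    {Q : ℝ → ℝ} {d : ℕ} {O : Fin d → Set ℝ} {v : Fin d → ℝ → ℝ}
    (S : ∀ i, PieceSystem r L n B (O i) (v i)) (hB : 0 ≤ B)
    (hQ : IsPowerApprox r N D δ Q) (hN : d * L ≤ N) (hO : ∀ i, IsOpen (O i))
    (hOb : ∀ i, Bornology.IsBounded (O i)) (hη₀ : 0 < η₀)
    (hb : ∀ i : Fin d, ∃ b : ℝ → ℝ, (∀ x, 0 ≤ b x) ∧ (∀ x, 0 < b x ↔ x ∈ O i) ∧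
      NetComputable r d w 2 {fun x => b (x i)}) :
    ∃ Φ : (Fin d → ℝ) → ℝ,
      NetComputable r d (n ^ d * (L ^ d * (2 ^ N * max (N * 2) 3)) + 1 +
        3 ^ Nat.clog 2 d * (w + 1)) (2 + Nat.clog 2 d + D) {Φ} ∧
      tsupport Φ = closure (Set.pi Set.univ O) ∧
      ∀ x, |Φ x - ∏ i, v i (x i)| ≤ (2 * B) ^ d * (6 ^ N * δ) + η₀ := by
  obtain ⟨G, hGc, hG0, hG⟩ := exists_computable_prod S hB hQ hN
  obtain ⟨b, hbc, hb0, hbO⟩ := exists_computable_pos_iff_pi hr hb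
  have hopen : IsOpen (Set.pi Set.univ O) := isOpen_set_pi Set.finite_univ fun i _ => hO i
  have hbdd : Bornology.IsBounded (Set.pi Set.univ O) := Bornology.IsBounded.pi hOb
  have hcpt : HasCompactSupport b := by
    refine HasCompactSupport.intro hbdd.isCompact_closure fun x hx => ?_
    exact le_antisymm (not_lt.1 fun h => hx (subset_closure ((hbO x).1 h))) (hb0 x)
  obtain ⟨C, hC⟩ := hcpt.exists_bound_of_continuous hbc.continuous
  have hC0 : 0 ≤ C := (norm_nonneg _).trans (hC 0)
  -- As `|b| ≤ C`, this bound on `η` keeps the perturbation `η * b` below `η₀`.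
  obtain ⟨η, hη, hη1, hint⟩ := exists_interior_eq_empty G b (η₀ := η₀ / (C + 1)) (by positivity)
  have hG' : ∀ x ∉ closure (Set.pi Set.univ O), G x = 0 := by
    intro x hx
    apply hG0
    rw [closure_pi_set, Set.mem_univ_pi] at hx
    push Not at hx
    exact hx
  refine ⟨fun x => G x + η * b x, ?_, tsupport_add_eq hb0 hbO hG' hint hopen, fun x => ?_⟩
  · have h1 := ((hGc.mono (Nat.le_succ _)).lift (Nat.succ_pos _) (Nat.clog 2 d))
    have h2 := ((hbc.lift (Nat.mul_pos (by positivity) (Nat.succ_pos _)) D).const_mul η)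
    rw [show 2 + D + Nat.clog 2 d = 2 + Nat.clog 2 d + D by ring] at h1
    exact h1.add h2
  · have h1 : |η * b x| ≤ η₀ := by
      rw [abs_mul, abs_of_pos hη]
      calc η * |b x| ≤ η₀ / (C + 1) * (C + 1) :=
            mul_le_mul hη1.le ((hC x).trans (by linarith)) (abs_nonneg _) (by positivity)
        _ = η₀ := by field_simp
    calc |G x + η * b x - ∏ i, v i (x i)| = |(G x - ∏ i, v i (x i)) + η * b x| := by ring_nf
      _ ≤ _ := (abs_add_le _ _).trans (add_le_add (hG x) h1)

/-! ### Error estimates -/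

theorem abs_prod_le_pow_card {ι : Type*} (s : Finset ι) {a : ι → ℝ} {M : ℝ}
    (ha : ∀ i ∈ s, |a i| ≤ M) : |∏ i ∈ s, a i| ≤ M ^ s.card := by
  rw [Finset.abs_prod, ← Finset.prod_const]
  exact Finset.prod_le_prod (fun _ _ => abs_nonneg _) ha

theorem abs_prod_sub_prod_le {ι : Type*} (s : Finset ι) {a b : ι → ℝ} {M τ : ℝ} (hM : 0 ≤ M)
    (ha : ∀ i ∈ s, |a i| ≤ M) (hab : ∀ i ∈ s, |b i - a i| ≤ τ) :
    |∏ i ∈ s, b i - ∏ i ∈ s, a i| ≤ (M + τ) ^ s.card - M ^ s.card := by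
  classical
  induction s using Finset.induction_on with
  | empty => simp
  | insert j s hj ih =>
    rw [Finset.prod_insert hj, Finset.prod_insert hj, Finset.card_insert_of_notMem hj]
    have h1 := ih (fun i hi => ha i (by simp [hi])) fun i hi => hab i (by simp [hi])
    have h2 := ha j (by simp)
    have h3 := hab j (by simp)
    have hτ : 0 ≤ τ := (abs_nonneg _).trans h3
    have h4 : |b j| ≤ M + τ := by
      calc |b j| = |a j + (b j - a j)| := by ring_nf
        _ ≤ _ := (abs_add_le _ _).trans (add_le_add h2 h3)
    have h5 : |∏ i ∈ s, a i| ≤ M ^ s.card :=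
      abs_prod_le_pow_card s fun i hi => ha i (by simp [hi])
    calc |b j * ∏ i ∈ s, b i - a j * ∏ i ∈ s, a i|
        = |b j * (∏ i ∈ s, b i - ∏ i ∈ s, a i) + (b j - a j) * ∏ i ∈ s, a i| := by ring_nf
      _ ≤ (M + τ) * ((M + τ) ^ s.card - M ^ s.card) + τ * M ^ s.card := by
          refine (abs_add_le _ _).trans (add_le_add ?_ ?_) <;> rw [abs_mul]
          · exact mul_le_mul h4 h1 (abs_nonneg _) (by linarith)
          · exact mul_le_mul h3 h5 (abs_nonneg _) hτ
      _ = _ := by ring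

theorem eventually_abs_prod_sub_prod_le {d : ℕ} {f : Fin d → ℝ → ℝ} {v : Fin d → ℝ → ℝ → ℝ}
    {M : ℝ} (hM : 0 ≤ M) (hf : ∀ i x, |f i x| ≤ M)
    (hv : ∀ i, ∀ ε > 0, ∀ᶠ K in Filter.atTop, ∀ x, |v i K x - f i x| ≤ ε) {ε : ℝ} (hε : 0 < ε) :
    ∀ᶠ K in Filter.atTop, ∀ x : Fin d → ℝ, |∏ i, v i K (x i) - ∏ i, f i (x i)| ≤ ε := by
  have hc : Continuous fun τ : ℝ => (M + τ) ^ d - M ^ d := by fun_prop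
  have h0 : ∀ᶠ τ in 𝓝[>] (0 : ℝ), (M + τ) ^ d - M ^ d < ε := by
    refine (hc.tendsto 0).mono_left nhdsWithin_le_nhds |>.eventually_lt_const ?_
    simpa using hε
  obtain ⟨τ, hτ, hτ0⟩ := (h0.and self_mem_nhdsWithin).exists
  have h1 : ∀ᶠ K in Filter.atTop, ∀ i, ∀ x, |v i K x - f i x| ≤ τ :=
    Filter.eventually_all.2 fun i => hv i τ hτ0
  filter_upwards [h1] with K hK x
  refine (abs_prod_sub_prod_le Finset.univ hM (fun i _ => hf i (x i))
    fun i _ => hK i (x i)).trans ?_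
  simpa using hτ.le

/-- The sets decrease in `K`, and their intersection lies in finitely many hyperplanes, which are
null. Continuity from above applies as `s` has finite measure. -/
theorem tendsto_volume_near_hyperplanes {d : ℕ} (T : Fin d → Finset ℝ) {s : Set (Fin d → ℝ)}
    (hs : IsClosed s) (hsf : volume s ≠ ∞) :
    (∀ K : ℝ, MeasurableSet (s ∩ {x | ∃ i, ∃ t ∈ T i, K * |x i - t| < 1})) ∧
    Filter.Tendsto (fun K : ℝ => volume (s ∩ {x | ∃ i, ∃ t ∈ T i, K * |x i - t| < 1}))
      Filter.atTop (𝓝 0) := by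
  have hm : ∀ K : ℝ, MeasurableSet (s ∩ {x | ∃ i, ∃ t ∈ T i, K * |x i - t| < 1}) := by
    intro K
    refine hs.measurableSet.inter (IsOpen.measurableSet ?_)
    have : {x : Fin d → ℝ | ∃ i, ∃ t ∈ T i, K * |x i - t| < 1} =
        ⋃ i, ⋃ t ∈ T i, {x : Fin d → ℝ | K * |x i - t| < 1} := by
      ext x
      simp
    rw [this]
    exact isOpen_iUnion fun i => isOpen_biUnion fun t _ => isOpen_lt (by fun_prop) (by fun_prop)
  refine ⟨hm, ?_⟩
  have hnull : volume (⋂ K : ℝ, s ∩ {x | ∃ i, ∃ t ∈ T i, K * |x i - t| < 1}) = 0 := by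
    have h1 : ∀ᵐ x : Fin d → ℝ, ∀ i, x i ∉ T i :=
      ae_forall_coord (p := fun i t => t ∉ T i) fun i =>
        measure_eq_zero_iff_ae_notMem.1 ((T i).finite_toSet.measure_zero _)
    refine measure_mono_null ?_ h1
    intro x hx hxT
    have h2 : ∀ᶠ K : ℝ in Filter.atTop, ∀ i, ∀ t ∈ T i, 1 ≤ K * |x i - t| := by
      refine Filter.eventually_all.2 fun i => (Filter.eventually_all_finset _).2 fun t ht => ?_
      have hpos : 0 < |x i - t| := abs_pos.2 (sub_ne_zero.2 fun h => hxT i (h ▸ ht))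
      filter_upwards [Filter.eventually_ge_atTop (1 / |x i - t|)] with K hK
      rwa [div_le_iff₀ hpos] at hK
    obtain ⟨K, hK⟩ := h2.exists
    obtain ⟨-, i, t, ht, h3⟩ := Set.mem_iInter.1 hx K
    exact (hK i t ht).not_gt h3
  have := tendsto_measure_iInter_atTop (μ := (volume : Measure (Fin d → ℝ)))
    (s := fun K : ℝ => s ∩ {x | ∃ i, ∃ t ∈ T i, K * |x i - t| < 1})
    (fun K => (hm K).nullMeasurableSet) ?_ ⟨0, ((measure_mono Set.inter_subset_left).trans_lt
      hsf.lt_top).ne⟩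
  · rwa [hnull] at this
  · rintro K K' hKK x ⟨hx, i, t, ht, h⟩
    exact ⟨hx, i, t, ht, (mul_le_mul_of_nonneg_right hKK (abs_nonneg _)).trans_lt h⟩

/-- The integrand is split pointwise into a small part on `s` and a large part on `E`. No triangle
inequality for the norm is involved, so exponents below one are allowed. -/
theorem lintegral_rpow_enorm_le {X : Type*} [MeasurableSpace X] {μ : Measure X} {H : X → ℝ}
    {s E : Set X} (hs : MeasurableSet s) (hE : MeasurableSet E) {a b : ℝ} {q : ℝ} (hq : 0 < q)
    (h0 : ∀ᵐ x ∂μ, x ∉ s → H x = 0) (ha : ∀ᵐ x ∂μ, x ∉ E → |H x| ≤ a)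
    (hb : ∀ᵐ x ∂μ, |H x| ≤ b) :
    ∫⁻ x, ‖H x‖ₑ ^ q ∂μ ≤ ENNReal.ofReal a ^ q * μ s + ENNReal.ofReal b ^ q * μ E := by
  calc ∫⁻ x, ‖H x‖ₑ ^ q ∂μ
      ≤ ∫⁻ x, (s.indicator (fun _ => ENNReal.ofReal a ^ q) x +
          E.indicator (fun _ => ENNReal.ofReal b ^ q) x) ∂μ := by
        refine lintegral_mono_ae ?_
        filter_upwards [h0, ha, hb] with x h0 ha hb
        have key : ∀ c, |H x| ≤ c → ‖H x‖ₑ ^ q ≤ ENNReal.ofReal c ^ q := fun c hc => by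
          refine ENNReal.rpow_le_rpow ?_ hq.le
          rw [← ofReal_norm, Real.norm_eq_abs]
          exact ENNReal.ofReal_le_ofReal hc
        by_cases hxs : x ∈ s
        · by_cases hxE : x ∈ E
          · rw [Set.indicator_of_mem hxE]
            exact (key b hb).trans le_add_self
          · rw [Set.indicator_of_mem hxs]
            exact (key a (ha hxE)).trans le_self_add
        · rw [h0 hxs, enorm_zero, ENNReal.zero_rpow_of_pos hq]
          exact zero_le
    _ = _ := by
        rw [lintegral_add_left (measurable_const.indicator hs), lintegral_indicator_const hs,
          lintegral_indicator_const hE]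

/-! ### Approximation of tensor products with prescribed support. -/

/-- The approximation of a multiple of a tensor product of piecewise polynomials by a network with
the same support. -/
theorem exists_computable_approx {r L N N' D d : ℕ} (hr : r ≠ 0) (hL : L ≠ 0)
    {f : Fin d → ℝ → ℝ} (hf : ∀ i, IsPiecewisePolynomial L N (f i))
    (hfc : ∀ i, HasCompactSupport (f i)) {M : ℝ} (hM0 : 0 ≤ M)
    (hM : ∀ i, ∀ᵐ x : ℝ, |f i x| ≤ M) {p : ℝ≥0∞} (hp : p ≠ 0)
    (hcont : p = ∞ → ∀ i, Continuous (f i)) {δ : ℝ} {Q : ℝ → ℝ}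
    (hQ : IsPowerApprox r N' D δ Q) (hN : d * L ≤ N') {κ ε : ℝ} (hκ : 0 < κ)
    (hsmall : ENNReal.ofReal (κ * ((2 * (12 ^ L * M)) ^ d * (6 ^ N' * δ))) *
      (∏ i, volume (tsupport (f i))) ^ (1 / p.toReal) < ENNReal.ofReal ε) :
    ∃ Φ : (Fin d → ℝ) → ℝ,
      NetComputable r d ((N * N + N) ^ d * (L ^ d * (2 ^ N' * max (N' * 2) 3)) + 1 +
        3 ^ Nat.clog 2 d * (2 * (N * N) + 1)) (2 + Nat.clog 2 d + D) {Φ} ∧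
      HasCompactSupport Φ ∧ tsupport Φ = essSupport (fun x => κ * ∏ i, f i (x i)) ∧
      eLpNorm (fun x => κ * ∏ i, f i (x i) - Φ x) p volume ≤ ENNReal.ofReal ε := by
  choose T O v hO hOf hZ hK hunif using fun i =>
    (hf i).exists_approx hr hL (hfc i) (hM i)
  set B : ℝ := 12 ^ L * M with hB
  have hB0 : 0 ≤ B := by positivity
  set e₀ : ℝ := (2 * B) ^ d * (6 ^ N' * δ) with he₀
  have he0 : 0 ≤ e₀ := mul_nonneg (by positivity) (mul_nonneg (by positivity)
    ((abs_nonneg _).trans (hQ.abs_sub_le 0 (by simp))))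
  have hOb : ∀ i, Bornology.IsBounded (O i) := fun i =>
    (hfc i).isCompact.isBounded.subset (subset_closure.trans (hOf i))
  set s := closure (Set.pi Set.univ O) with hs
  have hopen : IsOpen (Set.pi Set.univ O) := isOpen_set_pi Set.finite_univ fun i _ => hO i
  have hscpt : IsCompact s := (Bornology.IsBounded.pi hOb).isCompact_closure
  have hvol : volume s ≤ ∏ i, volume (tsupport (f i)) := by
    rw [← volume_pi_pi, hs, closure_pi_set]
    exact measure_mono (Set.pi_mono fun i _ => hOf i)
  have hess : essSupport (fun x => κ * ∏ i, f i (x i)) = s := by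
    refine essSupport_eq_closure hopen ?_
    filter_upwards [ae_prod_ne_zero_iff hZ] with x hx
    rw [← hx, mul_ne_zero_iff]
    simp [hκ.ne']
  -- Width and depth are the same for all `K`. The strict inequality in `hsmall` leaves room for the
  -- errors that vanish as `K → ∞`.
  have hnet : ∀ᶠ K in Filter.atTop, ∃ Φ : (Fin d → ℝ) → ℝ,
      NetComputable r d ((N * N + N) ^ d * (L ^ d * (2 ^ N' * max (N' * 2) 3)) + 1 +
        3 ^ Nat.clog 2 d * (2 * (N * N) + 1)) (2 + Nat.clog 2 d + D) {Φ} ∧ tsupport Φ = s ∧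
      (∀ x : Fin d → ℝ, |Φ x - ∏ i, v i K (x i)| ≤ e₀ + 1 / K) ∧
      (∀ x : Fin d → ℝ, |∏ i, v i K (x i)| ≤ (2 * B) ^ d) ∧
      ∀ x : Fin d → ℝ, (∀ i, ∀ t ∈ T i, 1 ≤ K * |x i - t|) → ∏ i, v i K (x i) = ∏ i, f i (x i) := by
    filter_upwards [Filter.eventually_all.2 hK, Filter.eventually_gt_atTop 0] with K hK hK0
    have S : ∀ i, PieceSystem r L (N * N + N) B (O i) (v i K) := fun i => (hK i).1.some
    obtain ⟨Φ, h1, h2, h3⟩ := exists_computable_prod_tsupport_eq (w := 2 * (N * N)) hr S hB0 hQ hN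
      hO hOb (η₀ := 1 / K) (by positivity) fun i => by
        obtain ⟨b, hb1, hb2, hb3⟩ := (hK i).2.2
        exact ⟨b, hb1, hb2, hb3 i⟩
    refine ⟨Φ, h1, h2, h3, fun x => ?_, fun x hx => ?_⟩
    · simpa using abs_prod_le_pow_card Finset.univ fun i _ => (S i).abs_le hB0 (x i)
    · exact Finset.prod_congr rfl fun i _ => (hK i).2.1 (x i) (hx i)
  suffices h : ∀ᶠ K in Filter.atTop, ∀ Φ : (Fin d → ℝ) → ℝ, tsupport Φ = s →
      (∀ x : Fin d → ℝ, |Φ x - ∏ i, v i K (x i)| ≤ e₀ + 1 / K) →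
      (∀ x : Fin d → ℝ, |∏ i, v i K (x i)| ≤ (2 * B) ^ d) →
      (∀ x : Fin d → ℝ, (∀ i, ∀ t ∈ T i, 1 ≤ K * |x i - t|) → ∏ i, v i K (x i) = ∏ i, f i (x i)) →
      eLpNorm (fun x => κ * ∏ i, f i (x i) - κ * Φ x) p volume ≤ ENNReal.ofReal ε by
    obtain ⟨K, ⟨Φ, h1, h2, h3, h4, h5⟩, hK⟩ := (hnet.and h).exists
    have htsupp : tsupport (fun x => κ * Φ x) = s := by
      rw [← h2, tsupport, tsupport]
      congr 1
      ext x
      simp [hκ.ne']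
    refine ⟨fun x => κ * Φ x, h1.const_mul κ, ?_, htsupp.trans hess.symm, hK Φ h2 h3 h4 h5⟩
    rw [HasCompactSupport, htsupp]
    exact hscpt
  rcases eq_or_ne p ∞ with rfl | hp'
  · have hcont := hcont rfl
    have hfM : ∀ i x, |f i x| ≤ M := fun i x =>
      abs_le_of_ae_of_continuousOn isOpen_univ (hcont i).continuousOn
        (by filter_upwards [hM i] with x hx _ using hx) x (Set.mem_univ x)
    rw [ENNReal.toReal_top, div_zero, ENNReal.rpow_zero, mul_one] at hsmall
    have hsmall' : κ * e₀ < ε := (ENNReal.ofReal_lt_ofReal_iff_of_nonneg (by positivity)).1 hsmall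
    -- The slack is shared equally between the cutoff error and the perturbation `1 / K`: `κ * (τ +
    -- e₀ + τ) = ε`.
    set τ : ℝ := (ε - κ * e₀) / (2 * κ) with hτ
    have hτ0 : 0 < τ := div_pos (by linarith) (by positivity)
    filter_upwards [eventually_abs_prod_sub_prod_le hM0 hfM (fun i => hunif i (hcont i)) hτ0,
      Filter.eventually_ge_atTop (1 / τ), Filter.eventually_gt_atTop 0] with K h1 h2 h2' Φ _ h3 _ _
    rw [eLpNorm_exponent_top]
    refine eLpNormEssSup_le_of_ae_bound (Filter.Eventually.of_forall fun x => ?_)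
    have h4 : 1 / K ≤ τ := by
      rw [div_le_iff₀ h2', mul_comm]
      rwa [div_le_iff₀ hτ0] at h2
    have h5 : |∏ i, f i (x i) - Φ x| ≤ τ + (e₀ + 1 / K) := by
      rw [abs_sub_comm]
      calc |Φ x - ∏ i, f i (x i)|
          = |(∏ i, v i K (x i) - ∏ i, f i (x i)) + (Φ x - ∏ i, v i K (x i))| := by ring_nf
        _ ≤ _ := (abs_add_le _ _).trans (add_le_add (h1 x) (h3 x))
    rw [← mul_sub, Real.norm_eq_abs, abs_mul, abs_of_pos hκ]
    calc κ * |∏ i, f i (x i) - Φ x| ≤ κ * (τ + (e₀ + τ)) := by gcongr; linarith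
      _ = ε := by rw [hτ]; field_simp; ring
  · set q := p.toReal with hq
    have hq0 : 0 < q := ENNReal.toReal_pos hp hp'
    -- This is a crude bound of the whole error for `K ≥ 1`, needed only on the small set `E K`;
    -- elsewhere the error is at most `κ * (e₀ + 1 / K)`.
    set b : ℝ := κ * (M ^ d + ((2 * B) ^ d + (e₀ + 1))) with hb
    set E : ℝ → Set (Fin d → ℝ) := fun K => s ∩ {x | ∃ i, ∃ t ∈ T i, K * |x i - t| < 1} with hE
    obtain ⟨hEm, hEt⟩ := tendsto_volume_near_hyperplanes T isClosed_closure
      (s := s) hscpt.measure_lt_top.ne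
    have hlim : Filter.Tendsto (fun K : ℝ => ENNReal.ofReal (κ * (e₀ + 1 / K)) ^ q * volume s +
        ENNReal.ofReal b ^ q * volume (E K)) Filter.atTop
        (𝓝 (ENNReal.ofReal (κ * e₀) ^ q * volume s)) := by
      have h1 : Filter.Tendsto (fun K : ℝ => ENNReal.ofReal (κ * (e₀ + 1 / K)) ^ q) Filter.atTop
          (𝓝 (ENNReal.ofReal (κ * e₀) ^ q)) := by
        refine (ENNReal.continuous_rpow_const.tendsto _).comp (ENNReal.tendsto_ofReal ?_)
        have : Filter.Tendsto (fun K : ℝ => 1 / K) Filter.atTop (𝓝 0) := by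
          simpa using tendsto_inv_atTop_zero (𝕜 := ℝ)
        simpa using (this.const_add e₀).const_mul κ
      have h2 := ENNReal.Tendsto.mul_const (b := volume s) h1 (Or.inr hscpt.measure_lt_top.ne)
      have h3 := ENNReal.Tendsto.const_mul (a := ENNReal.ofReal b ^ q) hEt
        (Or.inr (ENNReal.rpow_ne_top_of_nonneg hq0.le ENNReal.ofReal_ne_top))
      simpa using h2.add h3
    have hlt : ENNReal.ofReal (κ * e₀) ^ q * volume s < ENNReal.ofReal ε ^ q := by
      refine lt_of_le_of_lt ?_ (ENNReal.rpow_lt_rpow hsmall hq0)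
      rw [ENNReal.mul_rpow_of_nonneg _ _ hq0.le, ← ENNReal.rpow_mul, one_div,
        inv_mul_cancel₀ hq0.ne', ENNReal.rpow_one]
      gcongr
    filter_upwards [hlim.eventually_lt_const hlt, Filter.eventually_ge_atTop 1]
      with K h1 hK1 Φ h2 h3 h4 h5
    rw [eLpNorm_eq_lintegral_rpow_enorm_toReal hp hp', one_div, ENNReal.rpow_inv_le_iff hq0]
    refine le_trans (lintegral_rpow_enorm_le isClosed_closure.measurableSet (hEm K) hq0
      (s := s) (E := E K) (a := κ * (e₀ + 1 / K)) (b := b) ?_ ?_ ?_) h1.le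
    · filter_upwards [ae_prod_ne_zero_iff hZ] with x hx hxs
      have h6 : ∏ i, f i (x i) = 0 := by
        by_contra h0
        exact hxs (subset_closure (hx.1 h0))
      rw [h6, image_eq_zero_of_notMem_tsupport (f := Φ) (by rwa [h2])]
      ring
    · filter_upwards [ae_prod_ne_zero_iff hZ] with x hx hxE
      by_cases hxs : x ∈ s
      · rw [← mul_sub, abs_mul, abs_of_pos hκ, abs_sub_comm]
        refine mul_le_mul_of_nonneg_left ?_ hκ.le
        rw [← h5 x]
        · exact h3 x
        · intro i t ht
          by_contra! hn
          exact hxE ⟨hxs, i, t, ht, hn⟩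
      · have h6 : ∏ i, f i (x i) = 0 := by
          by_contra h0
          exact hxs (subset_closure (hx.1 h0))
        rw [h6, image_eq_zero_of_notMem_tsupport (f := Φ) (by rwa [h2])]
        simp only [mul_zero, sub_self, abs_zero]
        positivity
    · filter_upwards [ae_forall_coord hM] with x hx
      have hF : |∏ i, f i (x i)| ≤ M ^ d := by
        simpa using abs_prod_le_pow_card Finset.univ fun i _ => hx i
      have hΦ : |Φ x| ≤ (2 * B) ^ d + (e₀ + 1) := by
        calc |Φ x| = |∏ i, v i K (x i) + (Φ x - ∏ i, v i K (x i))| := by ring_nf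
          _ ≤ _ := (abs_add_le _ _).trans (add_le_add (h4 x) (h3 x))
          _ ≤ _ := by
            gcongr
            rw [div_le_one (by linarith)]
            exact hK1
      rw [← mul_sub, abs_mul, abs_of_pos hκ, hb]
      refine mul_le_mul_of_nonneg_left (le_trans ?_ (add_le_add hF hΦ)) hκ.le
      simpa only [Real.norm_eq_abs] using norm_sub_le (∏ i, f i (x i)) (Φ x)

/-! ### Piecewise polynomials -/

namespace IsPiecewisePolynomial

variable {L L' N N' : ℕ} {f g : ℝ → ℝ}

theorem mono (h : IsPiecewisePolynomial L N f) (hL : L ≤ L') (hN : N ≤ N') :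
    IsPiecewisePolynomial L' N' f := by
  obtain ⟨T, hT, h⟩ := h
  refine ⟨T, hT.trans hN, fun I hI hIT => ?_⟩
  obtain ⟨P, hP, hPI⟩ := h I hI hIT
  exact ⟨P, hP.trans_le (by exact_mod_cast hL), hPI⟩

theorem zero : IsPiecewisePolynomial L 0 fun _ => 0 :=
  ⟨∅, le_rfl, fun _ _ _ => ⟨0, by simp, by simp⟩⟩

theorem const_mul (h : IsPiecewisePolynomial L N f) (c : ℝ) :
    IsPiecewisePolynomial L N fun x => c * f x := by
  obtain ⟨T, hT, h⟩ := h
  refine ⟨T, hT, fun I hI hIT => ?_⟩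
  obtain ⟨P, hP, hPI⟩ := h I hI hIT
  refine ⟨c • P, (Polynomial.degree_smul_le c P).trans_lt hP, fun x hx => ?_⟩
  beta_reduce
  rw [hPI x hx, Polynomial.eval_smul, smul_eq_mul]

theorem add (hf : IsPiecewisePolynomial L N f) (hg : IsPiecewisePolynomial L N' g) :
    IsPiecewisePolynomial L (N + N') fun x => f x + g x := by
  classical
  obtain ⟨T, hT, hf⟩ := hf
  obtain ⟨T', hT', hg⟩ := hg
  refine ⟨T ∪ T', (Finset.card_union_le _ _).trans (add_le_add hT hT'), fun I hI hIT => ?_⟩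
  rw [Finset.coe_union, Set.disjoint_union_right] at hIT
  obtain ⟨P, hP, hPI⟩ := hf I hI hIT.1
  obtain ⟨P', hP', hPI'⟩ := hg I hI hIT.2
  refine ⟨P + P', (Polynomial.degree_add_le _ _).trans_lt (max_lt hP hP'), fun x hx => ?_⟩
  beta_reduce
  rw [hPI x hx, hPI' x hx, Polynomial.eval_add]

theorem sum {ι : Type*} (s : Finset ι) {F : ι → ℝ → ℝ}
    (h : ∀ i ∈ s, IsPiecewisePolynomial L N (F i)) :
    IsPiecewisePolynomial L (s.card * N) fun x => ∑ i ∈ s, F i x := by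
  classical
  induction s using Finset.induction_on with
  | empty => simpa using zero
  | insert a s ha ih =>
    simp only [Finset.sum_insert ha, Finset.card_insert_of_notMem ha]
    rw [add_mul, one_mul, add_comm]
    exact (h a (by simp)).add (ih fun i hi => h i (by simp [hi]))

theorem comp_affine (h : IsPiecewisePolynomial L N f) {a : ℝ} (ha : 0 < a) (b : ℝ) :
    IsPiecewisePolynomial L N fun x => f (a * x - b) := by
  classical
  obtain ⟨T, hT, h⟩ := h
  refine ⟨T.image fun t => (t + b) / a, Finset.card_image_le.trans hT, fun I hI hIT => ?_⟩
  have hmono : Monotone fun y : ℝ => (y + b) / a := fun y z hyz => by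
    simp only
    gcongr
  obtain ⟨P, hP, hPI⟩ := h ((fun y => (y + b) / a) ⁻¹' I) (hI.preimage_mono hmono)
    (Set.disjoint_left.2 fun y hy hyT => Set.disjoint_left.1 hIT hy
      (by exact_mod_cast Finset.mem_image_of_mem (fun t => (t + b) / a) hyT))
  set A : Polynomial ℝ := Polynomial.C a * Polynomial.X + Polynomial.C (-b) with hA
  refine ⟨P.comp A, ?_, fun x hx => ?_⟩
  · rcases eq_or_ne P 0 with rfl | hP0
    · simp
    · have hA1 : A.natDegree ≤ 1 := Polynomial.natDegree_linear_le
      have h1 : P.natDegree < L := (Polynomial.natDegree_lt_iff_degree_lt hP0).2 hP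
      refine Polynomial.degree_le_natDegree.trans_lt ?_
      rw [Polynomial.natDegree_comp]
      exact_mod_cast (Nat.mul_le_mul_left _ hA1).trans_lt (by simpa using h1)
  · beta_reduce
    rw [hPI, Polynomial.eval_comp]
    · simp [hA, sub_eq_add_neg]
    · simp only [Set.mem_preimage]
      convert hx using 1
      field_simp
      ring

theorem exists_ae_abs_le (h : IsPiecewisePolynomial L N f) (hf : HasCompactSupport f) :
    ∃ M : ℝ, 0 ≤ M ∧ ∀ᵐ x : ℝ, |f x| ≤ M := by
  obtain ⟨T, -, P, hP⟩ := h.exists_isPieces hf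
  have h1 : ∀ q : ℝ × ℝ, ∃ M : ℝ, 0 ≤ M ∧ ∀ x ∈ Set.Icc q.1 q.2, |(P q).eval x| ≤ M := by
    intro q
    obtain ⟨M, hM⟩ := isCompact_Icc.exists_bound_of_continuousOn (P q).continuous.continuousOn
    exact ⟨max M 0, le_max_right _ _, fun x hx => (hM x hx).trans (le_max_left _ _)⟩
  choose M hM0 hM using h1
  refine ⟨∑ q ∈ gaps T, M q, Finset.sum_nonneg fun q _ => hM0 q, ?_⟩
  have h2 : ∀ᵐ x : ℝ, x ∉ (T : Set ℝ) :=
    measure_eq_zero_iff_ae_notMem.1 (T.finite_toSet.measure_zero _)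
  filter_upwards [h2] with x hx
  by_cases hq : ∃ q ∈ gaps T, x ∈ Set.Ioo q.1 q.2
  · obtain ⟨q, hq, hxq⟩ := hq
    rw [hP.eq_eval q hq x hxq]
    exact (hM q x (Set.Ioo_subset_Icc_self hxq)).trans
      (Finset.single_le_sum (fun q _ => hM0 q) hq)
  · push Not at hq
    rw [hP.eq_zero x hx hq, abs_zero]
    exact Finset.sum_nonneg fun q _ => hM0 q

end IsPiecewisePolynomial

/-! ### Affine changes of variables on the line -/

/-- The affine map `x ↦ a x - b` as a homeomorphism. -/
def affineHomeo {a : ℝ} (ha : 0 < a) (b : ℝ) : ℝ ≃ₜ ℝ :=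
  (Homeomorph.mulLeft₀ a ha.ne').trans (Homeomorph.addRight (-b))

theorem volume_preimage_affineHomeo {a : ℝ} (ha : 0 < a) (b : ℝ) (s : Set ℝ) :
    volume (affineHomeo ha b ⁻¹' s) = ENNReal.ofReal a⁻¹ * volume s := by
  have : affineHomeo ha b ⁻¹' s = (a * ·) ⁻¹' ((· + -b) ⁻¹' s) := rfl
  rw [this, Real.volume_preimage_mul_left ha.ne', measure_preimage_add_right,
    abs_of_pos (inv_pos.2 ha)]

theorem hasCompactSupport_comp_affine {f : ℝ → ℝ} (hf : HasCompactSupport f) {a : ℝ} (ha : 0 < a)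
    (b : ℝ) : HasCompactSupport fun x => f (a * x - b) :=
  hf.comp_homeomorph (affineHomeo ha b)

theorem volume_tsupport_comp_affine (f : ℝ → ℝ) {a : ℝ} (ha : 0 < a) (b : ℝ) :
    volume (tsupport fun x => f (a * x - b)) = ENNReal.ofReal a⁻¹ * volume (tsupport f) := by
  rw [← volume_preimage_affineHomeo ha b, ← tsupport_comp_eq_preimage]
  rfl

theorem ae_comp_affine {p : ℝ → Prop} (hp : ∀ᵐ x : ℝ, p x) {a : ℝ} (ha : 0 < a) (b : ℝ) :
    ∀ᵐ x : ℝ, p (a * x - b) := by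
  have h := volume_preimage_affineHomeo ha b {x | ¬p x}
  rw [show volume {x | ¬p x} = 0 from hp, mul_zero] at h
  exact h

/-! ### Wavelets -/

theorem motherWavelet_eq (φ : ℝ → ℝ) (g : ℤ →₀ ℝ) :
    motherWavelet φ g = fun x => ∑ k ∈ g.support, g k * φ (2 * x - k) := rfl

theorem IsPiecewisePolynomial.motherWavelet {L N : ℕ} {φ : ℝ → ℝ}
    (h : IsPiecewisePolynomial L N φ) (g : ℤ →₀ ℝ) :
    IsPiecewisePolynomial L (g.support.card * N) (motherWavelet φ g) :=
  IsPiecewisePolynomial.sum g.support fun k _ => (h.comp_affine two_pos k).const_mul _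

theorem hasCompactSupport_motherWavelet {φ : ℝ → ℝ} (h : HasCompactSupport φ) (g : ℤ →₀ ℝ) :
    HasCompactSupport (motherWavelet φ g) := by
  rw [motherWavelet_eq]
  induction g.support using Finset.induction_on with
  | empty => exact HasCompactSupport.zero
  | insert a s ha ih =>
    simp only [Finset.sum_insert ha]
    exact ((hasCompactSupport_comp_affine h two_pos a).mul_left (f := fun _ => g a)).add ih

theorem continuous_motherWavelet {φ : ℝ → ℝ} (h : Continuous φ) (g : ℤ →₀ ℝ) :
    Continuous (motherWavelet φ g) := by
  rw [motherWavelet_eq]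
  fun_prop

/-- The univariate factors of the tensor product wavelets. -/
def waveletFactor (φ ψ : ℝ → ℝ) {d : ℕ} (lam : WaveletIndex d) (i : Fin d) (x : ℝ) : ℝ :=
  (if lam.e i then ψ else φ) ((2 : ℝ) ^ lam.j * x - lam.k i)

theorem wavelet_eq (φ ψ : ℝ → ℝ) {d : ℕ} (lam : WaveletIndex d) (p : ℝ≥0∞) :
    wavelet φ ψ lam p = fun x => (2 : ℝ) ^ ((d : ℝ) * (lam.j : ℝ) / p.toReal) *
      ∏ i, waveletFactor φ ψ lam i (x i) := by
  ext x
  rw [wavelet, tensorWavelet]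
  congr 1
  refine Finset.prod_congr rfl fun i _ => ?_
  rw [waveletFactor]
  split_ifs <;> rfl

/-- The approximation of wavelets, given an approximation of the power function. -/
theorem exists_net_wavelet {r : ℕ} (hr : r ≠ 0) (d L Nφ Nψ N' : ℕ) (hL : L ≠ 0)
    (hN : d * L ≤ N') :
    ∃ B : ℕ, 0 < B ∧ ∀ {δ : ℝ} {Q : ℝ → ℝ} {D : ℕ}, IsPowerApprox r N' D δ Q →
      ∀ {φ : ℝ → ℝ} {g : ℤ →₀ ℝ}, HasCompactSupport φ → IsPiecewisePolynomial L Nφ φ →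
      g.support.card ≤ Nψ → ∀ {M : ℝ}, 0 ≤ M → (∀ᵐ x : ℝ, |φ x| ≤ M) →
      (∀ᵐ x : ℝ, |motherWavelet φ g x| ≤ M) → ∀ {p : ℝ≥0∞}, p ≠ 0 → (p = ∞ → Continuous φ) →
      ∀ {lam : WaveletIndex d} {ε : ℝ},
      ENNReal.ofReal ((2 : ℝ) ^ ((d : ℝ) * (lam.j : ℝ) / p.toReal) *
        ((2 * (12 ^ L * M)) ^ d * (6 ^ N' * δ))) *
        (∏ i, volume (tsupport (waveletFactor φ (motherWavelet φ g) lam i))) ^ (1 / p.toReal) <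
          ENNReal.ofReal ε →
      ∀ w : ℝ, ((3 + Nat.clog 2 d + D : ℕ) : ℝ) * B ≤ w →
      ∃ Φ ∈ RePUClass r d p w,
        tsupport (Φ.realizeScalar r) = essSupport (wavelet φ (motherWavelet φ g) lam p) ∧
        eLpNorm (fun x => wavelet φ (motherWavelet φ g) lam p x - Φ.realizeScalar r x)
          p volume ≤ ENNReal.ofReal ε ∧
        Φ.depth = 3 + Nat.clog 2 d + D := by
  -- A common bound for the breakpoints: `φ` has at most `Nφ` and `ψ` at most `Nψ * Nφ`.
  set N := (Nψ + 1) * Nφ with hNdef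
  set W := (N * N + N) ^ d * (L ^ d * (2 ^ N' * max (N' * 2) 3)) + 1 +
        3 ^ Nat.clog 2 d * (2 * (N * N) + 1) with hW
  refine ⟨max d (W + 1) ^ 2, by positivity, ?_⟩
  intro δ Q D hQ φ g hφ hφL hg M hM0 hM hMψ p hp hcont lam ε hsmall w hw
  set ψ := motherWavelet φ g with hψ
  have h2j : (0 : ℝ) < 2 ^ lam.j := by positivity
  have hφN : IsPiecewisePolynomial L N φ := hφL.mono le_rfl (by rw [hNdef]; nlinarith)
  have hψN : IsPiecewisePolynomial L N ψ :=
    (hφL.motherWavelet g).mono le_rfl (Nat.mul_le_mul_right _ (by omega))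
  have hψc := hasCompactSupport_motherWavelet hφ g
  have h1 : ∀ i, IsPiecewisePolynomial L N (waveletFactor φ ψ lam i) := by
    intro i
    unfold waveletFactor
    split_ifs
    · exact hψN.comp_affine h2j _
    · exact hφN.comp_affine h2j _
  have h2 : ∀ i, HasCompactSupport (waveletFactor φ ψ lam i) := by
    intro i
    unfold waveletFactor
    split_ifs
    · exact hasCompactSupport_comp_affine hψc h2j _
    · exact hasCompactSupport_comp_affine hφ h2j _
  have h3 : ∀ i, ∀ᵐ x : ℝ, |waveletFactor φ ψ lam i x| ≤ M := by
    intro i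
    unfold waveletFactor
    split_ifs
    · exact ae_comp_affine hMψ h2j _
    · exact ae_comp_affine hM h2j _
  have h4 : p = ∞ → ∀ i, Continuous (waveletFactor φ ψ lam i) := by
    intro hp i
    have h1 := hcont hp
    have h2 := continuous_motherWavelet h1 g
    unfold waveletFactor
    split_ifs <;> fun_prop
  obtain ⟨F, hF, hFc, hFs, hFe⟩ := exists_computable_approx hr hL h1 h2 hM0 h3 hp h4 hQ hN
    (κ := (2 : ℝ) ^ ((d : ℝ) * (lam.j : ℝ) / p.toReal)) (by positivity) hsmall
  obtain ⟨Φ, hΦ, hΦd, hΦw⟩ := hF.exists_net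
  refine ⟨Φ, ⟨?_, ?_⟩, ?_, ?_, ?_⟩
  · rw [hΦ]
    exact hF.continuous.memLp_of_hasCompactSupport hFc
  · refine le_trans ?_ hw
    have : Φ.weights ≤ (3 + Nat.clog 2 d + D) * max d (W + 1) ^ 2 := by
      refine hΦw.trans (Nat.mul_le_mul_right _ (by omega))
    exact_mod_cast this
  · rw [hΦ, hFs, wavelet_eq]
  · rw [hΦ, wavelet_eq]
    exact hFe
  · rw [hΦd]
    omega

theorem ae_abs_le_of_eLpNorm_top_le {f : ℝ → ℝ} {M : ℝ≥0} (h : eLpNorm f ∞ volume ≤ M) :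
    ∀ᵐ x : ℝ, |f x| ≤ M := by
  rw [eLpNorm_exponent_top] at h
  filter_upwards [ae_le_eLpNormEssSup (f := f) (μ := volume)] with x hx
  have h1 : ‖f x‖ₑ ≤ M := hx.trans h
  rw [enorm_le_coe] at h1
  exact_mod_cast h1

/-- The normalization of the wavelets makes the size of the supports irrelevant. -/
theorem normalized_volume_le {φ ψ : ℝ → ℝ} {d : ℕ} (lam : WaveletIndex d) {p : ℝ≥0∞} {p₀ : ℝ}
    (hp₀ : 0 < p₀) (hp : ENNReal.ofReal p₀ ≤ p) {S : ℝ} (hS : 1 ≤ S)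
    (hφ : volume (tsupport φ) ≤ ENNReal.ofReal S) (hψ : volume (tsupport ψ) ≤ ENNReal.ofReal S)
    {e : ℝ} (he : 0 ≤ e) :
    ENNReal.ofReal ((2 : ℝ) ^ ((d : ℝ) * (lam.j : ℝ) / p.toReal) * e) *
      (∏ i, volume (tsupport (waveletFactor φ ψ lam i))) ^ (1 / p.toReal) ≤
    ENNReal.ofReal (e * (S ^ (1 / p₀)) ^ d) := by
  have hS' : 1 ≤ (S ^ (1 / p₀)) ^ d :=
    one_le_pow₀ (Real.one_le_rpow hS (by positivity))
  rcases eq_or_ne p ∞ with rfl | hp'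
  · simp only [ENNReal.toReal_top, div_zero, Real.rpow_zero, ENNReal.rpow_zero, one_mul, mul_one]
    exact ENNReal.ofReal_le_ofReal (le_mul_of_one_le_right he hS')
  have hpp : p₀ ≤ p.toReal := (ENNReal.ofReal_le_iff_le_toReal hp').1 hp
  set q := p.toReal with hq
  have hq0 : 0 < q := hp₀.trans_le hpp
  have h2j : (0 : ℝ) < 2 ^ lam.j := by positivity
  have h1 : ∏ i, volume (tsupport (waveletFactor φ ψ lam i)) ≤
      ENNReal.ofReal ((((2 : ℝ) ^ lam.j)⁻¹ * S) ^ d) := by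
    have : ∀ i ∈ (Finset.univ : Finset (Fin d)), volume (tsupport (waveletFactor φ ψ lam i)) ≤
        ENNReal.ofReal (((2 : ℝ) ^ lam.j)⁻¹ * S) := by
      intro i _
      have h := volume_tsupport_comp_affine (if lam.e i then ψ else φ) h2j (lam.k i)
      change volume (tsupport fun x => _) ≤ _
      rw [ENNReal.ofReal_mul (by positivity)]
      refine h.le.trans ?_
      gcongr
      split_ifs <;> assumption
    refine (Finset.prod_le_prod' this).trans ?_
    rw [Finset.prod_const, Finset.card_univ, Fintype.card_fin, ENNReal.ofReal_pow (by positivity)]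
  calc _ ≤ ENNReal.ofReal ((2 : ℝ) ^ ((d : ℝ) * (lam.j : ℝ) / q) * e) *
        ENNReal.ofReal ((((2 : ℝ) ^ lam.j)⁻¹ * S) ^ d) ^ (1 / q) := by gcongr
    _ = ENNReal.ofReal ((2 : ℝ) ^ ((d : ℝ) * (lam.j : ℝ) / q) * e *
        ((((2 : ℝ) ^ lam.j)⁻¹ * S) ^ d) ^ (1 / q)) := by
        rw [ENNReal.ofReal_rpow_of_nonneg (by positivity) (by positivity),
          ← ENNReal.ofReal_mul (by positivity)]
    _ ≤ _ := by
        refine ENNReal.ofReal_le_ofReal ?_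
        -- The dilation scales the volume of the support by `2 ^ (-d j)`, and the `1 / q`-th power
        -- of this cancels the normalizing factor.
        have h3 : (((2 : ℝ) ^ lam.j)⁻¹ ^ d) ^ (1 / q) =
            ((2 : ℝ) ^ ((d : ℝ) * (lam.j : ℝ) / q))⁻¹ := by
          rw [inv_pow, ← Real.rpow_intCast, ← Real.rpow_natCast, ← Real.rpow_mul (by norm_num),
            Real.inv_rpow (by positivity), ← Real.rpow_mul (by norm_num)]
          congr 2
          ring
        -- Here `S ≥ 1` is essential: it makes the bound uniform over all `q ≥ p₀`.
        have h4 : (S ^ d) ^ (1 / q) ≤ (S ^ (1 / p₀)) ^ d := by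
          rw [← Real.rpow_natCast, ← Real.rpow_natCast, ← Real.rpow_mul (by linarith),
            ← Real.rpow_mul (by linarith), mul_comm]
          refine Real.rpow_le_rpow_of_exponent_le hS ?_
          gcongr
        rw [mul_pow, Real.mul_rpow (by positivity) (by positivity), h3]
        have h5 : (0 : ℝ) < (2 : ℝ) ^ ((d : ℝ) * (lam.j : ℝ) / q) := by positivity
        calc _ = e * (S ^ d) ^ (1 / q) := by field_simp
          _ ≤ _ := by gcongr

/-! ### Depth bounds -/

theorem clog_two_le (n : ℕ) : (Nat.clog 2 n : ℝ) ≤ 1 + 2 * Real.log n := by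
  rcases le_or_gt n 1 with h | h
  · rw [Nat.clog_of_right_le_one h]
    have := Real.log_natCast_nonneg n
    push_cast
    linarith
  · have h1 : 2 ^ (Nat.clog 2 n - 1) < n := Nat.pow_pred_clog_lt_self one_lt_two h
    have h2 : ((Nat.clog 2 n - 1 : ℕ) : ℝ) * Real.log 2 ≤ Real.log n := by
      rw [← Real.log_pow]
      exact Real.log_le_log (by positivity) (by exact_mod_cast h1.le)
    have h3 : (Nat.clog 2 n : ℝ) ≤ ((Nat.clog 2 n - 1 : ℕ) : ℝ) + 1 := by
      exact_mod_cast Nat.sub_le_iff_le_add.1 le_rfl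
    have h4 : (0 : ℝ) ≤ ((Nat.clog 2 n - 1 : ℕ) : ℝ) := Nat.cast_nonneg _
    nlinarith [Real.log_two_gt_d9]

theorem two_pow_clog_le {n : ℕ} (hn : 1 ≤ n) : 2 ^ Nat.clog 2 n ≤ 2 * n := by
  rcases hn.eq_or_lt with rfl | h
  · simp
  · have h1 : 2 ^ (Nat.clog 2 n - 1) < n := Nat.pow_pred_clog_lt_self one_lt_two h
    have h2 : 0 < Nat.clog 2 n := Nat.clog_pos one_lt_two h
    have h3 : 2 ^ Nat.clog 2 n = 2 * 2 ^ (Nat.clog 2 n - 1) := by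
      rw [← pow_succ', Nat.sub_add_cancel h2]
    omega

/-- From `log n ≥ 1 - 1 / n` one gets `n ≤ 1 + n log n`, which brings products of the form `n (1 +
log n)` into the shape of the ReLU depth bound. -/
theorem mul_one_add_log_le {n : ℕ} (hn : 1 ≤ n) :
    (n : ℝ) * (1 + Real.log n) ≤ 2 * (1 + n * Real.log n) := by
  have hn' : (0 : ℝ) < n := by exact_mod_cast hn
  have h := Real.one_sub_inv_le_log_of_pos hn'
  have h2 : (n : ℝ) * (1 - (n : ℝ)⁻¹) ≤ n * Real.log n := by gcongr
  rw [mul_sub, mul_inv_cancel₀ hn'.ne'] at h2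
  linarith

/-- Lagrange interpolation needs `L ≥ 1`. As `Real.log 0 = 0`, passing from `L` to `max L 1` leaves
the logarithmic terms unchanged. -/
theorem log_max_one (L : ℕ) : Real.log (max L 1 : ℕ) = Real.log L := by
  rcases L.eq_zero_or_pos with rfl | h
  · simp
  · rw [max_eq_left h]

theorem max_one_mul_log (L : ℕ) :
    ((max L 1 : ℕ) : ℝ) * Real.log (max L 1 : ℕ) = L * Real.log L := by
  rcases L.eq_zero_or_pos with rfl | h
  · simp
  · rw [max_eq_left h]

theorem WaveletIndex.one_le {d : ℕ} (lam : WaveletIndex d) : 1 ≤ d := by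
  obtain ⟨i, -⟩ := lam.e_ne_zero
  exact i.pos

/-! ### The two complexity bounds. -/

/-- The powers are exact, so the smallness condition reads `0 < ε`. The sup bound of the functions
enters neither the weights nor the depth. -/
theorem wavelet_repu_complexity (r : ℕ) (hr : 2 ≤ r) : ∃ c : ℝ, 0 < c ∧
    ∀ d L Nφ Nψ : ℕ, ∃ C : ℝ, 0 < C ∧
      ∀ (φ : ℝ → ℝ) (g : ℤ →₀ ℝ),
        HasCompactSupport φ → IsPiecewisePolynomial L Nφ φ → g.support.card ≤ Nψ →
        ∀ p : ℝ≥0∞, p ≠ 0 → (p = ∞ → Continuous φ) →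
        ∀ (lam : WaveletIndex d) (ε : ℝ), 0 < ε →
          ∃ Φ ∈ RePUClass r d p C,
            tsupport (Φ.realizeScalar r) = essSupport (wavelet φ (motherWavelet φ g) lam p) ∧
            eLpNorm (fun x => wavelet φ (motherWavelet φ g) lam p x - Φ.realizeScalar r x)
              p volume ≤ ENNReal.ofReal ε ∧
            (Φ.depth : ℝ) ≤ c * (1 + Real.log L + Real.log d) := by
  have hr0 : r ≠ 0 := by omega
  -- The depth is `3 + clog d + k`, at most `3 + (1 + 2 log d) + (1 + 2 log d + 2 log L)`.
  refine ⟨5, by norm_num, fun d L Nφ Nψ => ?_⟩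
  set L₁ := max L 1 with hL₁
  have hL₁0 : L₁ ≠ 0 := by omega
  set k := Nat.clog r (d * L₁) with hk
  obtain ⟨B, hB, hnet⟩ := exists_net_wavelet hr0 d L₁ Nφ Nψ (r ^ k) hL₁0
    (Nat.le_pow_clog (by omega) _)
  refine ⟨((3 + Nat.clog 2 d + k : ℕ) : ℝ) * B, by positivity, ?_⟩
  intro φ g hφ hφL hg p hp hcont lam ε hε
  have hψc := hasCompactSupport_motherWavelet hφ g
  obtain ⟨M, hM, hφM⟩ := hφL.exists_ae_abs_le hφ
  obtain ⟨M', hM', hψM⟩ := (hφL.motherWavelet g).exists_ae_abs_le hψc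
  obtain ⟨Φ, h1, h2, h3, h4⟩ := hnet (isPowerApprox_pow hr0 k) hφ
    (hφL.mono (le_max_left _ _) le_rfl) hg (le_max_of_le_left hM : 0 ≤ max M M')
    (hφM.mono fun x hx => hx.trans (le_max_left _ _))
    (hψM.mono fun x hx => hx.trans (le_max_right _ _)) hp hcont (lam := lam) (ε := ε)
    (by simpa using hε) _ le_rfl
  refine ⟨Φ, h1, h2, h3, ?_⟩
  rw [h4]
  have hd := lam.one_le
  have h5 : (k : ℝ) ≤ Nat.clog 2 (d * L₁) := by
    exact_mod_cast Nat.clog_anti_left one_lt_two hr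
  have h6 := clog_two_le (d * L₁)
  have h7 := clog_two_le d
  have h8 : Real.log ((d * L₁ : ℕ) : ℝ) = Real.log d + Real.log L := by
    rw [← log_max_one L, Nat.cast_mul, Real.log_mul (by positivity) (by positivity)]
  rw [h8] at h6
  have h9 := Real.log_natCast_nonneg d
  have h10 := Real.log_natCast_nonneg L
  push_cast
  linarith

/-- The number of iterations needed for a given accuracy. -/
theorem exists_iterations {Γ ε : ℝ} (hΓ : 1 ≤ Γ) (hε : 0 < ε) (hε1 : ε < 1) {n : ℕ}
    (hn : 1 ≤ n) : ∃ m : ℕ, Γ ^ n * ((4 : ℝ) ^ m)⁻¹ < ε ∧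
      (m : ℝ) ≤ n * (1 + Real.log ε⁻¹) * (1 + Real.log Γ) := by
  have h1 : 0 ≤ Real.log ε⁻¹ := Real.log_nonneg ((one_le_inv₀ hε).2 hε1.le)
  have h2 : 0 ≤ Real.log Γ := Real.log_nonneg hΓ
  have hn' : (1 : ℝ) ≤ n := by exact_mod_cast hn
  -- Then `exp X = Γ ^ n / ε`, and since `e < 4` any integer `m > X` will do.
  set X := n * Real.log Γ + Real.log ε⁻¹ with hX
  have hX0 : 0 ≤ X := by positivity
  have hΓ0 : 0 < Γ := by linarith
  refine ⟨⌊X⌋₊ + 1, ?_, ?_⟩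
  · have h3 : Real.exp X < 4 ^ (⌊X⌋₊ + 1) := by
      calc Real.exp X < Real.exp ((⌊X⌋₊ + 1 : ℕ) : ℝ) := by
            rw [Real.exp_lt_exp]
            push_cast
            exact Nat.lt_floor_add_one X
        _ = Real.exp 1 ^ (⌊X⌋₊ + 1) := by rw [← Real.exp_nat_mul, mul_one]
        _ ≤ 4 ^ (⌊X⌋₊ + 1) := by
            gcongr
            linarith [Real.exp_one_lt_three]
    have h4 : Real.exp X = Γ ^ n * ε⁻¹ := by
      rw [hX, Real.exp_add, Real.exp_nat_mul, Real.exp_log hΓ0, Real.exp_log (by positivity)]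
    rw [h4, ← div_eq_mul_inv, div_lt_iff₀ hε] at h3
    rw [← div_eq_mul_inv, div_lt_iff₀ (by positivity)]
    linarith
  · have h3 : ((⌊X⌋₊ + 1 : ℕ) : ℝ) ≤ X + 1 := by
      push_cast
      linarith [Nat.floor_le hX0]
    refine h3.trans ?_
    rw [hX]
    nlinarith [mul_nonneg (mul_nonneg (by linarith : (0 : ℝ) ≤ n) h1) h2,
      mul_nonneg (sub_nonneg.2 hn') h1]

/-- There are `k` squarings of `m` layers each, with `k` of order `1 + log (d L)` and `m` of order
`d L (1 + log ε⁻¹)`. The base `Γ` depends only on `p₀`, `S`, `M`, so `log Γ` may enter `c`. -/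
theorem wavelet_relu_complexity (p₀ : ℝ) (S M : ℝ≥0) (hp₀ : 0 < p₀) : ∃ c : ℝ, 0 < c ∧
    ∀ d L Nφ Nψ : ℕ, ∃ C : ℝ, 0 < C ∧
      ∀ (φ : ℝ → ℝ) (g : ℤ →₀ ℝ),
        HasCompactSupport φ → IsPiecewisePolynomial L Nφ φ → g.support.card ≤ Nψ →
        volume (tsupport φ) ≤ S → volume (tsupport (motherWavelet φ g)) ≤ S →
        eLpNorm φ ∞ volume ≤ M → eLpNorm (motherWavelet φ g) ∞ volume ≤ M →
        ∀ p : ℝ≥0∞, ENNReal.ofReal p₀ ≤ p → (p = ∞ → Continuous φ) →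
        ∀ (lam : WaveletIndex d) (ε : ℝ), 0 < ε → ε < 1 →
          ∃ Φ ∈ ReLUClass d p (C * (1 + Real.log ε⁻¹)),
            tsupport (Φ.realizeScalar 1) = essSupport (wavelet φ (motherWavelet φ g) lam p) ∧
            eLpNorm (fun x => wavelet φ (motherWavelet φ g) lam p x - Φ.realizeScalar 1 x)
              p volume ≤ ENNReal.ofReal ε ∧
            (Φ.depth : ℝ) ≤
              c * (1 + L * Real.log L) * (1 + d * Real.log d) * (1 + Real.log ε⁻¹) := by
  set M₁ : ℝ := max M 1 with hM₁
  set S₁ : ℝ := max S 1 with hS₁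
  set R₁ : ℝ := S₁ ^ (1 / p₀) with hR₁
  have hM₁1 : 1 ≤ M₁ := le_max_right _ _
  have hS₁1 : 1 ≤ S₁ := le_max_right _ _
  have hR₁1 : 1 ≤ R₁ := Real.one_le_rpow hS₁1 (by positivity)
  -- With `n = d * L₁`, the factors absorb `(2 * 12 ^ L₁ * M₁) ^ d ≤ (24 * M₁) ^ n`, then `6 ^ 2 ^ k
  -- * 2 ^ k ≤ 12 ^ 2 ^ k ≤ 12 ^ (4 * n)`, and `R₁ ^ d ≤ R₁ ^ n` from the supports.
  set Γ : ℝ := 24 * M₁ * 12 ^ 4 * R₁ with hΓ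
  have hΓ1 : 1 ≤ Γ := by
    rw [hΓ]
    have : (1 : ℝ) ≤ 24 * M₁ * 12 ^ 4 := by linarith
    exact one_le_mul_of_one_le_of_one_le this hR₁1
  have hΓl : 0 ≤ Real.log Γ := Real.log_nonneg hΓ1
  -- With `U = 1 + log d + log L`, the layers outside the squarings cost `5 * U` and the squarings
  -- `2 * U * n * (1 + log ε⁻¹) * (1 + log Γ)`. The `4` comes from applying `mul_one_add_log_le` to
  -- `d` and to `L₁`.
  set c : ℝ := 4 * (7 + 2 * Real.log Γ) with hc
  have hc0 : 0 < c := by positivity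
  refine ⟨c, hc0, fun d L Nφ Nψ => ?_⟩
  set L₁ := max L 1 with hL₁
  have hL₁1 : 1 ≤ L₁ := le_max_right _ _
  -- The extra squaring ensures `k ≠ 0`, hence an even exponent, also for `d * L₁ = 1`.
  set k := Nat.clog 2 (d * L₁) + 1 with hk
  have hdk : d * L₁ ≤ 2 ^ k := (Nat.le_pow_clog one_lt_two _).trans
    (Nat.pow_le_pow_right two_pos (Nat.le_succ _))
  obtain ⟨B, hB, hnet⟩ := exists_net_wavelet one_ne_zero d L₁ Nφ Nψ (2 ^ k) (by omega) hdk
  have hlogd := Real.log_natCast_nonneg d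
  have hlogL := Real.log_natCast_nonneg L
  set A : ℝ := c * (1 + L * Real.log L) * (1 + d * Real.log d) with hA
  have hA0 : 0 < A := by positivity
  -- The number of weights is at most the depth times `B`, so the depth bound `A * (1 + log ε⁻¹)`
  -- serves for both.
  refine ⟨A * B, by positivity, ?_⟩
  intro φ g hφ hφL hg hSφ hSψ hMφ hMψ p hp hcont lam ε hε hε1
  have hd := lam.one_le
  set n := d * L₁ with hn
  have hn1 : 1 ≤ n := Nat.mul_pos hd hL₁1
  obtain ⟨m, hm, hmle⟩ := exists_iterations hΓ1 hε hε1 hn1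
  set ℓ := 1 + Real.log ε⁻¹ with hℓ
  have hℓ1 : 1 ≤ ℓ := by
    have : 0 ≤ Real.log ε⁻¹ := Real.log_nonneg ((one_le_inv₀ hε).2 hε1.le)
    linarith
  have hp0 : p ≠ 0 := by
    rintro rfl
    exact (ENNReal.ofReal_pos.2 hp₀).not_ge hp
  have hcoe : ∀ T : ℝ≥0, (T : ℝ≥0∞) ≤ ENNReal.ofReal (max T 1) := fun T => by
    rw [← ENNReal.ofReal_coe_nnreal]
    exact ENNReal.ofReal_le_ofReal (le_max_left _ _)
  have hdepth : ((3 + Nat.clog 2 d + (1 + k * m) : ℕ) : ℝ) ≤ A * ℓ := by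
    have h1 := clog_two_le d
    have h2 : (k : ℝ) ≤ 2 * (1 + Real.log d + Real.log L) := by
      have h := clog_two_le n
      rw [hn, Nat.cast_mul, Real.log_mul (by positivity) (by positivity), log_max_one] at h
      rw [hk]
      push_cast
      linarith
    set U := 1 + Real.log d + Real.log L with hU
    have hU1 : 1 ≤ U := by linarith
    have h3 : (1 : ℝ) ≤ n * ℓ := one_le_mul_of_one_le_of_one_le (by exact_mod_cast hn1) hℓ1
    have h4 : (k : ℝ) * m ≤ 2 * U * (n * ℓ * (1 + Real.log Γ)) :=
      mul_le_mul h2 hmle (Nat.cast_nonneg _) (by positivity)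
    have h5 : U ≤ U * (n * ℓ) := le_mul_of_one_le_right (by linarith) h3
    have h6 : U * n ≤ 4 * ((1 + L * Real.log L) * (1 + d * Real.log d)) := by
      have h7 := mul_one_add_log_le hd
      have h8 := mul_one_add_log_le hL₁1
      rw [max_one_mul_log, log_max_one] at h8
      calc U * n ≤ (1 + Real.log d) * (1 + Real.log L) * n := by
            gcongr
            nlinarith [mul_nonneg hlogd hlogL]
        _ = (d * (1 + Real.log d)) * (L₁ * (1 + Real.log L)) := by
            rw [hn]
            push_cast
            ring
        _ ≤ (2 * (1 + d * Real.log d)) * (2 * (1 + L * Real.log L)) := by gcongr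
        _ = _ := by ring
    calc ((3 + Nat.clog 2 d + (1 + k * m) : ℕ) : ℝ) ≤ 5 * U + k * m := by
          push_cast
          linarith
      _ ≤ 5 * (U * (n * ℓ)) + 2 * U * (n * ℓ * (1 + Real.log Γ)) := by gcongr
      _ = (U * n) * (7 + 2 * Real.log Γ) * ℓ := by ring
      _ ≤ (4 * ((1 + L * Real.log L) * (1 + d * Real.log d))) * (7 + 2 * Real.log Γ) * ℓ := by
          gcongr
      _ = A * ℓ := by
          rw [hA, hc]
          ring
  have herr : ((2 * (12 ^ L₁ * M₁)) ^ d * (6 ^ 2 ^ k * (2 ^ k * ((4 : ℝ) ^ m)⁻¹))) * R₁ ^ d <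
      ε := by
    refine lt_of_le_of_lt ?_ hm
    have h1 : 2 ^ k ≤ 4 * n := by
      rw [hk, pow_succ]
      have := two_pow_clog_le hn1
      omega
    have h2 : (2 * (12 ^ L₁ * M₁)) ^ d ≤ (24 * M₁) ^ n := by
      have : 2 * (12 ^ L₁ * M₁) ≤ (24 * M₁) ^ L₁ := by
        have e1 : (2 : ℝ) ≤ 2 ^ L₁ := le_self_pow₀ one_le_two (by omega)
        have e2 : M₁ ≤ M₁ ^ L₁ := le_self_pow₀ hM₁1 (by omega)
        calc 2 * (12 ^ L₁ * M₁) ≤ 2 ^ L₁ * (12 ^ L₁ * M₁ ^ L₁) := by gcongr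
          _ = (24 * M₁) ^ L₁ := by
            rw [← mul_pow, ← mul_pow]
            ring
      rw [hn, mul_comm d, pow_mul]
      gcongr
    have h3 : (6 : ℝ) ^ 2 ^ k * 2 ^ k ≤ (12 ^ 4) ^ n := by
      have e1 : (2 : ℝ) ^ k ≤ 2 ^ 2 ^ k :=
        pow_le_pow_right₀ one_le_two Nat.lt_two_pow_self.le
      calc (6 : ℝ) ^ 2 ^ k * 2 ^ k ≤ 6 ^ 2 ^ k * 2 ^ 2 ^ k := by gcongr
        _ = 12 ^ 2 ^ k := by rw [← mul_pow]; norm_num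
        _ ≤ 12 ^ (4 * n) := pow_le_pow_right₀ (by norm_num) h1
        _ = _ := by rw [pow_mul]
    have h4 : R₁ ^ d ≤ R₁ ^ n := pow_le_pow_right₀ hR₁1 (Nat.le_mul_of_pos_right d hL₁1)
    calc _ = (2 * (12 ^ L₁ * M₁)) ^ d * (6 ^ 2 ^ k * 2 ^ k) * R₁ ^ d * ((4 : ℝ) ^ m)⁻¹ := by ring
      _ ≤ (24 * M₁) ^ n * (12 ^ 4) ^ n * R₁ ^ n * ((4 : ℝ) ^ m)⁻¹ := by gcongr
      _ = Γ ^ n * ((4 : ℝ) ^ m)⁻¹ := by rw [hΓ, mul_pow _ R₁, mul_pow (24 * M₁)]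
  obtain ⟨Φ, h1, h2, h3, h4⟩ := hnet (isPowerApprox_sqApprox m (k := k) (by omega)) hφ
    (hφL.mono (le_max_left _ _) le_rfl) hg (by positivity : (0 : ℝ) ≤ M₁)
    ((ae_abs_le_of_eLpNorm_top_le hMφ).mono fun x hx => hx.trans (le_max_left _ _))
    ((ae_abs_le_of_eLpNorm_top_le hMψ).mono fun x hx => hx.trans (le_max_left _ _))
    hp0 hcont (lam := lam) (ε := ε)
    ((normalized_volume_le lam hp₀ hp hS₁1 (hSφ.trans (hcoe S)) (hSψ.trans (hcoe S))
      (by positivity)).trans_lt ((ENNReal.ofReal_lt_ofReal_iff hε).2 herr))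
    (A * B * ℓ) (by
      rw [mul_right_comm]
      exact mul_le_mul_of_nonneg_right hdepth (Nat.cast_nonneg _))
  exact ⟨Φ, h1, h2, h3, by rw [h4]; exact hdepth⟩

end

theorem mainTheorem3 :
    -- (i) RePU networks
    (∀ r : ℕ, 2 ≤ r → ∃ c : ℝ, 0 < c ∧
      ∀ d L Nφ Nψ : ℕ, ∃ C : ℝ, 0 < C ∧
        ∀ (φ : ℝ → ℝ) (g : ℤ →₀ ℝ),
          HasCompactSupport φ → IsPiecewisePolynomial L Nφ φ → g.support.card ≤ Nψ →
          ∀ p : ℝ≥0∞, p ≠ 0 → (p = ∞ → Continuous φ) →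
          ∀ (lam : WaveletIndex d) (ε : ℝ), 0 < ε →
            ∃ Φ ∈ RePUClass r d p C,
              tsupport (Φ.realizeScalar r) = essSupport (wavelet φ (motherWavelet φ g) lam p) ∧
              eLpNorm (fun x => wavelet φ (motherWavelet φ g) lam p x - Φ.realizeScalar r x)
                p volume ≤ ENNReal.ofReal ε ∧
              (Φ.depth : ℝ) ≤ c * (1 + Real.log L + Real.log d)) ∧
    -- (ii) ReLU networks
    (∀ (p₀ : ℝ) (S M : ℝ≥0), 0 < p₀ → ∃ c : ℝ, 0 < c ∧
      ∀ d L Nφ Nψ : ℕ, ∃ C : ℝ, 0 < C ∧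
        ∀ (φ : ℝ → ℝ) (g : ℤ →₀ ℝ),
          HasCompactSupport φ → IsPiecewisePolynomial L Nφ φ → g.support.card ≤ Nψ →
          volume (tsupport φ) ≤ S → volume (tsupport (motherWavelet φ g)) ≤ S →
          eLpNorm φ ∞ volume ≤ M → eLpNorm (motherWavelet φ g) ∞ volume ≤ M →
          ∀ p : ℝ≥0∞, ENNReal.ofReal p₀ ≤ p → (p = ∞ → Continuous φ) →
          ∀ (lam : WaveletIndex d) (ε : ℝ), 0 < ε → ε < 1 →
            ∃ Φ ∈ ReLUClass d p (C * (1 + Real.log ε⁻¹)),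
              tsupport (Φ.realizeScalar 1) = essSupport (wavelet φ (motherWavelet φ g) lam p) ∧
              eLpNorm (fun x => wavelet φ (motherWavelet φ g) lam p x - Φ.realizeScalar 1 x)
                p volume ≤ ENNReal.ofReal ε ∧
              (Φ.depth : ℝ) ≤
                c * (1 + L * Real.log L) * (1 + d * Real.log d) * (1 + Real.log ε⁻¹)) :=
  ⟨wavelet_repu_complexity, wavelet_relu_complexity⟩
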